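/- Let $0<\alpha<1$ and $0<p<1$. Fourier transforms are normalised by $\hat\varphi(x)=\int_{\mathbb R}e^{-ix\xi}\varphi(\xi)\,d\xi$ (extended to tempered distributions by duality), Laplace transforms by $\int_0^\infty e^{-st}(\cdot)\,dt$; powers of complex numbers are principal, and $I^{\beta}y(t)=\frac1{\Gamma(\beta)}\int_0^t(t-s)^{\beta-1}y(s)\,ds$. Let $\mathcal E$ be the class of functions $w:\mathbb R\times(0,\infty)\to\mathbb R$ that are Lebesgue measurable, satisfy $w(\cdot,t)\in C_0(\mathbb R)$ for almost every $t>0$, are of exponential type in $t$ uniformly in $x$ (there are $M,a,t_0$ with $|w(x,t)|\le Me^{at}$ for all $t\ge t_0$ and all $x$), and for which there is $\rho:(0,\infty)\to\mathbb R$, integrable on $(0,T)$ for every $T<\infty$, with $\sup_x|w(x,t)|\le\rho(t)$ for almost every $t>0$. For $f\in\mathcal E$ and $g\in C_0(\mathbb R)$, a mild solution of $$p(\partial_t-\partial_x)^\alpha u+(1-p)(\partial_t+\partial_x)^\alpha u=f,\qquad \lim_{t\to0^+}I_t^{1-\alpha}u(x,t)=g(x)\qquad(\ast)$$ is a function $u\in\mathcal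 E$ such that (i) with $U(\cdot,s)$, $F(\cdot,s)$ the Fourier–Laplace transforms of $u$ and $f$ (tempered distributions in $\xi$), there is $a>0$ such that for all $s\in\mathbb C$ with $\operatorname{Re}s>a$ $$p\big[(s-i\xi)^\alpha U(\xi,s)-\hat g(\xi)\big]+(1-p)\big[(s+i\xi)^\alpha U(\xi,s)-\hat g(\xi)\big]=F(\xi,s)\quad\text{in }\mathcal S'(\mathbb R_\xi);$$ (ii) for every $x\in\mathbb R$, the integral defining $I_t^{1-\alpha}u(x,t)$ converges absolutely for all sufficiently small $t>0$, and $I_t^{1-\alpha}u(x,t)\to g(x)$ as $t\to0^+$. Then there is a kernel $G_t(x)$, $t>0$, $x\in\mathbb R$, real valued and depending only on $\alpha$ and $p$, with $$G_t=\mathcal F^{-1}\Big\{\mathcal L^{-1}\Big\{\frac1{p(s-i\xi)^\alpha+(1-p)(s+i\xi)^\alpha}\Big\}(t)\Big\},$$ that is, for each $\xi$ there is a continuous function $P(\xi,\cdot)$ on $(0,\infty)$ whose Laplace transform converges absolutely to $1/\big(p(s-i\xi)^\alpha+(1-p)(s+i\xi)^\alpha\big)$ for $\operatorname{Re}s>0$,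 and for each $t>0$ the function $G_t$ is the inverse Fourier transform of $P(\cdot,t)$ in the sense of tempered distributions. It satisfies $$G_t(x)=t^{\alpha-2}G_1(x/t)\quad(t>0,\ x\in\mathbb R),\qquad \|G_1\|_{L^1(\mathbb R)}<\infty .$$ For all $f\in\mathcal E$ and $g\in C_0(\mathbb R)$, problem $(\ast)$ has a unique mild solution (uniqueness being understood up to a null set of times $t$), given by the Duhamel formula $$u(x,t)=(G_t*g)(x)+\int_0^t\big(G_{t-\tau}*f(\cdot,\tau)\big)(x)\,d\tau ,$$ where for almost every $t>0$ the space-time integral over $\mathbb R\times(0,t)$ converges absolutely for all $x$. If moreover $f$ is bounded on $\mathbb R\times[a,b]$ for all $0<a<b<\infty$, then the integral converges absolutely for every $t>0$ and $x\in\mathbb R$, $u(\cdot,t)\in C_0(\mathbb R)$ for every $t>0$, and $u$ is continuous on $\mathbb R\times(0,\infty)$. -/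

import Mathlib

open MeasureTheory Set Filter Topology
open scoped ZeroAtInfty SchwartzMap

noncomputable section

/-- The Riemann-Liouville fractional integral of order `β > 0`,
`I^β y (t) = Γ(β)⁻¹ ∫₀ᵗ (t - s)^(β-1) y(s) ds`. -/
def fracIntegral (β : ℝ) (y : ℝ → ℝ) (t : ℝ) : ℝ :=
  (Real.Gamma β)⁻¹ * ∫ s in (0 : ℝ)..t, (t - s) ^ (β - 1) * y s

/-- Functions `w(x,t)` on `ℝ × (0,∞)`, in `C₀(ℝ)` with respect to `x` and of exponential type with
respect to `t` (uniformly in `x`), whose supremum in `x` is locally integrable on `[0,∞)`.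
Values at `t ≤ 0` play no role. -/
structure IsExpTypeC0 (w : ℝ → ℝ → ℝ) : Prop where
  measurable : AEStronglyMeasurable (fun z : ℝ × ℝ => w z.1 z.2)
    (volume.restrict (univ ×ˢ Ioi (0 : ℝ)))
  zeroAtInfty : ∀ᵐ t ∂(volume.restrict (Ioi (0 : ℝ))), ∃ h : C₀(ℝ, ℝ), ∀ x, h x = w x t
  locallyIntegrable : ∃ ρ : ℝ → ℝ, (∀ T : ℝ, IntegrableOn ρ (Ioc 0 T)) ∧
    ∀ᵐ t ∂(volume.restrict (Ioi (0 : ℝ))), ∀ x, |w x t| ≤ ρ t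
  expType : ∃ M a t₀ : ℝ, ∀ t, t₀ ≤ t → ∀ x, |w x t| ≤ M * Real.exp (a * t)

/-- The Fourier transform `∫ e^{-ixξ} φ(ξ) dξ` of a function on the line. -/
def fourierT (φ : ℝ → ℂ) (x : ℝ) : ℂ :=
  ∫ ξ : ℝ, Complex.exp (-(Complex.I * x * ξ)) * φ ξ

/-- The Fourier transform of `g`, as a tempered distribution, applied to `φ`:
`⟨ĝ, φ⟩ = ⟨g, φ̂⟩`. -/
def fourierPair (g : ℝ → ℝ) (φ : ℝ → ℂ) : ℂ :=
  ∫ x : ℝ, (g x : ℂ) * fourierT φ x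

/-- The Fourier-Laplace transform of `w` at the Laplace variable `s`, as a tempered distribution in
the Fourier variable, applied to `φ`: `∫₀^∞ e^{-st} ⟨w(·,t)^, φ⟩ dt`. -/
def fourierLaplacePair (w : ℝ → ℝ → ℝ) (s : ℂ) (φ : ℝ → ℂ) : ℂ :=
  ∫ t in Ioi (0 : ℝ), Complex.exp (-(s * t)) * fourierPair (fun x => w x t) φ

/-- The Fourier-Laplace transform (applied to `φ`) of the Riemann-Liouville type fractional
material derivative `(∂ₜ + ε ∂ₓ)^α u`, `ε = ±1`, of a function with `I^{1-α} u = g` at `t = 0`: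
it is `(s + ε i ξ)^α û(ξ,s) - ĝ(ξ)`. -/
def materialDerivPair (α ε : ℝ) (u : ℝ → ℝ → ℝ) (g : ℝ → ℝ) (s : ℂ) (φ : ℝ → ℂ) : ℂ :=
  fourierLaplacePair u s (fun ξ => (s + ε * (Complex.I * ξ)) ^ (α : ℂ) * φ ξ) - fourierPair g φ

/-- Mild solutions of
`p (∂ₜ - ∂ₓ)^α u + (1 - p) (∂ₜ + ∂ₓ)^α u = f`, `lim_{t → 0⁺} I^{1-α} u = g`:
the equation holds on the Fourier-Laplace side, as an identity of tempered distributions in `ξ`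
for every `s` in some right half plane, and the initial condition holds at every point `x`. -/
structure IsMildSolution (α p : ℝ) (f : ℝ → ℝ → ℝ) (g : ℝ → ℝ) (u : ℝ → ℝ → ℝ) : Prop where
  expTypeC0 : IsExpTypeC0 u
  equation : ∃ a : ℝ, 0 < a ∧ ∀ s : ℂ, a < s.re → ∀ φ : 𝓢(ℝ, ℂ),
    (p : ℂ) * materialDerivPair α (-1) u g s φ + (1 - p : ℂ) * materialDerivPair α 1 u g s φ
      = fourierLaplacePair f s φ
  fracIntegrable : ∀ x, ∀ᶠ t in 𝓝[>] (0 : ℝ),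
    IntervalIntegrable (fun s => (t - s) ^ (-α) * u x s) volume 0 t
  initial : ∀ x, Tendsto (fun t => fracIntegral (1 - α) (u x) t) (𝓝[>] 0) (𝓝 (g x))

/-- `ζ(ξ,s) = p (s - iξ)^α + (1 - p) (s + iξ)^α`, with principal branches. -/
def symbolZeta (α p : ℝ) (ξ : ℝ) (s : ℂ) : ℂ :=
  p * (s - Complex.I * ξ) ^ (α : ℂ) + (1 - p) * (s + Complex.I * ξ) ^ (α : ℂ)

/-- `P` is the inverse Laplace transform of `F` (given on `Re s > 0`): the continuous function on
`(0,∞)` whose Laplace transform is `F`. -/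
def IsInverseLaplace (F : ℂ → ℂ) (P : ℝ → ℂ) : Prop :=
  ContinuousOn P (Ioi 0) ∧ ∀ s : ℂ, 0 < s.re →
    IntegrableOn (fun t : ℝ => Complex.exp (-(s * t)) * P t) (Ioi 0) ∧
    ∫ t in Ioi (0 : ℝ), Complex.exp (-(s * t)) * P t = F s

/-- The function `G` is the inverse Fourier transform of `P`, in the sense of tempered
distributions: `⟨P, φ⟩ = ⟨G, φ̂⟩` for all Schwartz functions `φ`. -/
def IsInverseFourier (P : ℝ → ℂ) (G : ℝ → ℝ) : Prop :=
  ∀ φ : 𝓢(ℝ, ℂ), Integrable (fun ξ => P ξ * φ ξ) ∧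
    Integrable (fun x => (G x : ℂ) * fourierT φ x) ∧
    ∫ ξ : ℝ, P ξ * φ ξ = ∫ x : ℝ, (G x : ℂ) * fourierT φ x

/-- `G t = 𝓕⁻¹{ 𝓛⁻¹{ K(ξ,s) }(t) }` for every `t > 0`. -/
def IsInverseFourierLaplace (K : ℝ → ℂ → ℂ) (G : ℝ → ℝ → ℝ) : Prop :=
  ∃ P : ℝ → ℝ → ℂ, (∀ ξ, IsInverseLaplace (K ξ) (P ξ)) ∧
    ∀ t, 0 < t → IsInverseFourier (fun ξ => P ξ t) (G t)

/-- Duhamel's formula `(G_t * g)(x) + ∫₀ᵗ (G_{t-τ} * f(·,τ))(x) dτ`. -/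
def duhamel (G : ℝ → ℝ → ℝ) (f : ℝ → ℝ → ℝ) (g : ℝ → ℝ) (x t : ℝ) : ℝ :=
  (∫ y, G t (x - y) * g y) + ∫ τ in (0 : ℝ)..t, ∫ y, G (t - τ) (x - y) * f y τ

/-- Absolute convergence of the space-time integral in Duhamel's formula at `(x,t)`. -/
def DuhamelConverges (G : ℝ → ℝ → ℝ) (f : ℝ → ℝ → ℝ) (x t : ℝ) : Prop :=
  IntegrableOn (fun z : ℝ × ℝ => G (t - z.2) (x - z.1) * f z.1 z.2) (univ ×ˢ Ioo 0 t)

end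

/-! Write `u = s - iξ`, `v = s + iξ`, `q = 1 - p`. Taking out the geometric mean of its two terms,
the symbol becomes `2√(pq) (uv)^(α/2) cosh(θ/2)` with `θ = α(log u - log v) + log(p/q)`
(`symbolZeta_eq`). For `Re s > 0` one has `|Im θ| < π`, so the symbol has no zeros and `1/cosh(θ/2)
= ∫ e^{-iθy}/cosh(πy) dy` (`integral_exp_div_cosh_pi`). Thus the reciprocal symbol is a
superposition over `y` of `u^(-A) v^(-B)` with `A = α/2 + iαy` and `B` its conjugate. Each such
product is a product of two Laplace integrals, hence an integral over `t > 0`, `0 < x < 1` of a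
Beta-type density times `e^{-t(u(1-x)+vx)} = e^{-st} e^{-iξt(2x-1)}`; the power of `t` is `t^(A+B-1)
= t^(α-1)` for every `y` (`integral_Ioi_cpow_mul_simplex`). Integrating in `y` first exhibits the
kernel as `t^(α-2) Φ(x/t)` with `Φ` supported in `[-1,1]`. The `y`-integral converges because
`|Γ(α/2 + iαy)|²` decays, up to a polynomial factor, no faster than `e^{-πα|y|}`, which `1/cosh(πy)`
beats when `α < 1` (`integrable_barnesWeight`). So `Φ` is bounded by a multiple of a Beta density
and lies in `L¹`.

From there on only `Φ ∈ L¹` and its Fourier-Laplace identity matter. Duhamel's formula is a time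
convolution of `σ^(α-1)` with averages of the data against `Φ`; Young-type bounds place it in the
solution class, and Fubini turns its Fourier-Laplace transform into division by the symbol
(`fourierLaplacePair_duhamelAvg`). Testing with symbol times a Schwartz function gives the equation.
The initial condition follows from `I^(1-α) I^α = I^1` and `Γ(α) ∫ Φ = 1`
(`isMildSolution_duhamelAvg`).

For uniqueness, dividing test functions by the symbol shows that two mild solutions have the same
Fourier-Laplace transform; injectivity of the Laplace transform, a countable family of test
functions and continuity in `x` finish (`IsMildSolution.ae_eq`). Joint continuity for locally
bounded sources comes from cutting off the singularity at `τ = t`, with an error that is locally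
uniformly small (`continuousOn_duhamelAvg`). -/

open scoped FourierTransform

/-! ### Gamma integrals with complex rate -/

theorem integrableOn_rpow_mul_exp_neg_mul {σ c : ℝ} (hσ : 0 < σ) (hc : 0 < c) :
    IntegrableOn (fun t : ℝ => t ^ (σ - 1) * Real.exp (-(c * t))) (Ioi 0) := by
  have := integrableOn_rpow_mul_exp_neg_mul_rpow (p := 1) (s := σ - 1) (b := c)
    (by linarith) one_pos hc
  refine this.congr_fun (fun t ht => ?_) measurableSet_Ioi
  simp

theorem norm_ofReal_cpow_mul_exp {a r : ℂ} {t : ℝ} (ht : 0 < t) :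
    ‖(t : ℂ) ^ (a - 1) * Complex.exp (-(r * t))‖ = t ^ (a.re - 1) * Real.exp (-(r.re * t)) := by
  rw [norm_mul, Complex.norm_cpow_eq_rpow_re_of_pos ht, Complex.norm_exp]
  simp

theorem continuousOn_ofReal_cpow_const (a : ℂ) :
    ContinuousOn (fun t : ℝ => (t : ℂ) ^ a) (Ioi 0) := by
  intro t ht
  refine ContinuousAt.continuousWithinAt ?_
  exact Complex.continuousAt_ofReal_cpow_const _ _ (Or.inr (ne_of_gt ht))

theorem integrableOn_cpow_mul_exp_neg {a r : ℂ} (ha : 0 < a.re) (hr : 0 < r.re) :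
    IntegrableOn (fun t : ℝ => (t : ℂ) ^ (a - 1) * Complex.exp (-(r * t))) (Ioi 0) := by
  refine Integrable.mono' (integrableOn_rpow_mul_exp_neg_mul ha hr) ?_ ?_
  · exact ((continuousOn_ofReal_cpow_const _).mul (by fun_prop)).aestronglyMeasurable
      measurableSet_Ioi
  · filter_upwards [ae_restrict_mem measurableSet_Ioi] with t ht
    exact (norm_ofReal_cpow_mul_exp ht).le

/-- Differentiation under the integral: near `r` the decay rate stays above `r.re / 2`, and the
extra factor `t` only raises the exponent of the dominating function by one. -/
theorem differentiableOn_integral_cpow_mul_exp_neg {a : ℂ} (ha : 0 < a.re) :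
    DifferentiableOn ℂ (fun r : ℂ => ∫ t : ℝ in Ioi 0, (t : ℂ) ^ (a - 1) * Complex.exp (-(r * t)))
      {r | 0 < r.re} := by
  intro r hr
  simp only [mem_ofPred_eq] at hr
  have hopen : {z : ℂ | r.re / 2 < z.re} ∈ 𝓝 r :=
    (isOpen_lt continuous_const Complex.continuous_re).mem_nhds (by
      simp only [mem_ofPred_eq]; linarith)
  have key := hasDerivAt_integral_of_dominated_loc_of_deriv_le
    (μ := volume.restrict (Ioi (0 : ℝ)))
    (F := fun (r : ℂ) (t : ℝ) => (t : ℂ) ^ (a - 1) * Complex.exp (-(r * t)))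
    (F' := fun (r : ℂ) (t : ℝ) => (t : ℂ) ^ (a - 1) * (Complex.exp (-(r * t)) * (-(t : ℂ))))
    (bound := fun t => t ^ ((a.re + 1) - 1) * Real.exp (-((r.re / 2) * t)))
    (x₀ := r) hopen ?_ (integrableOn_cpow_mul_exp_neg ha hr) ?_ ?_ ?_ ?_
  · exact key.2.differentiableAt.differentiableWithinAt
  · refine Eventually.of_forall fun z => ?_
    exact ((continuousOn_ofReal_cpow_const _).mul (by fun_prop)).aestronglyMeasurable
      measurableSet_Ioi
  · exact ((continuousOn_ofReal_cpow_const _).mul (by fun_prop)).aestronglyMeasurable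
      measurableSet_Ioi
  · filter_upwards [ae_restrict_mem measurableSet_Ioi] with t ht z hz
    have ht' : (0 : ℝ) < t := ht
    rw [← mul_assoc, norm_mul, norm_ofReal_cpow_mul_exp ht, norm_neg, Complex.norm_real,
      Real.norm_of_nonneg ht'.le]
    have : t ^ ((a.re + 1) - 1) = t ^ (a.re - 1) * t := by
      rw [← Real.rpow_add_one ht'.ne']; ring_nf
    rw [this, mul_right_comm]
    have hz' : r.re / 2 < z.re := hz
    gcongr
  · exact integrableOn_rpow_mul_exp_neg_mul (by linarith) (by linarith)
  · refine Eventually.of_forall fun t z _ => ?_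
    have h1 : HasDerivAt (fun z : ℂ => -(z * t)) (-(t : ℂ)) z := by
      simpa using ((hasDerivAt_id z).mul_const (t : ℂ)).fun_neg
    exact (h1.cexp).const_mul _

/-- For positive real `r` this is the classical Gamma integral. Both sides are holomorphic on the
right half plane, and the real points `1 + 1/(n+1)` accumulate at `1`, so the identity theorem
applies. -/
theorem integral_cpow_mul_exp_neg_eq {a r : ℂ} (ha : 0 < a.re) (hr : 0 < r.re) :
    ∫ t : ℝ in Ioi 0, (t : ℂ) ^ (a - 1) * Complex.exp (-(r * t)) =
      r ^ (-a) * Complex.Gamma a := by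
  have hU : IsOpen {r : ℂ | 0 < r.re} := isOpen_lt continuous_const Complex.continuous_re
  have h1 := (differentiableOn_integral_cpow_mul_exp_neg ha).analyticOnNhd hU
  have h2 : AnalyticOnNhd ℂ (fun r : ℂ => r ^ (-a) * Complex.Gamma a) {r | 0 < r.re} := by
    refine DifferentiableOn.analyticOnNhd (fun z hz => ?_) hU
    refine DifferentiableAt.differentiableWithinAt ?_
    refine DifferentiableAt.mul_const ?_ _
    exact (differentiableAt_id).cpow_const (Or.inl hz)
  have hpre : IsPreconnected {r : ℂ | 0 < r.re} := (convex_halfSpace_re_gt 0).isPreconnected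
  refine h1.eqOn_of_preconnected_of_frequently_eq h2 hpre (z₀ := 1) (by simp) ?_ hr
  have hseq : Tendsto (fun n : ℕ => ((1 + 1 / ((n : ℝ) + 1) : ℝ) : ℂ)) atTop (𝓝[≠] 1) := by
    refine tendsto_nhdsWithin_iff.2 ⟨?_, Eventually.of_forall fun n => ?_⟩
    · have : Tendsto (fun n : ℕ => (1 + 1 / ((n : ℝ) + 1) : ℝ)) atTop (𝓝 (1 + 0)) :=
        tendsto_const_nhds.add tendsto_one_div_add_atTop_nhds_zero_nat
      rw [add_zero] at this
      exact (Complex.continuous_ofReal.tendsto 1).comp this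
    · simp only [mem_compl_iff, mem_singleton_iff]
      intro h
      have h3 : (1 + 1 / ((n : ℝ) + 1) : ℝ) = 1 := by exact_mod_cast h
      have : (0 : ℝ) < 1 / ((n : ℝ) + 1) := by positivity
      linarith
  refine hseq.frequently (Frequently.of_forall fun n => ?_)
  have hn : (0 : ℝ) < 1 + 1 / ((n : ℝ) + 1) := by positivity
  have := Complex.integral_cpow_mul_exp_neg_mul_Ioi ha hn
  rw [this, one_div, Complex.inv_cpow, Complex.cpow_neg]
  rw [Complex.arg_ofReal_of_nonneg hn.le]
  exact Real.pi_pos.ne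

/-! ### The Fourier transform of the hyperbolic secant -/

/-- The logistic substitution `1/(1 + e^{-x})` maps the line onto `(0,1)` and turns the integral
into the Beta integral `B(w, 1-w) = Γ(w) Γ(1-w)`, which the reflection formula evaluates. -/
theorem integral_exp_div_cosh {w : ℂ} (h0 : 0 < w.re) (h1 : w.re < 1) :
    Integrable (fun x : ℝ => Complex.exp (w * x) / (1 + Complex.exp x)) ∧
    ∫ x : ℝ, Complex.exp (w * x) / (1 + Complex.exp x) = Real.pi / Complex.sin (Real.pi * w) := by
  have hw1 : 0 < (1 - w).re := by simpa using h1
  set g : ℝ → ℂ := fun x => (x : ℂ) ^ (w - 1) * (1 - (x : ℂ)) ^ ((1 - w) - 1) with hg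
  set f : ℝ → ℝ := fun x => (1 + Real.exp (-x))⁻¹ with hf
  set f' : ℝ → ℝ := fun x => Real.exp (-x) / (1 + Real.exp (-x)) ^ 2 with hf'
  have hpos : ∀ x : ℝ, 0 < 1 + Real.exp (-x) := fun x => by positivity
  have hder : ∀ x ∈ (univ : Set ℝ), HasDerivWithinAt f (f' x) univ x := by
    intro x _
    refine HasDerivAt.hasDerivWithinAt ?_
    have : HasDerivAt (fun x : ℝ => 1 + Real.exp (-x)) (-Real.exp (-x)) x := by
      simpa using ((hasDerivAt_neg x).exp).const_add 1
    convert! this.inv (hpos x).ne' using 1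
    simp [hf']
  have hinj : InjOn f univ := by
    intro x _ y _ hxy
    have := inv_injective hxy
    have := Real.exp_injective (add_left_cancel this)
    linarith
  have himg : f '' univ = Ioo 0 1 := by
    ext y
    rw [image_univ, mem_range, mem_Ioo]
    constructor
    · rintro ⟨x, rfl⟩
      exact ⟨inv_pos.2 (hpos x), inv_lt_one_of_one_lt₀ (by linarith [Real.exp_pos (-x)])⟩
    · rintro ⟨hy0, hy1⟩
      refine ⟨-Real.log (y⁻¹ - 1), ?_⟩
      have : 0 < y⁻¹ - 1 := by
        have := (one_lt_inv₀ hy0).2 hy1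
        linarith
      simp only [hf, neg_neg, Real.exp_log this]
      simp
  have hpt : ∀ x : ℝ, |f' x| • g (f x) = Complex.exp (w * x) / (1 + Complex.exp x) := by
    intro x
    have hfx : f x = Real.exp (x - Real.log (1 + Real.exp x)) := by
      rw [Real.exp_sub, Real.exp_log (by positivity)]
      simp only [hf, Real.exp_neg]
      have := Real.exp_pos x
      field_simp
      try ring
    have h1fx : (1 - f x : ℝ) = Real.exp (- Real.log (1 + Real.exp x)) := by
      rw [Real.exp_neg, Real.exp_log (by positivity)]
      simp only [hf, Real.exp_neg]
      have := Real.exp_pos x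
      field_simp
      try ring
    have hf'x : |f' x| = Real.exp (x - 2 * Real.log (1 + Real.exp x)) := by
      rw [abs_of_pos (by simp only [hf']; have := hpos x; positivity)]
      rw [Real.exp_sub, two_mul, Real.exp_add, Real.exp_log (by positivity)]
      simp only [hf', Real.exp_neg]
      have := Real.exp_pos x
      field_simp
      try ring
    have hc : ∀ (y : ℝ) (z : ℂ), ((Real.exp y : ℝ) : ℂ) ^ z = Complex.exp (y * z) := by
      intro y z
      rw [Complex.cpow_def_of_ne_zero (by exact_mod_cast (Real.exp_pos y).ne'),
        ← Complex.ofReal_log (Real.exp_pos y).le, Real.log_exp]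
    have e1 : (1 : ℂ) - (f x : ℂ) = ((1 - f x : ℝ) : ℂ) := by push_cast; ring
    have e2 : (1 : ℂ) + Complex.exp x = Complex.exp (Real.log (1 + Real.exp x)) := by
      rw [← Complex.ofReal_exp, ← Complex.ofReal_exp, Real.exp_log (by positivity)]
      push_cast; ring
    simp only [hg]
    rw [e1, h1fx, hf'x, hfx, hc, hc, e2, Complex.real_smul, Complex.ofReal_exp,
      ← Complex.exp_sub, ← Complex.exp_add, ← Complex.exp_add]
    congr 1
    push_cast
    ring
  have hconv := Complex.betaIntegral_convergent h0 hw1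
  rw [intervalIntegrable_iff_integrableOn_Ioo_of_le zero_le_one] at hconv
  have hint := (integrableOn_image_iff_integrableOn_abs_deriv_smul MeasurableSet.univ hder hinj g).1
    (by rw [himg]; exact hconv)
  have hval := integral_image_eq_integral_abs_deriv_smul MeasurableSet.univ hder hinj g
  rw [himg] at hval
  simp only [hpt, Measure.restrict_univ, integrableOn_univ] at hint hval
  refine ⟨hint, ?_⟩
  rw [← hval, ← integral_Ioc_eq_integral_Ioo, ← intervalIntegral.integral_of_le zero_le_one]
  have hb := Complex.Gamma_mul_Gamma_eq_betaIntegral h0 hw1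
  rw [Complex.Gamma_mul_Gamma_one_sub] at hb
  simp only [add_sub_cancel, Complex.Gamma_one, one_mul] at hb
  rw [hb, Complex.betaIntegral]

/-- Since `1/cosh(πy) = 2e^{πy}/(1 + e^{2πy})`, the scaling `x = 2πy` reduces to the logistic
integral at `w = 1/2 - iθ/(2π)`; the strip `|Im θ| < π` is exactly `0 < Re w < 1`. -/
theorem integral_exp_div_cosh_pi {θ : ℂ} (hθ : |θ.im| < Real.pi) :
    Integrable (fun y : ℝ => Complex.exp (-(Complex.I * θ * y)) / Complex.cosh (Real.pi * y)) ∧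
    ∫ y : ℝ, Complex.exp (-(Complex.I * θ * y)) / Complex.cosh (Real.pi * y)
      = 1 / Complex.cosh (θ / 2) := by
  have hπ := Real.pi_pos
  have hπc : (Real.pi : ℂ) ≠ 0 := by exact_mod_cast hπ.ne'
  obtain ⟨ha, hb⟩ := abs_lt.1 hθ
  set w : ℂ := 1 / 2 - Complex.I * θ / (2 * Real.pi) with hw
  have hre : w.re = 1 / 2 + θ.im / (2 * Real.pi) := by
    have : (Complex.I * θ / (2 * Real.pi)) = Complex.I * θ / ((2 * Real.pi : ℝ) : ℂ) := by
      push_cast; ring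
    rw [hw, this, Complex.sub_re, Complex.div_ofReal_re]
    simp
    ring
  have h0 : 0 < w.re := by
    rw [hre]
    have : -(1 / 2) < θ.im / (2 * Real.pi) := by
      rw [lt_div_iff₀ (by positivity)]; linarith
    linarith
  have h1 : w.re < 1 := by
    rw [hre]
    have : θ.im / (2 * Real.pi) < 1 / 2 := by
      rw [div_lt_iff₀ (by positivity)]; linarith
    linarith
  obtain ⟨hi, hv⟩ := integral_exp_div_cosh h0 h1
  have hpt : ∀ y : ℝ, Complex.exp (-(Complex.I * θ * y)) / Complex.cosh (Real.pi * y) =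
      2 * (Complex.exp (w * ((2 * Real.pi * y : ℝ) : ℂ)) /
        (1 + Complex.exp ((2 * Real.pi * y : ℝ) : ℂ))) := by
    intro y
    have e1 : Complex.exp (w * ((2 * Real.pi * y : ℝ) : ℂ)) =
        Complex.exp (-(Complex.I * θ * y)) * Complex.exp (Real.pi * y) := by
      rw [← Complex.exp_add]
      congr 1
      rw [hw]; push_cast; field_simp; ring
    have e2 : Complex.exp ((2 * Real.pi * y : ℝ) : ℂ) =
        Complex.exp (Real.pi * y) * Complex.exp (Real.pi * y) := by
      rw [← Complex.exp_add]; congr 1; push_cast; ring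
    have hne : (1 : ℂ) + Complex.exp (Real.pi * y) * Complex.exp (Real.pi * y) ≠ 0 := by
      have : (1 : ℂ) + Complex.exp (Real.pi * y) * Complex.exp (Real.pi * y) =
          ((1 + Real.exp (Real.pi * y) * Real.exp (Real.pi * y) : ℝ) : ℂ) := by push_cast; rfl
      rw [this]
      have : (0 : ℝ) < 1 + Real.exp (Real.pi * y) * Real.exp (Real.pi * y) := by positivity
      exact_mod_cast this.ne'
    have hE := Complex.exp_ne_zero (Real.pi * y)
    rw [e1, e2, Complex.cosh, Complex.exp_neg (Real.pi * y)]
    set E := Complex.exp (Real.pi * y)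
    have : (E + E⁻¹) / 2 = (1 + E * E) / (2 * E) := by
      field_simp; ring
    rw [this]
    field_simp
  have h2π : (2 * Real.pi : ℝ) ≠ 0 := by positivity
  constructor
  · simp_rw [hpt]
    exact ((integrable_comp_mul_left_iff _ h2π).2 hi).const_mul 2
  · simp_rw [hpt]
    rw [integral_const_mul, Measure.integral_comp_mul_left
      (fun x : ℝ => Complex.exp (w * (x : ℂ)) / (1 + Complex.exp (x : ℂ))) (2 * Real.pi), hv]
    have e3 : Complex.sin (Real.pi * w) = Complex.cosh (θ / 2) := by
      have : (Real.pi : ℂ) * w = Real.pi / 2 - (θ / 2) * Complex.I := by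
        rw [hw]; field_simp
      rw [this, Complex.sin_pi_div_two_sub, Complex.cos_mul_I]
    rw [e3, abs_of_pos (by positivity), Complex.real_smul]
    push_cast
    field_simp

/-! ### Gamma on vertical lines -/

/-- On the line `Re z = 1/2` the point `1 - z` is the conjugate of `z`, so the reflection formula
computes the modulus. -/
theorem normSq_Gamma_half_add (y : ℝ) :
    ‖Complex.Gamma (1 / 2 + y * Complex.I)‖ ^ 2 = Real.pi / Real.cosh (Real.pi * y) := by
  have h := Complex.Gamma_mul_Gamma_one_sub (1 / 2 + y * Complex.I)
  have e1 : (1 : ℂ) - (1 / 2 + y * Complex.I) =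
      (starRingEnd ℂ) (1 / 2 + y * Complex.I) := by
    simp [Complex.ext_iff]; norm_num
  have e2 : Complex.sin (Real.pi * (1 / 2 + y * Complex.I)) = Complex.cosh (Real.pi * y) := by
    have : (Real.pi : ℂ) * (1 / 2 + y * Complex.I) =
        Real.pi / 2 - (-(Real.pi * y)) * Complex.I := by ring
    rw [this, Complex.sin_pi_div_two_sub, Complex.cos_mul_I, Complex.cosh_neg]
  rw [e1, e2, Complex.Gamma_conj, Complex.mul_conj'] at h
  exact_mod_cast h

theorem norm_betaIntegral_le {u v : ℂ} :
    ‖Complex.betaIntegral u v‖ ≤ ∫ x in (0 : ℝ)..1, x ^ (u.re - 1) * (1 - x) ^ (v.re - 1) := by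
  rw [Complex.betaIntegral]
  refine (intervalIntegral.norm_integral_le_integral_norm zero_le_one).trans (le_of_eq ?_)
  rw [intervalIntegral.integral_of_le zero_le_one, intervalIntegral.integral_of_le zero_le_one,
    integral_Ioc_eq_integral_Ioo, integral_Ioc_eq_integral_Ioo]
  refine setIntegral_congr_fun measurableSet_Ioo fun x hx => ?_
  have h1 : (1 : ℂ) - x = ((1 - x : ℝ) : ℂ) := by push_cast; ring
  rw [norm_mul, h1, Complex.norm_cpow_eq_rpow_re_of_pos hx.1,
    Complex.norm_cpow_eq_rpow_re_of_pos (by linarith [hx.2])]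
  simp

/-- The comparison is with the line `Re z = 1/2`, where the modulus is explicit: `Γ(1/2 + iy) Γ(σ +
1/2) = Γ(σ + 1 + iy) B(1/2 + iy, σ + 1/2)`, and the Beta factor is bounded uniformly in `y`. The
functional equation lowers `σ + 1` to `σ` and produces `σ² + y²`. -/
theorem exists_le_normSq_Gamma {σ : ℝ} (hσ : 0 < σ) :
    ∃ c : ℝ, 0 < c ∧ ∀ y : ℝ,
      c ≤ ‖Complex.Gamma (σ + y * Complex.I)‖ ^ 2 * (σ ^ 2 + y ^ 2) * Real.cosh (Real.pi * y) := by
  set δ : ℝ := 1 / 2 + σ with hδ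
  have hδ0 : 0 < δ := by positivity
  set C : ℝ := ∫ x in (0 : ℝ)..1, x ^ ((1 / 2 : ℝ) - 1) * (1 - x) ^ (δ - 1) with hC
  have hΓδ : 0 < Real.Gamma δ := Real.Gamma_pos_of_pos hδ0
  have key : ∀ y : ℝ, Real.pi * Real.Gamma δ ^ 2 ≤
      (‖Complex.Gamma (σ + y * Complex.I)‖ ^ 2 * (σ ^ 2 + y ^ 2) * Real.cosh (Real.pi * y))
        * C ^ 2 := by
    intro y
    have hb := Complex.Gamma_mul_Gamma_eq_betaIntegral (s := 1 / 2 + y * Complex.I) (t := δ)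
      (by simp) (by simpa using hδ0)
    have e1 : (1 / 2 + y * Complex.I + δ : ℂ) = (σ + y * Complex.I) + 1 := by
      rw [hδ]; push_cast; ring
    have hz : (σ + y * Complex.I : ℂ) ≠ 0 := by
      intro h
      have := congrArg Complex.re h
      simp at this
      exact hσ.ne' this
    rw [e1, Complex.Gamma_add_one _ hz] at hb
    have hB : ‖Complex.betaIntegral (1 / 2 + y * Complex.I) δ‖ ≤ C := by
      refine norm_betaIntegral_le.trans (le_of_eq ?_)
      rw [hC]
      simp
    have hn := congrArg (fun z => ‖z‖ ^ 2) hb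
    simp only [norm_mul, mul_pow] at hn
    rw [normSq_Gamma_half_add, Complex.Gamma_ofReal, Complex.norm_real,
      Real.norm_of_nonneg hΓδ.le] at hn
    have hzz : ‖(σ + y * Complex.I : ℂ)‖ ^ 2 = σ ^ 2 + y ^ 2 := by
      rw [← Complex.normSq_eq_norm_sq, Complex.normSq_add_mul_I]
    rw [hzz] at hn
    have hcosh := Real.cosh_pos (Real.pi * y)
    have : Real.pi * Real.Gamma δ ^ 2 =
        (Real.pi / Real.cosh (Real.pi * y) * Real.Gamma δ ^ 2) * Real.cosh (Real.pi * y) := by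
      field_simp
    rw [this, hn]
    have hB2 : ‖Complex.betaIntegral (1 / 2 + y * Complex.I) δ‖ ^ 2 ≤ C ^ 2 := by gcongr
    calc _ = (‖Complex.Gamma (σ + y * Complex.I)‖ ^ 2 * (σ ^ 2 + y ^ 2) *
          Real.cosh (Real.pi * y)) * ‖Complex.betaIntegral (1 / 2 + y * Complex.I) δ‖ ^ 2 := by ring
      _ ≤ _ := by gcongr
  have hpos : 0 < Real.pi * Real.Gamma δ ^ 2 := by have := Real.pi_pos; positivity
  -- If `C` vanished, the inequality `key` at `y = 0` would bound a positive number by zero.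
  have hC2 : 0 < C ^ 2 := by
    rcases (sq_nonneg C).lt_or_eq with h | h
    · exact h
    · have := key 0
      rw [← h, mul_zero] at this
      linarith
  refine ⟨Real.pi * Real.Gamma δ ^ 2 / C ^ 2, by positivity, fun y => ?_⟩
  rw [div_le_iff₀ hC2]
  exact key y

/-! ### The Mellin-Barnes weight and its integrability -/

theorem integrable_poly_mul_exp_neg_abs {c : ℝ} (hc : 0 < c) :
    Integrable (fun y : ℝ => (1 + y ^ 2) * Real.exp (-(c * |y|))) := by
  -- The constant comes from `(1 + y²)² ≤ 2 + 2y⁴` and the fourth Taylor term `(c|y|)⁴/24 ≤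
  -- e^{c|y|}`.
  refine Integrable.mono' (integrable_inv_one_add_sq.const_mul (2 + 48 / c ^ 4))
    (by fun_prop) (Eventually.of_forall fun y => ?_)
  have hx : 0 ≤ c * |y| := by positivity
  have h1 := Real.pow_div_factorial_le_exp (c * |y|) hx 4
  have h2 := Real.one_le_exp hx
  have h4 : (c * |y|) ^ 4 = c ^ 4 * y ^ 4 := by
    rw [mul_pow, Even.pow_abs (by decide)]
  rw [h4] at h1
  have h5 : y ^ 4 ≤ 24 / c ^ 4 * Real.exp (c * |y|) := by
    have : ((4).factorial : ℝ) = 24 := by norm_num [Nat.factorial]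
    rw [this, div_le_iff₀ (by norm_num)] at h1
    rw [div_mul_eq_mul_div, le_div_iff₀ (by positivity)]
    linarith
  rw [Real.norm_of_nonneg (by positivity), Real.exp_neg, ← div_eq_mul_inv, ← div_eq_mul_inv,
    div_le_div_iff₀ (by positivity) (by positivity)]
  have h6 : (1 + y ^ 2) * (1 + y ^ 2) ≤ 2 + 2 * y ^ 4 := by nlinarith [sq_nonneg (y ^ 2 - 1)]
  calc _ ≤ 2 + 2 * y ^ 4 := h6
    _ ≤ 2 * Real.exp (c * |y|) + 2 * (24 / c ^ 4 * Real.exp (c * |y|)) := by gcongr; linarith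
    _ = _ := by ring

/-- The weight of the Mellin-Barnes representation of the kernel. -/
noncomputable def barnesWeight (α y : ℝ) : ℝ :=
  (Real.cosh (Real.pi * y) *
    ‖Complex.Gamma (((α / 2 : ℝ) : ℂ) + ((α * y : ℝ) : ℂ) * Complex.I)‖ ^ 2)⁻¹

theorem barnesWeight_neg (α y : ℝ) : barnesWeight α (-y) = barnesWeight α y := by
  unfold barnesWeight
  have : (((α / 2 : ℝ) : ℂ) + ((α * -y : ℝ) : ℂ) * Complex.I) =
      (starRingEnd ℂ) (((α / 2 : ℝ) : ℂ) + ((α * y : ℝ) : ℂ) * Complex.I) := by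
    rw [map_add, map_mul, Complex.conj_ofReal, Complex.conj_ofReal, Complex.conj_I]
    push_cast; ring
  rw [this, Complex.Gamma_conj, mul_neg, Real.cosh_neg, RCLike.norm_conj]

theorem barnesWeight_nonneg (α y : ℝ) : 0 ≤ barnesWeight α y := by
  unfold barnesWeight
  have := Real.cosh_pos (Real.pi * y)
  positivity

theorem Gamma_line_ne_zero {α : ℝ} (hα : 0 < α) (y : ℝ) :
    Complex.Gamma (((α / 2 : ℝ) : ℂ) + ((α * y : ℝ) : ℂ) * Complex.I) ≠ 0 :=
  Complex.Gamma_ne_zero_of_re_pos (by simp; exact hα)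

theorem continuous_barnesWeight {α : ℝ} (hα : 0 < α) : Continuous (barnesWeight α) := by
  unfold barnesWeight
  refine Continuous.inv₀ ?_ fun y => ?_
  · refine Continuous.mul (by fun_prop) (Continuous.pow (Continuous.norm ?_) 2)
    rw [continuous_iff_continuousAt]
    intro y
    have hd := Complex.differentiableAt_Gamma
      (((α / 2 : ℝ) : ℂ) + ((α * y : ℝ) : ℂ) * Complex.I) (by
        intro m h
        have := congrArg Complex.re h
        simp at this
        have : (0 : ℝ) ≤ m := Nat.cast_nonneg m
        linarith)
    exact ContinuousAt.comp (f := fun y : ℝ => ((α / 2 : ℝ) : ℂ) + ((α * y : ℝ) : ℂ) * Complex.I)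
      hd.continuousAt (by fun_prop)
  · have h1 := Real.cosh_pos (Real.pi * y)
    have h2 := norm_pos_iff.2 (Gamma_line_ne_zero hα y)
    positivity

/-- The factor `1/cosh(πy)` gains `e^{-π|y|}`, while the reciprocal squared Gamma modulus costs at
most a quadratic polynomial times `e^{πα|y|}`. What remains decays at rate `π(1 - α)`; this is where
`α < 1` is decisive. -/
theorem integrable_barnesWeight {α : ℝ} (hα : 0 < α) (hα1 : α < 1) :
    Integrable (barnesWeight α) := by
  obtain ⟨c, hc, hle⟩ := exists_le_normSq_Gamma (σ := α / 2) (by positivity)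
  have hπ := Real.pi_pos
  refine Integrable.mono' ((integrable_poly_mul_exp_neg_abs
    (c := Real.pi * (1 - α)) (by have : 0 < 1 - α := by linarith
                                 positivity)).const_mul (2 / c))
    (continuous_barnesWeight hα).aestronglyMeasurable (Eventually.of_forall fun y => ?_)
  rw [Real.norm_of_nonneg (barnesWeight_nonneg _ _)]
  unfold barnesWeight
  have h := hle (α * y)
  set Γ2 := ‖Complex.Gamma (((α / 2 : ℝ) : ℂ) + ((α * y : ℝ) : ℂ) * Complex.I)‖ ^ 2 with hΓ
  have hΓpos : 0 < Γ2 := by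
    have h2 := norm_pos_iff.2 (Gamma_line_ne_zero hα y)
    positivity
  have h1 : (α / 2) ^ 2 + (α * y) ^ 2 ≤ 1 + y ^ 2 := by
    have : α ^ 2 ≤ 1 := by nlinarith
    nlinarith [sq_nonneg y]
  have h2 : Real.cosh (Real.pi * (α * y)) ≤ Real.exp (Real.pi * α * |y|) := by
    rw [← Real.cosh_abs, Real.cosh_eq]
    have e : |Real.pi * (α * y)| = Real.pi * α * |y| := by
      rw [abs_mul, abs_mul, abs_of_pos hπ, abs_of_pos hα]; ring
    rw [e]
    have : Real.exp (-(Real.pi * α * |y|)) ≤ Real.exp (Real.pi * α * |y|) := by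
      gcongr
      have : 0 ≤ Real.pi * α * |y| := by positivity
      linarith
    linarith
  have h3 : Real.exp (Real.pi * |y|) / 2 ≤ Real.cosh (Real.pi * y) := by
    rw [← Real.cosh_abs, Real.cosh_eq, abs_mul, abs_of_pos hπ]
    have := Real.exp_pos (-(Real.pi * |y|))
    linarith
  have h4 : c ≤ Γ2 * ((1 + y ^ 2) * Real.exp (Real.pi * α * |y|)) := by
    calc c ≤ Γ2 * ((α / 2) ^ 2 + (α * y) ^ 2) * Real.cosh (Real.pi * (α * y)) := h
      _ ≤ Γ2 * (1 + y ^ 2) * Real.exp (Real.pi * α * |y|) := by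
        have := Real.cosh_pos (Real.pi * (α * y))
        gcongr
      _ = _ := by ring
  have hcosh := Real.cosh_pos (Real.pi * y)
  rw [inv_le_comm₀ (by positivity) (by positivity)]
  have e5 : Real.exp (-(Real.pi * (1 - α) * |y|)) =
      Real.exp (Real.pi * α * |y|) / Real.exp (Real.pi * |y|) := by
    rw [← Real.exp_sub]; congr 1; ring
  rw [e5]
  calc _ = (Real.exp (Real.pi * |y|) / 2) * (c / ((1 + y ^ 2) * Real.exp (Real.pi * α * |y|))) := by
        field_simp
    _ ≤ _ := by
        gcongr
        rw [div_le_iff₀ (by positivity)]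
        exact h4

/-! ### The Mellin-Barnes representation -/

/-- A product of two Laplace integrals is the integral of the convolution of the integrands. Scaling
the convolution variable to `t x` with `0 < x < 1` pulls out `t^(A+B-1)` and combines the
exponentials. -/
theorem integral_Ioi_cpow_mul_simplex {A B u v : ℂ} (hA : 0 < A.re) (hB : 0 < B.re)
    (hu : 0 < u.re) (hv : 0 < v.re) :
    ∫ t : ℝ in Ioi 0, ∫ x : ℝ in Ioo 0 1, (t : ℂ) ^ (A + B - 1) *
      ((((1 - x : ℝ) : ℂ) ^ (A - 1) * (x : ℂ) ^ (B - 1)) *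
        Complex.exp (-(t * (u * (1 - x) + v * x)))) =
      (v ^ (-B) * Complex.Gamma B) * (u ^ (-A) * Complex.Gamma A) := by
  have hconv := integral_posConvolution (integrableOn_cpow_mul_exp_neg hB hv)
    (integrableOn_cpow_mul_exp_neg hA hu) (ContinuousLinearMap.mul ℝ ℂ)
  simp_rw [ContinuousLinearMap.mul_apply'] at hconv
  rw [integral_cpow_mul_exp_neg_eq hB hv, integral_cpow_mul_exp_neg_eq hA hu] at hconv
  rw [← hconv]
  refine setIntegral_congr_fun measurableSet_Ioi fun t ht => ?_
  have ht' : (0 : ℝ) < t := ht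
  have htc : (t : ℂ) ≠ 0 := by exact_mod_cast ht'.ne'
  have hs := intervalIntegral.smul_integral_comp_mul_left (a := 0) (b := 1)
    (fun b : ℝ => (b : ℂ) ^ (B - 1) * Complex.exp (-(v * b)) *
      (((t - b : ℝ) : ℂ) ^ (A - 1) * Complex.exp (-(u * ((t - b : ℝ) : ℂ))))) t
  rw [mul_zero, mul_one] at hs
  rw [← hs, intervalIntegral.integral_of_le zero_le_one, integral_Ioc_eq_integral_Ioo,
    ← integral_smul]
  refine setIntegral_congr_fun measurableSet_Ioo fun x hx => ?_
  have e1 : ((t - t * x : ℝ) : ℂ) = (t : ℂ) * ((1 - x : ℝ) : ℂ) := by push_cast; ring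
  rw [e1, Complex.ofReal_mul, Complex.mul_cpow_ofReal_nonneg ht'.le hx.1.le,
    Complex.mul_cpow_ofReal_nonneg ht'.le (by linarith [hx.2]), Complex.real_smul]
  have e2 : (t : ℂ) ^ (A + B - 1) = t * ((t : ℂ) ^ (B - 1) * (t : ℂ) ^ (A - 1)) := by
    rw [← Complex.cpow_add _ _ htc]
    nth_rewrite 2 [← Complex.cpow_one (t : ℂ)]
    rw [← Complex.cpow_add _ _ htc]
    congr 1; ring
  have e3 : Complex.exp (-(t * (u * (1 - x) + v * x))) =
      Complex.exp (-(v * (t * x))) * Complex.exp (-(u * (t * ((1 - x : ℝ) : ℂ)))) := by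
    rw [← Complex.exp_add]; congr 1; push_cast; ring
  rw [e2, e3]
  ring

theorem integrableOn_rpow_mul_one_sub_rpow {a b : ℝ} (ha : 0 < a) (hb : 0 < b) :
    IntegrableOn (fun x : ℝ => x ^ (a - 1) * (1 - x) ^ (b - 1)) (Ioo 0 1) := by
  have h := (Complex.betaIntegral_convergent (u := a) (v := b) (by simpa) (by simpa)).norm
  rw [intervalIntegrable_iff_integrableOn_Ioo_of_le zero_le_one] at h
  refine h.congr_fun (fun x hx => ?_) measurableSet_Ioo
  have h1 : (1 : ℂ) - x = ((1 - x : ℝ) : ℂ) := by push_cast; ring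
  simp only
  rw [norm_mul, h1, Complex.norm_cpow_eq_rpow_re_of_pos hx.1,
    Complex.norm_cpow_eq_rpow_re_of_pos (by linarith [hx.2])]
  simp

/-- The Fourier transform of the Mellin-Barnes weight. -/
noncomputable def barnesTransform (α L : ℝ) : ℝ := ∫ y : ℝ, barnesWeight α y * Real.cos (L * y)

/-- Evenness of the weight makes the integral invariant under `L ↦ -L`, so only the cosine survives.
In particular the kernel is real. -/
theorem integral_barnesWeight_mul_exp {α : ℝ} (hα : 0 < α) (hα1 : α < 1) (L : ℝ) :
    ∫ y : ℝ, (barnesWeight α y : ℂ) * Complex.exp (Complex.I * (L * y)) = barnesTransform α L := by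
  have hW := integrable_barnesWeight hα hα1
  have hi : ∀ M : ℝ, Integrable (fun y : ℝ =>
      (barnesWeight α y : ℂ) * Complex.exp (Complex.I * (M * y))) := by
    intro M
    refine Integrable.mono' hW ?_ (Eventually.of_forall fun y => ?_)
    · exact ((Complex.continuous_ofReal.comp (continuous_barnesWeight hα)).mul
        (by fun_prop)).aestronglyMeasurable
    · rw [norm_mul, Complex.norm_real, Real.norm_of_nonneg (barnesWeight_nonneg _ _)]
      have : Complex.I * (M * y) = ((M * y : ℝ) : ℂ) * Complex.I := by push_cast; ring
      rw [this, Complex.norm_exp_ofReal_mul_I, mul_one]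
  have hneg : ∫ y : ℝ, (barnesWeight α y : ℂ) * Complex.exp (Complex.I * (L * y)) =
      ∫ y : ℝ, (barnesWeight α y : ℂ) * Complex.exp (Complex.I * ((-L : ℝ) * y)) := by
    rw [← integral_neg_eq_self]
    refine integral_congr_ae (Eventually.of_forall fun y => ?_)
    simp only
    rw [barnesWeight_neg]
    push_cast
    ring_nf
  have h2 : (2 : ℂ) * ∫ y : ℝ, (barnesWeight α y : ℂ) * Complex.exp (Complex.I * (L * y)) =
      2 * (barnesTransform α L : ℂ) := by
    rw [two_mul]
    nth_rewrite 2 [hneg]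
    rw [← integral_add (hi L) (hi (-L)), barnesTransform, ← integral_complex_ofReal,
      ← integral_const_mul]
    refine integral_congr_ae (Eventually.of_forall fun y => ?_)
    simp only
    push_cast
    rw [Complex.cos]
    have e1 : Complex.I * (L * y) = (L * y : ℂ) * Complex.I := by ring
    have e2 : Complex.I * (-L * y) = -(L * y : ℂ) * Complex.I := by ring
    rw [e1, e2]
    ring
  exact mul_left_cancel₀ two_ne_zero h2

theorem abs_barnesTransform_le {α : ℝ} (hα : 0 < α) (hα1 : α < 1) (L : ℝ) :
    |barnesTransform α L| ≤ ∫ y : ℝ, barnesWeight α y := by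
  rw [barnesTransform, ← Real.norm_eq_abs]
  refine norm_integral_le_of_norm_le (integrable_barnesWeight hα hα1)
    (Eventually.of_forall fun y => ?_)
  rw [norm_mul, Real.norm_of_nonneg (barnesWeight_nonneg _ _), Real.norm_eq_abs]
  exact mul_le_of_le_one_right (barnesWeight_nonneg _ _) (Real.abs_cos_le_one _)

theorem continuous_barnesTransform {α : ℝ} (hα : 0 < α) (hα1 : α < 1) :
    Continuous (barnesTransform α) := by
  unfold barnesTransform
  refine continuous_of_dominated (bound := barnesWeight α) ?_ ?_ (integrable_barnesWeight hα hα1) ?_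
  · intro L
    exact ((continuous_barnesWeight hα).mul (by fun_prop)).aestronglyMeasurable
  · refine fun L => Eventually.of_forall fun y => ?_
    rw [norm_mul, Real.norm_of_nonneg (barnesWeight_nonneg _ _), Real.norm_eq_abs]
    exact mul_le_of_le_one_right (barnesWeight_nonneg _ _) (Real.abs_cos_le_one _)
  · exact Eventually.of_forall fun y => by fun_prop

/-- The exponent `α log ((1-x)/x) - log (p/q)` at which the Mellin-Barnes integral is evaluated. -/
noncomputable def barnesArg (α p x : ℝ) : ℝ :=
  α * (Real.log (1 - x) - Real.log x) - Real.log (p / (1 - p))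

/-- The unnormalised profile on the unit interval. -/
noncomputable def unitProfile (α p x : ℝ) : ℝ :=
  (x ^ (α / 2 - 1) * (1 - x) ^ (α / 2 - 1)) * barnesTransform α (barnesArg α p x)

theorem measurable_unitProfile {α : ℝ} (hα : 0 < α) (hα1 : α < 1) (p : ℝ) :
    Measurable (unitProfile α p) := by
  unfold unitProfile barnesArg
  refine Measurable.mul (by fun_prop) ((continuous_barnesTransform hα hα1).measurable.comp ?_)
  fun_prop

theorem integrableOn_unitProfile {α : ℝ} (hα : 0 < α) (hα1 : α < 1) (p : ℝ) :
    IntegrableOn (unitProfile α p) (Ioo 0 1) := by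
  refine Integrable.mono' ((integrableOn_rpow_mul_one_sub_rpow (half_pos hα) (half_pos hα)).mul_const
    (∫ y : ℝ, barnesWeight α y)) (measurable_unitProfile hα hα1 p).aestronglyMeasurable ?_
  filter_upwards [ae_restrict_mem measurableSet_Ioo] with x hx
  have h1 : 0 < 1 - x := by linarith [hx.2]
  have h0 : 0 < x := hx.1
  rw [unitProfile, norm_mul, Real.norm_of_nonneg (by positivity)]
  gcongr
  exact abs_barnesTransform_le hα hα1 _

/-- The exponents are conjugate: their real parts give a Beta density, their imaginary parts a pure
phase in `log((1-x)/x)`. -/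
theorem cpow_mul_cpow_line {α x y : ℝ} (hx : x ∈ Ioo (0 : ℝ) 1) :
    ((1 - x : ℝ) : ℂ) ^ ((((α / 2 : ℝ) : ℂ) + ((α * y : ℝ) : ℂ) * Complex.I) - 1) *
      (x : ℂ) ^ ((((α / 2 : ℝ) : ℂ) - ((α * y : ℝ) : ℂ) * Complex.I) - 1) =
    ((x ^ (α / 2 - 1) * (1 - x) ^ (α / 2 - 1) : ℝ) : ℂ) *
      Complex.exp (Complex.I * (((α * (Real.log (1 - x) - Real.log x) : ℝ) : ℂ) * y)) := by
  have h1 : 0 < 1 - x := by linarith [hx.2]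
  have h0 : 0 < x := hx.1
  rw [Complex.cpow_def_of_ne_zero (by exact_mod_cast h1.ne'),
    Complex.cpow_def_of_ne_zero (by exact_mod_cast h0.ne'), Real.rpow_def_of_pos h0,
    Real.rpow_def_of_pos h1, ← Complex.ofReal_log h1.le, ← Complex.ofReal_log h0.le]
  rw [← Real.exp_add, Complex.ofReal_exp, ← Complex.exp_add, ← Complex.exp_add]
  congr 1
  push_cast
  ring

theorem Gamma_mul_Gamma_conj_line (α y : ℝ) :
    Complex.Gamma (((α / 2 : ℝ) : ℂ) - ((α * y : ℝ) : ℂ) * Complex.I) *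
      Complex.Gamma (((α / 2 : ℝ) : ℂ) + ((α * y : ℝ) : ℂ) * Complex.I) =
    ((‖Complex.Gamma (((α / 2 : ℝ) : ℂ) + ((α * y : ℝ) : ℂ) * Complex.I)‖ ^ 2 : ℝ) : ℂ) := by
  have : (((α / 2 : ℝ) : ℂ) - ((α * y : ℝ) : ℂ) * Complex.I) =
      (starRingEnd ℂ) (((α / 2 : ℝ) : ℂ) + ((α * y : ℝ) : ℂ) * Complex.I) := by
    rw [map_add, map_mul, Complex.conj_ofReal, Complex.conj_ofReal, Complex.conj_I]
    ring
  rw [this, Complex.Gamma_conj, Complex.conj_mul']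
  push_cast; rfl

/-- Each of the two arguments lies in `(-π/2, π/2)`. This keeps the argument of the secant integral
inside its strip. -/
theorem abs_log_sub_log_im_lt {u v : ℂ} (hu : 0 < u.re) (hv : 0 < v.re) :
    |(Complex.log u - Complex.log v).im| < Real.pi := by
  have h1 := Complex.abs_arg_lt_pi_div_two_iff.2 (Or.inl hu)
  have h2 := Complex.abs_arg_lt_pi_div_two_iff.2 (Or.inl hv)
  rw [Complex.sub_im, Complex.log_im, Complex.log_im]
  rw [abs_lt] at *
  constructor <;> linarith [h1.1, h1.2, h2.1, h2.2]

/-- The weight is designed so that the Gamma factors produced by the Laplace integrals cancel,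
leaving the density of the secant formula. -/
theorem barnesWeight_eq_div {α : ℝ} (hα : 0 < α) (y : ℝ) :
    (barnesWeight α y : ℂ) * (Complex.Gamma (((α / 2 : ℝ) : ℂ) - ((α * y : ℝ) : ℂ) * Complex.I) *
      Complex.Gamma (((α / 2 : ℝ) : ℂ) + ((α * y : ℝ) : ℂ) * Complex.I)) =
    1 / Complex.cosh (Real.pi * y) := by
  rw [Gamma_mul_Gamma_conj_line, barnesWeight]
  have h2 := norm_pos_iff.2 (Gamma_line_ne_zero hα y)
  have h3 := Real.cosh_pos (Real.pi * y)
  have : Complex.cosh (Real.pi * y) = ((Real.cosh (Real.pi * y) : ℝ) : ℂ) := by push_cast; rfl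
  rw [this, ← Complex.ofReal_mul, ← Complex.ofReal_one, ← Complex.ofReal_div]
  congr 1
  generalize ‖Complex.Gamma (((α / 2 : ℝ) : ℂ) + ((α * y : ℝ) : ℂ) * Complex.I)‖ = N at *
  field_simp

/-- The two-sided integral of the unnormalised profile. -/
theorem integral_unitProfile_eq {α p : ℝ} (hα : 0 < α) (hα1 : α < 1) {u v : ℂ}
    (hu : 0 < u.re) (hv : 0 < v.re) :
    ∫ t : ℝ in Ioi 0, ∫ x : ℝ in Ioo 0 1, ((t ^ (α - 1) : ℝ) : ℂ) *
      (Complex.exp (-(t * (u * (1 - x) + v * x))) * unitProfile α p x) =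
      Complex.exp (-(α / 2 * (Complex.log u + Complex.log v))) /
        Complex.cosh ((α * (Complex.log u - Complex.log v) + Real.log (p / (1 - p))) / 2) := by
  set c := min u.re v.re with hc
  have hc0 : 0 < c := lt_min hu hv
  set H : (ℝ × ℝ) → ℝ → ℂ := fun z y =>
    (((z.1 ^ (α - 1) : ℝ) : ℂ) * (Complex.exp (-(z.1 * (u * (1 - z.2) + v * z.2))) *
      ((z.2 ^ (α / 2 - 1) * (1 - z.2) ^ (α / 2 - 1) : ℝ) : ℂ))) *
      ((barnesWeight α y : ℂ) * Complex.exp (Complex.I * (barnesArg α p z.2 * y))) with hH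
  set μ := (volume.restrict (Ioi (0 : ℝ))).prod (volume.restrict (Ioo (0 : ℝ) 1)) with hμ
  have hμr : μ = (volume : Measure (ℝ × ℝ)).restrict (Ioi 0 ×ˢ Ioo 0 1) := by
    rw [hμ, Measure.prod_restrict]; rfl
  have hmeas : Measurable (Function.uncurry H) := by
    simp only [hH, Function.uncurry_def, barnesArg]
    have := (continuous_barnesWeight hα).measurable
    fun_prop
  -- Absolute convergence in `(t,x,y)`: since `u(1-x) + vx` has real part at least `c`, the
  -- integrand is dominated by a tensor product of a Gamma density, a Beta density and the weight.
  have hInt : Integrable (Function.uncurry H) (μ.prod volume) := by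
    have hb := ((integrableOn_rpow_mul_exp_neg_mul hα hc0).mul_prod
      (integrableOn_rpow_mul_one_sub_rpow (half_pos hα) (half_pos hα))).mul_prod
        (integrable_barnesWeight hα hα1)
    refine Integrable.mono' hb hmeas.aestronglyMeasurable ?_
    have hmem : ∀ᵐ z ∂(μ.prod (volume : Measure ℝ)), z.1 ∈ Ioi (0 : ℝ) ×ˢ Ioo (0 : ℝ) 1 := by
      refine Measure.quasiMeasurePreserving_fst.ae ?_
      rw [hμr]
      exact ae_restrict_mem (measurableSet_Ioi.prod measurableSet_Ioo)
    filter_upwards [hmem] with z hz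
    obtain ⟨⟨t, x⟩, y⟩ := z
    obtain ⟨ht, hx⟩ := hz
    have ht' : (0 : ℝ) < t := ht
    have hx0 : 0 < x := hx.1
    have hx1 : 0 < 1 - x := by have := hx.2; simp only at this; linarith
    simp only [Function.uncurry, hH]
    have e1 : Complex.I * (barnesArg α p x * y) = ((barnesArg α p x * y : ℝ) : ℂ) * Complex.I := by
      push_cast; ring
    rw [e1, norm_mul, norm_mul, norm_mul, norm_mul, Complex.norm_exp_ofReal_mul_I, mul_one,
      Complex.norm_real, Complex.norm_real, Complex.norm_real, Complex.norm_exp,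
      Real.norm_of_nonneg (barnesWeight_nonneg _ _), Real.norm_of_nonneg (by positivity),
      Real.norm_of_nonneg (by positivity), ← mul_assoc]
    have hW := barnesWeight_nonneg α y
    gcongr
    have e2 : (-(t * (u * (1 - x) + v * x)) : ℂ).re = -(t * (u.re * (1 - x) + v.re * x)) := by
      have : (-(t * (u * (1 - x) + v * x)) : ℂ) = ((-t : ℝ) : ℂ) * (u * ((1 - x : ℝ) : ℂ) + v * x) := by
        push_cast; ring
      rw [this, Complex.re_ofReal_mul, Complex.add_re, Complex.re_mul_ofReal,
        Complex.re_mul_ofReal]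
      ring
    rw [e2]
    have h3 : c ≤ u.re * (1 - x) + v.re * x := by
      have h4 : c ≤ u.re := min_le_left _ _
      have h5 : c ≤ v.re := min_le_right _ _
      nlinarith
    nlinarith
  have hswap := integral_integral_swap hInt
  have hleft : ∫ z, ∫ y, H z y ∂volume ∂μ = ∫ t : ℝ in Ioi 0, ∫ x : ℝ in Ioo 0 1,
      ((t ^ (α - 1) : ℝ) : ℂ) *
      (Complex.exp (-(t * (u * (1 - x) + v * x))) * unitProfile α p x) := by
    have hL := integral_prod (fun z => ∫ y, H z y) hInt.integral_prod_left
    rw [hμ, hL]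
    refine integral_congr_ae (Eventually.of_forall fun t => ?_)
    refine integral_congr_ae (Eventually.of_forall fun x => ?_)
    simp only [hH]
    rw [integral_const_mul, integral_barnesWeight_mul_exp hα hα1, unitProfile]
    push_cast
    ring
  have hright : ∀ᵐ y, ∫ z, H z y ∂μ =
      Complex.exp (-(α / 2 * (Complex.log u + Complex.log v))) *
      (Complex.exp (-(Complex.I * (α * (Complex.log u - Complex.log v) + Real.log (p / (1 - p)))
        * y)) / Complex.cosh (Real.pi * y)) := by
    filter_upwards [hInt.prod_left_ae] with y hy
    have hL := integral_prod (fun z => H z y) hy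
    rw [hμ, hL]
    -- For fixed `y` the `(t,x)`-integral is a product of two Gamma integrals with these exponents;
    -- `A + B = α` does not depend on `y`.
    set A : ℂ := ((α / 2 : ℝ) : ℂ) + ((α * y : ℝ) : ℂ) * Complex.I with hA
    set B : ℂ := ((α / 2 : ℝ) : ℂ) - ((α * y : ℝ) : ℂ) * Complex.I with hB
    have hAr : 0 < A.re := by simp [hA, hα]
    have hBr : 0 < B.re := by simp [hB, hα]
    have hsimp := integral_Ioi_cpow_mul_simplex hAr hBr hu hv
    set d : ℂ := (barnesWeight α y : ℂ) *
      Complex.exp (-(Complex.I * (Real.log (p / (1 - p)) * y))) with hd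
    have : ∫ t : ℝ in Ioi 0, ∫ x : ℝ in Ioo 0 1, H (t, x) y = d * ∫ t : ℝ in Ioi 0,
        ∫ x : ℝ in Ioo 0 1, (t : ℂ) ^ (A + B - 1) *
      ((((1 - x : ℝ) : ℂ) ^ (A - 1) * (x : ℂ) ^ (B - 1)) *
        Complex.exp (-(t * (u * (1 - x) + v * x)))) := by
      rw [← integral_const_mul]
      refine setIntegral_congr_fun measurableSet_Ioi fun t ht => ?_
      rw [← integral_const_mul]
      refine setIntegral_congr_fun measurableSet_Ioo fun x hx => ?_
      simp only [hH]
      have e1 : (t : ℂ) ^ (A + B - 1) = ((t ^ (α - 1) : ℝ) : ℂ) := by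
        rw [Complex.ofReal_cpow (le_of_lt ht)]
        congr 1
        rw [hA, hB]; push_cast; ring
      rw [e1, hA, hB, cpow_mul_cpow_line hx, hd]
      have e2 : Complex.exp (Complex.I * (barnesArg α p x * y)) =
          Complex.exp (Complex.I * (((α * (Real.log (1 - x) - Real.log x) : ℝ) : ℂ) * y)) *
          Complex.exp (-(Complex.I * (Real.log (p / (1 - p)) * y))) := by
        rw [← Complex.exp_add, barnesArg]
        congr 1
        push_cast
        ring
      rw [e2]
      ring
    rw [this, hsimp]
    have hu0 : u ≠ 0 := fun h => by rw [h] at hu; simp at hu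
    have hv0 : v ≠ 0 := fun h => by rw [h] at hv; simp at hv
    have hWG := barnesWeight_eq_div hα y
    rw [← hA, ← hB] at hWG
    calc _ = ((barnesWeight α y : ℂ) * (Complex.Gamma B * Complex.Gamma A)) *
          (Complex.exp (-(Complex.I * (Real.log (p / (1 - p)) * y))) * (v ^ (-B) * u ^ (-A))) := by
            rw [hd]; ring
      _ = (1 / Complex.cosh (Real.pi * y)) *
          (Complex.exp (-(α / 2 * (Complex.log u + Complex.log v))) *
            Complex.exp (-(Complex.I * (α * (Complex.log u - Complex.log v)
              + Real.log (p / (1 - p))) * y))) := by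
            rw [hWG, Complex.cpow_def_of_ne_zero hu0, Complex.cpow_def_of_ne_zero hv0,
              ← Complex.exp_add, ← Complex.exp_add, ← Complex.exp_add]
            congr 2
            rw [hA, hB]; push_cast; ring
      _ = _ := by ring
  rw [← hleft, hswap, integral_congr_ae hright, integral_const_mul,
    (integral_exp_div_cosh_pi ?_).2, mul_one_div]
  have := abs_log_sub_log_im_lt hu hv
  rw [Complex.add_im, Complex.ofReal_im, add_zero, Complex.im_ofReal_mul, abs_mul, abs_of_pos hα]
  calc _ ≤ 1 * |(Complex.log u - Complex.log v).im| := by gcongr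
    _ < Real.pi := by rwa [one_mul]

/-! ### The profile and its Fourier-Laplace transform -/

/-- The self-similar profile of the kernel, supported in `[-1,1]`. -/
noncomputable def profile (α p : ℝ) : ℝ → ℝ :=
  (Ioo (-1 : ℝ) 1).indicator
    fun y => (2 * (2 * Real.sqrt (p * (1 - p))))⁻¹ * unitProfile α p ((y + 1) / 2)

theorem measurable_profile {α : ℝ} (hα : 0 < α) (hα1 : α < 1) (p : ℝ) :
    Measurable (profile α p) := by
  unfold profile
  have := measurable_unitProfile hα hα1 p
  exact Measurable.indicator (by fun_prop) measurableSet_Ioo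

theorem integrable_profile {α : ℝ} (hα : 0 < α) (hα1 : α < 1) (p : ℝ) :
    Integrable (profile α p) := by
  unfold profile
  rw [integrable_indicator_iff measurableSet_Ioo]
  have h := integrableOn_unitProfile hα hα1 p
  rw [← intervalIntegrable_iff_integrableOn_Ioo_of_le zero_le_one] at h
  have h2 := (h.comp_mul_left (c := 1 / 2)).comp_add_right 1
  norm_num at h2
  have h3 := h2.const_mul (2 * (2 * Real.sqrt (p * (1 - p))))⁻¹
  rw [intervalIntegrable_iff_integrableOn_Ioo_of_le (by norm_num)] at h3
  refine h3.congr_fun (fun x hx => ?_) measurableSet_Ioo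
  simp only
  congr 2
  ring

/-- The substitution `y = 2x - 1`; its Jacobian cancels the outer factor `2` in the normalisation of
the profile. -/
theorem fourierT_profile (α p r : ℝ) :
    fourierT (fun y => (profile α p y : ℂ)) r = (2 * Real.sqrt (p * (1 - p)) : ℂ)⁻¹ *
      ∫ x in Ioo (0 : ℝ) 1,
        Complex.exp (-(Complex.I * r * (2 * x - 1))) * unitProfile α p x := by
  have h1 : fourierT (fun y => (profile α p y : ℂ)) r =
      ∫ y in (-1 : ℝ)..1, Complex.exp (-(Complex.I * r * y)) *
        (((2 * (2 * Real.sqrt (p * (1 - p))))⁻¹ * unitProfile α p ((y + 1) / 2) : ℝ) : ℂ) := by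
    rw [fourierT, intervalIntegral.integral_of_le (by norm_num), integral_Ioc_eq_integral_Ioo,
      ← integral_indicator measurableSet_Ioo]
    refine integral_congr_ae (Eventually.of_forall fun y => ?_)
    simp only [profile, indicator]
    split_ifs <;> simp
  have h2 := intervalIntegral.integral_comp_mul_sub (a := (0 : ℝ)) (b := 1) (c := 2)
    (fun y : ℝ => Complex.exp (-(Complex.I * r * y)) *
      (((2 * (2 * Real.sqrt (p * (1 - p))))⁻¹ * unitProfile α p ((y + 1) / 2) : ℝ) : ℂ))
    two_ne_zero 1
  rw [show (2 : ℝ) * 0 - 1 = -1 by norm_num, show (2 : ℝ) * 1 - 1 = 1 by norm_num,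
    eq_inv_smul_iff₀ two_ne_zero, Complex.real_smul] at h2
  rw [h1, ← h2, intervalIntegral.integral_of_le zero_le_one, integral_Ioc_eq_integral_Ioo,
    ← integral_const_mul, ← integral_const_mul]
  refine setIntegral_congr_fun measurableSet_Ioo fun x hx => ?_
  have : (2 * x - 1 + 1) / 2 = x := by ring
  simp only [this]
  push_cast
  rw [mul_inv (2 : ℂ)]
  ring

/-- With `p = e^{log p}` and `1 - p = e^{log(1-p)}` the symbol is a sum of two exponentials; taking
out the exponential of the mean exponent leaves a hyperbolic cosine of half the difference. -/
theorem symbolZeta_eq {α p : ℝ} (hp0 : 0 < p) (hp1 : p < 1) {ξ : ℝ} {s : ℂ} (hs : 0 < s.re) :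
    symbolZeta α p ξ s = (2 * Real.sqrt (p * (1 - p)) : ℂ) *
      (Complex.exp (α / 2 * (Complex.log (s - Complex.I * ξ) + Complex.log (s + Complex.I * ξ))) *
        Complex.cosh ((α * (Complex.log (s - Complex.I * ξ) - Complex.log (s + Complex.I * ξ)) +
          Real.log (p / (1 - p))) / 2)) := by
  have hu : s - Complex.I * ξ ≠ 0 := fun h => by
    have := congrArg Complex.re h; simp at this; exact hs.ne' this
  have hv : s + Complex.I * ξ ≠ 0 := fun h => by
    have := congrArg Complex.re h; simp at this; exact hs.ne' this
  have hq : 0 < 1 - p := by linarith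
  rw [symbolZeta, Complex.cpow_def_of_ne_zero hu, Complex.cpow_def_of_ne_zero hv]
  set lu := Complex.log (s - Complex.I * ξ)
  set lv := Complex.log (s + Complex.I * ξ)
  have e1 : (p : ℂ) = Complex.exp (Real.log p) := by
    rw [← Complex.ofReal_exp, Real.exp_log hp0]
  have e2 : (1 - p : ℂ) = Complex.exp (Real.log (1 - p)) := by
    rw [← Complex.ofReal_exp, Real.exp_log hq]; push_cast; rfl
  have e3 : (Real.sqrt (p * (1 - p)) : ℂ) =
      Complex.exp ((Real.log p + Real.log (1 - p)) / 2) := by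
    have : Real.sqrt (p * (1 - p)) = Real.exp ((Real.log p + Real.log (1 - p)) / 2) := by
      rw [Real.sqrt_eq_rpow, Real.rpow_def_of_pos (by positivity), Real.log_mul hp0.ne' hq.ne']
      congr 1; ring
    rw [this]; push_cast; rfl
  rw [Real.log_div hp0.ne' hq.ne', e3, e2, Complex.cosh]
  nth_rewrite 1 [e1]
  push_cast
  have : ∀ a b c d : ℂ, 2 * Complex.exp a * (Complex.exp b * ((Complex.exp c + Complex.exp d) / 2))
      = Complex.exp (a + b + c) + Complex.exp (a + b + d) := by
    intro a b c d
    rw [Complex.exp_add, Complex.exp_add, Complex.exp_add, Complex.exp_add]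
    ring
  rw [this, ← Complex.exp_add, ← Complex.exp_add]
  congr 2 <;> ring

theorem cosh_ne_zero_of_abs_im_lt {z : ℂ} (hz : |z.im| < Real.pi / 2) : Complex.cosh z ≠ 0 := by
  intro h
  have h1 : Complex.cos (z * Complex.I) = 0 := by rw [Complex.cos_mul_I, h]
  rw [Complex.cos_eq_zero_iff] at h1
  obtain ⟨k, hk⟩ := h1
  have h2 := congrArg Complex.re hk
  have e : ((2 * (k : ℂ) + 1) * Real.pi / 2) = (((2 * (k : ℝ) + 1) * Real.pi / 2 : ℝ) : ℂ) := by
    push_cast; ring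
  rw [e, Complex.ofReal_re] at h2
  simp only [Complex.mul_re, Complex.I_re, mul_zero, Complex.I_im, mul_one, zero_sub] at h2
  have hπ := Real.pi_pos
  rw [abs_lt] at hz
  have h3 : (2 * (k : ℝ) + 1) < 1 := by nlinarith [hz.1]
  have h4 : -1 < (2 * (k : ℝ) + 1) := by nlinarith [hz.2]
  have h5 : (k : ℝ) < 0 := by linarith
  have h6 : (-1 : ℝ) < k := by linarith
  have h7 : k < 0 := by exact_mod_cast h5
  have h8 : (-1 : ℤ) < k := by exact_mod_cast h6
  omega

/-- In the factorised form the argument of `cosh` has imaginary part below `π/2` in modulus, and the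
zeros of `cosh` have imaginary part an odd multiple of `π/2`. -/
theorem symbolZeta_ne_zero {α p : ℝ} (hα : 0 < α) (hα1 : α < 1) (hp0 : 0 < p) (hp1 : p < 1)
    {ξ : ℝ} {s : ℂ} (hs : 0 < s.re) : symbolZeta α p ξ s ≠ 0 := by
  rw [symbolZeta_eq hp0 hp1 hs]
  have hq : 0 < 1 - p := by linarith
  have h1 : (0 : ℝ) < Real.sqrt (p * (1 - p)) := Real.sqrt_pos.2 (by positivity)
  refine mul_ne_zero (mul_ne_zero two_ne_zero (by exact_mod_cast h1.ne'))
    (mul_ne_zero (Complex.exp_ne_zero _) (cosh_ne_zero_of_abs_im_lt ?_))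
  have hu : 0 < (s - Complex.I * ξ).re := by simpa using hs
  have hv : 0 < (s + Complex.I * ξ).re := by simpa using hs
  have h2 := abs_log_sub_log_im_lt hu hv
  have e : ∀ z : ℂ, (z / 2).im = z.im / 2 := fun z => by
    have : z / 2 = z / ((2 : ℝ) : ℂ) := by push_cast; rfl
    rw [this, Complex.div_ofReal_im]
  rw [e, abs_div, abs_two]
  refine div_lt_div_of_pos_right ?_ two_pos
  rw [Complex.add_im, Complex.ofReal_im, add_zero, Complex.im_ofReal_mul, abs_mul, abs_of_pos hα]
  calc _ ≤ 1 * |(Complex.log (s - Complex.I * ξ) - Complex.log (s + Complex.I * ξ)).im| := by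
        gcongr
    _ < Real.pi := by rwa [one_mul]

/-- The two-sided formula is applied with `u = s - iξ`, `v = s + iξ`: then `u(1-x) + vx = s +
iξ(2x-1)`, so the exponential splits into the Laplace factor in `t` and the Fourier factor of the
profile at frequency `ξt`. -/
theorem laplace_fourierT_profile {α p : ℝ} (hα : 0 < α) (hα1 : α < 1) (hp0 : 0 < p) (hp1 : p < 1)
    (ξ : ℝ) {s : ℂ} (hs : 0 < s.re) :
    ∫ t in Ioi (0 : ℝ), Complex.exp (-(s * t)) *
      (((t ^ (α - 1) : ℝ) : ℂ) * fourierT (fun y => (profile α p y : ℂ)) (ξ * t)) =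
      1 / symbolZeta α p ξ s := by
  have hu : 0 < (s - Complex.I * ξ).re := by simpa using hs
  have hv : 0 < (s + Complex.I * ξ).re := by simpa using hs
  have h := integral_unitProfile_eq (p := p) hα hα1 hu hv
  rw [symbolZeta_eq hp0 hp1 hs, one_div, mul_inv, mul_inv (Complex.exp _), ← Complex.exp_neg,
    ← div_eq_mul_inv (Complex.exp _), ← h, ← integral_const_mul]
  refine integral_congr_ae (Eventually.of_forall fun t => ?_)
  simp only
  rw [fourierT_profile, integral_const_mul]
  rw [mul_left_comm, mul_left_comm (Complex.exp _), ← integral_const_mul, mul_left_comm]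
  congr 2
  refine integral_congr_ae (Eventually.of_forall fun x => ?_)
  simp only
  rw [← mul_assoc, ← Complex.exp_add]
  congr 2
  push_cast
  ring

/-! ### Time convolutions as a shear of the quadrant -/

section Shear
variable {E : Type*} [NormedAddCommGroup E]

theorem indicator_shear (q : ℝ → ℝ → E) (t τ : ℝ) :
    (Ioi (0 : ℝ) ×ˢ Ioi (0 : ℝ)).indicator (Function.uncurry q) (t - τ, τ) =
      (Ioo 0 t).indicator (fun τ => q (t - τ) τ) τ := by
  have : ((t - τ, τ) ∈ Ioi (0 : ℝ) ×ˢ Ioi (0 : ℝ)) ↔ τ ∈ Ioo 0 t := by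
    simp only [mem_prod, mem_Ioi, mem_Ioo, sub_pos]
    exact and_comm
  by_cases h : τ ∈ Ioo 0 t
  · rw [indicator_of_mem (this.2 h), indicator_of_mem h]; rfl
  · rw [indicator_of_notMem (fun h' => h (this.1 h')), indicator_of_notMem h]

/-- The map `(t,τ) ↦ (t-τ,τ)` preserves Lebesgue measure, and the preimage of the open quadrant is
the region `0 < τ < t`. -/
theorem integrable_shear {q : ℝ → ℝ → E}
    (hq : IntegrableOn (Function.uncurry q) (Ioi (0 : ℝ) ×ˢ Ioi (0 : ℝ))) :
    Integrable (fun z : ℝ × ℝ => (Ioo 0 z.1).indicator (fun τ => q (z.1 - τ) τ) z.2) := by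
  rw [← integrable_indicator_iff (measurableSet_Ioi.prod measurableSet_Ioi)] at hq
  have hmp := measurePreserving_sub_prod (volume : Measure ℝ) (volume : Measure ℝ)
  have := hmp.integrable_comp_of_integrable (g := (Ioi (0 : ℝ) ×ˢ Ioi (0 : ℝ)).indicator
    (Function.uncurry q)) hq
  refine this.congr (Eventually.of_forall fun z => ?_)
  exact indicator_shear q z.1 z.2

theorem ae_integrableOn_shear {q : ℝ → ℝ → E}
    (hq : IntegrableOn (Function.uncurry q) (Ioi (0 : ℝ) ×ˢ Ioi (0 : ℝ))) :
    ∀ᵐ t : ℝ, IntegrableOn (fun τ => q (t - τ) τ) (Ioo 0 t) := by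
  filter_upwards [(integrable_shear hq).prod_right_ae] with t ht
  exact (integrable_indicator_iff measurableSet_Ioo).1 ht

variable [NormedSpace ℝ E]

theorem integrable_integral_shear {q : ℝ → ℝ → E}
    (hq : IntegrableOn (Function.uncurry q) (Ioi (0 : ℝ) ×ˢ Ioi (0 : ℝ))) :
    Integrable (fun t : ℝ => ∫ τ in Ioo 0 t, q (t - τ) τ) := by
  have := (integrable_shear hq).integral_prod_left
  simpa only [integral_indicator measurableSet_Ioo] using this

theorem integral_shear {q : ℝ → ℝ → E}
    (hq : IntegrableOn (Function.uncurry q) (Ioi (0 : ℝ) ×ˢ Ioi (0 : ℝ))) :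
    ∫ t : ℝ in Ioi 0, ∫ τ in Ioo 0 t, q (t - τ) τ =
      ∫ τ in Ioi (0 : ℝ), ∫ σ in Ioi (0 : ℝ), q σ τ := by
  have h1 : ∫ t : ℝ in Ioi 0, ∫ τ in Ioo 0 t, q (t - τ) τ =
      ∫ t : ℝ, ∫ τ in Ioo 0 t, q (t - τ) τ := by
    refine setIntegral_eq_integral_of_forall_compl_eq_zero fun t ht => ?_
    rw [Ioo_eq_empty (fun h => ht h), setIntegral_empty]
  rw [h1]
  simp_rw [← integral_indicator (measurableSet_Ioo : MeasurableSet (Ioo (0 : ℝ) _))]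
  rw [integral_integral_swap (integrable_shear hq), ← integral_indicator measurableSet_Ioi]
  refine integral_congr_ae (Eventually.of_forall fun τ => ?_)
  have h2 : (fun t : ℝ => (Ioo 0 t).indicator (fun τ => q (t - τ) τ) τ) = fun t : ℝ =>
      (Ioi (0 : ℝ) ×ˢ Ioi (0 : ℝ)).indicator (Function.uncurry q) (t - τ, τ) := by
    ext t; rw [indicator_shear]
  simp only
  rw [h2, integral_sub_right_eq_self
    (fun σ => (Ioi (0 : ℝ) ×ˢ Ioi (0 : ℝ)).indicator (Function.uncurry q) (σ, τ)) τ]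
  by_cases h : τ ∈ Ioi (0 : ℝ)
  · rw [indicator_of_mem h, ← integral_indicator measurableSet_Ioi]
    refine integral_congr_ae (Eventually.of_forall fun σ => ?_)
    by_cases h' : σ ∈ Ioi (0 : ℝ)
    · rw [indicator_of_mem h']
      exact indicator_of_mem (s := Ioi (0 : ℝ) ×ˢ Ioi (0 : ℝ)) (a := (σ, τ)) ⟨h', h⟩ _
    · rw [indicator_of_notMem h']
      exact indicator_of_notMem (s := Ioi (0 : ℝ) ×ˢ Ioi (0 : ℝ)) (a := (σ, τ))
        (fun h'' => h' h''.1) _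
  · rw [indicator_of_notMem h, integral_eq_zero_of_ae]
    exact Eventually.of_forall fun σ => indicator_of_notMem (fun h'' => h h''.2) _

end Shear

/-! ### Beta integrals over bounded intervals -/

theorem integral_rpow_mul_one_sub_rpow {a b : ℝ} (ha : 0 < a) (hb : 0 < b) :
    ∫ x in Ioo (0 : ℝ) 1, x ^ (a - 1) * (1 - x) ^ (b - 1) =
      Real.Gamma a * Real.Gamma b / Real.Gamma (a + b) := by
  have h := Complex.Gamma_mul_Gamma_eq_betaIntegral (s := a) (t := b) (by simpa) (by simpa)
  have hB : Complex.betaIntegral a b =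
      ((∫ x in Ioo (0 : ℝ) 1, x ^ (a - 1) * (1 - x) ^ (b - 1) : ℝ) : ℂ) := by
    rw [Complex.betaIntegral, intervalIntegral.integral_of_le zero_le_one,
      integral_Ioc_eq_integral_Ioo, ← integral_complex_ofReal]
    refine setIntegral_congr_fun measurableSet_Ioo fun x hx => ?_
    have h1 : 0 ≤ 1 - x := by linarith [hx.2]
    rw [Complex.ofReal_mul, Complex.ofReal_cpow hx.1.le, Complex.ofReal_cpow h1]
    push_cast; rfl
  rw [hB, Complex.Gamma_ofReal, Complex.Gamma_ofReal, ← Complex.ofReal_add,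
    Complex.Gamma_ofReal] at h
  have h' : Real.Gamma a * Real.Gamma b = Real.Gamma (a + b) *
    ∫ x in Ioo (0 : ℝ) 1, x ^ (a - 1) * (1 - x) ^ (b - 1) := by exact_mod_cast h
  rw [h', mul_div_cancel_left₀ _ (Real.Gamma_pos_of_pos (by positivity)).ne']

theorem setIntegral_Ioo_comp_mul {E : Type*} [NormedAddCommGroup E] [NormedSpace ℝ E]
    {T : ℝ} (hT : 0 < T) (k : ℝ → E) :
    ∫ s in Ioo 0 T, k s = T • ∫ r in Ioo (0 : ℝ) 1, k (T * r) := by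
  have := intervalIntegral.smul_integral_comp_mul_left (a := 0) (b := 1) k T
  rw [mul_zero, mul_one, intervalIntegral.integral_of_le zero_le_one,
    intervalIntegral.integral_of_le hT.le, integral_Ioc_eq_integral_Ioo,
    integral_Ioc_eq_integral_Ioo] at this
  exact this.symm

theorem integrableOn_Ioo_comp_mul {E : Type*} [NormedAddCommGroup E] [NormedSpace ℝ E]
    {T : ℝ} (hT : 0 < T) (k : ℝ → E) :
    IntegrableOn k (Ioo 0 T) ↔ IntegrableOn (fun r => k (T * r)) (Ioo (0 : ℝ) 1) := by
  have h := IntervalIntegrable.comp_mul_left_iff (f := k) (a := 0) (b := T) (c := T) hT.ne'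
  rw [zero_div, div_self hT.ne', intervalIntegrable_iff_integrableOn_Ioo_of_le zero_le_one,
    intervalIntegrable_iff_integrableOn_Ioo_of_le hT.le] at h
  exact h.symm

theorem mul_rpow_mul_sub_rpow {T r a b : ℝ} (hT : 0 < T) (hr : r ∈ Ioo (0 : ℝ) 1) :
    (T - T * r) ^ (a - 1) * (T * r) ^ (b - 1) =
      T ^ (a + b - 2) * (r ^ (b - 1) * (1 - r) ^ (a - 1)) := by
  have h1 : 0 ≤ 1 - r := by linarith [hr.2]
  have e : T - T * r = T * (1 - r) := by ring
  rw [e, Real.mul_rpow hT.le h1, Real.mul_rpow hT.le hr.1.le]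
  have : T ^ (a + b - 2) = T ^ (a - 1) * T ^ (b - 1) := by
    rw [← Real.rpow_add hT]; congr 1; ring
  rw [this]; ring

theorem integrableOn_sub_rpow_mul_rpow {T a b : ℝ} (hT : 0 < T) (ha : 0 < a) (hb : 0 < b) :
    IntegrableOn (fun s : ℝ => (T - s) ^ (a - 1) * s ^ (b - 1)) (Ioo 0 T) := by
  rw [integrableOn_Ioo_comp_mul hT]
  refine IntegrableOn.congr_fun ((integrableOn_rpow_mul_one_sub_rpow hb ha).const_mul
    (T ^ (a + b - 2)))
    (fun r hr => ?_) measurableSet_Ioo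
  exact (mul_rpow_mul_sub_rpow hT hr).symm

theorem integral_sub_rpow_mul_rpow {T a b : ℝ} (hT : 0 < T) (ha : 0 < a) (hb : 0 < b) :
    ∫ s in Ioo 0 T, (T - s) ^ (a - 1) * s ^ (b - 1) =
      T ^ (a + b - 1) * (Real.Gamma b * Real.Gamma a / Real.Gamma (b + a)) := by
  rw [setIntegral_Ioo_comp_mul hT, ← integral_rpow_mul_one_sub_rpow hb ha,
    setIntegral_congr_fun measurableSet_Ioo fun r hr => mul_rpow_mul_sub_rpow hT hr,
    integral_const_mul, smul_eq_mul, ← mul_assoc]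
  congr 1
  nth_rewrite 1 [← Real.rpow_one T]
  rw [← Real.rpow_add hT]; congr 1; ring

/-! ### Averages against a self-similar kernel -/

/-- The average `∫ Φ(η) h(x - ση) dη` of `h` with profile `Φ` at scale `σ`. -/
noncomputable def profileAvg (Φ h : ℝ → ℝ) (σ x : ℝ) : ℝ := ∫ η : ℝ, Φ η * h (x - σ * η)

/-- The self-similar kernel `t^(α-2) Φ(x/t)`. -/
noncomputable def selfSimilar (α : ℝ) (Φ : ℝ → ℝ) (t x : ℝ) : ℝ := t ^ (α - 2) * Φ (x / t)

/-- The substitution `y = x - ση` moves all dependence on the scale into the argument of `h`. The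
averages stay continuous down to `σ = 0`, and the singularity is carried by the scalar `σ^(α-1)`
alone. -/
theorem integral_selfSimilar_mul (α : ℝ) (Φ h : ℝ → ℝ) {σ : ℝ} (hσ : 0 < σ) (x : ℝ) :
    ∫ y, selfSimilar α Φ σ (x - y) * h y = σ ^ (α - 1) * profileAvg Φ h σ x := by
  have h1 := integral_sub_left_eq_self (fun y => selfSimilar α Φ σ (x - y) * h y) volume x
  have h2 := Measure.integral_comp_mul_left
    (fun y => selfSimilar α Φ σ y * h (x - y)) σ
  simp only [sub_sub_cancel] at h1
  rw [abs_of_pos (by positivity), eq_inv_smul_iff₀ hσ.ne', smul_eq_mul] at h2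
  rw [← h1, ← h2, profileAvg, ← integral_const_mul, ← integral_const_mul]
  refine integral_congr_ae (Eventually.of_forall fun η => ?_)
  have e : σ ^ (α - 1) = σ * σ ^ (α - 2) := by
    rw [show α - 2 = (α - 1) - 1 by ring, Real.rpow_sub_one hσ.ne' (α - 1),
      mul_div_cancel₀ _ hσ.ne']
  simp only [selfSimilar]
  rw [mul_div_cancel_left₀ _ hσ.ne']
  rw [← mul_assoc, ← mul_assoc, ← mul_assoc, e]

theorem integrable_selfSimilar (α : ℝ) {Φ : ℝ → ℝ} (hΦ : Integrable Φ) (σ : ℝ) (hσ : 0 < σ) (x : ℝ) :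
    Integrable (fun y => selfSimilar α Φ σ (x - y)) := by
  unfold selfSimilar
  exact ((hΦ.comp_div hσ.ne').comp_sub_left x).const_mul _

theorem abs_profileAvg_le {Φ h : ℝ → ℝ} (hΦ : Integrable Φ) {M : ℝ} (hM : ∀ y, |h y| ≤ M)
    (σ x : ℝ) : |profileAvg Φ h σ x| ≤ (∫ η, |Φ η|) * M := by
  rw [profileAvg, ← integral_mul_const, ← Real.norm_eq_abs]
  refine norm_integral_le_of_norm_le (hΦ.abs.mul_const M) (Eventually.of_forall fun η => ?_)
  rw [norm_mul, Real.norm_eq_abs, Real.norm_eq_abs]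
  gcongr
  exact hM _

theorem continuous_profileAvg {Φ h : ℝ → ℝ} (hΦ : Integrable Φ) (hc : Continuous h) {M : ℝ}
    (hM : ∀ y, |h y| ≤ M) : Continuous (fun z : ℝ × ℝ => profileAvg Φ h z.1 z.2) := by
  unfold profileAvg
  refine continuous_of_dominated (bound := fun η => |Φ η| * M) ?_ ?_ (hΦ.abs.mul_const M) ?_
  · intro z
    exact hΦ.aestronglyMeasurable.mul (by fun_prop)
  · refine fun z => Eventually.of_forall fun η => ?_
    rw [norm_mul, Real.norm_eq_abs, Real.norm_eq_abs]
    gcongr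
    exact hM _
  · exact Eventually.of_forall fun η => by fun_prop

theorem ZeroAtInftyContinuousMap.abs_apply_le (h : C₀(ℝ, ℝ)) (x : ℝ) : |h x| ≤ ‖h‖ := by
  rw [← Real.norm_eq_abs, ← ZeroAtInftyContinuousMap.norm_toBCF_eq_norm]
  exact h.toBCF.norm_coe_le_norm x

theorem tendsto_profileAvg_cocompact {Φ : ℝ → ℝ} (hΦ : Integrable Φ) (h : C₀(ℝ, ℝ)) (σ : ℝ) :
    Tendsto (profileAvg Φ h σ) (cocompact ℝ) (𝓝 0) := by
  have : (cocompact ℝ).IsCountablyGenerated := by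
    rw [cocompact_eq_atBot_atTop]; infer_instance
  have : Tendsto (fun x => ∫ η : ℝ, Φ η * h (x - σ * η)) (cocompact ℝ) (𝓝 (∫ η : ℝ, (0 : ℝ))) := by
    refine tendsto_integral_filter_of_dominated_convergence (fun η => |Φ η| * ‖h‖) ?_ ?_
      (hΦ.abs.mul_const _) ?_
    · exact Eventually.of_forall fun x => hΦ.aestronglyMeasurable.mul (by fun_prop)
    · refine Eventually.of_forall fun z => Eventually.of_forall fun η => ?_
      rw [norm_mul, Real.norm_eq_abs, Real.norm_eq_abs]
      gcongr
      exact h.abs_apply_le _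
    · refine Eventually.of_forall fun η => ?_
      have h1 : Tendsto (fun x : ℝ => x - σ * η) (cocompact ℝ) (cocompact ℝ) :=
        (Homeomorph.subRight (σ * η)).isClosedEmbedding.tendsto_cocompact
      have h2 := ((zero_at_infty h).comp h1).const_mul (Φ η)
      simpa using h2
  rwa [integral_zero] at this

/-! ### Majorants and Borel representatives -/

/-- A Borel function which is `C₀` in space at all times and is dominated by a locally integrable
function of time of exponential type. -/
structure HasMajorant (F : ℝ → ℝ → ℝ) (ρ : ℝ → ℝ) : Prop where
  measurable : Measurable (Function.uncurry F)
  zeroAtInfty : ∀ t, ∃ h : C₀(ℝ, ℝ), ∀ x, h x = F x t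
  measurable_bound : Measurable ρ
  bound : ∀ x t, |F x t| ≤ ρ t
  integrable : ∀ T, IntegrableOn ρ (Ioc 0 T)
  expType : ∃ M a t₀ : ℝ, 0 ≤ M ∧ 0 ≤ a ∧ 0 < t₀ ∧ ∀ t, t₀ ≤ t → ρ t ≤ M * Real.exp (a * t)

namespace HasMajorant
variable {F : ℝ → ℝ → ℝ} {ρ : ℝ → ℝ}

theorem nonneg (hF : HasMajorant F ρ) (t : ℝ) : 0 ≤ ρ t := (abs_nonneg _).trans (hF.bound 0 t)

theorem continuous (hF : HasMajorant F ρ) (t : ℝ) : Continuous fun x => F x t := by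
  obtain ⟨h, hh⟩ := hF.zeroAtInfty t
  have : (fun x => F x t) = h := by ext x; rw [hh]
  rw [this]; exact h.continuous

end HasMajorant

theorem integrableOn_exp_neg_mul_of_expType {ρ : ℝ → ℝ} (hint : ∀ T, IntegrableOn ρ (Ioc 0 T))
    {M a t₀ : ℝ} (h : ∀ t, t₀ ≤ t → |ρ t| ≤ M * Real.exp (a * t)) {c : ℝ}
    (hc : a < c) : IntegrableOn (fun t => Real.exp (-(c * t)) * ρ t) (Ioi 0) := by
  set t₁ := max t₀ 1 with ht₁
  have ht1 : 0 < t₁ := lt_of_lt_of_le one_pos (le_max_right _ _)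
  rw [← Ioc_union_Ioi_eq_Ioi ht1.le]
  refine IntegrableOn.union ?_ ?_
  · exact IntegrableOn.continuousOn_mul_of_subset (K := Icc 0 t₁)
      (g := fun t => Real.exp (-(c * t))) (by fun_prop) (hint t₁) isCompact_Icc measurableSet_Ioc
      Ioc_subset_Icc_self
  · have hm : AEStronglyMeasurable ρ (volume.restrict (Ioi t₁)) := by
      have : Ioi t₁ ⊆ ⋃ n : ℕ, Ioc (0 : ℝ) n := by
        intro t ht
        obtain ⟨n, hn⟩ := exists_nat_ge t
        exact mem_iUnion.2 ⟨n, ht1.trans ht, hn⟩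
      refine AEStronglyMeasurable.mono_set this ?_
      rw [aestronglyMeasurable_iUnion_iff]
      exact fun n => (hint n).aestronglyMeasurable
    have hg : IntegrableOn (fun t => M * Real.exp (-((c - a) * t))) (Ioi t₁) := by
      have := integrableOn_exp_mul_Ioi (a := -(c - a)) (by linarith) t₁
      refine (this.congr_fun (fun t _ => ?_) measurableSet_Ioi).const_mul M
      simp only [neg_mul]
    refine Integrable.mono' hg ((by fun_prop : Continuous fun t =>
      Real.exp (-(c * t))).aestronglyMeasurable.mul hm) ?_
    filter_upwards [ae_restrict_mem measurableSet_Ioi] with t ht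
    have h1 := h t ((le_max_left _ _).trans (le_of_lt ht))
    rw [norm_mul, Real.norm_of_nonneg (Real.exp_pos _).le, Real.norm_eq_abs]
    calc _ ≤ Real.exp (-(c * t)) * (M * Real.exp (a * t)) := by gcongr
      _ = M * (Real.exp (-(c * t)) * Real.exp (a * t)) := by ring
      _ = _ := by rw [← Real.exp_add]; congr 2; ring

/-- Averages over shrinking intervals see only the almost everywhere class of `h'`, yet recover the
continuous representative at every point. This is the source of joint Borel measurability below. -/
theorem tendsto_integral_average {h h' : ℝ → ℝ} (hc : Continuous h) {M : ℝ} (hM : ∀ x, |h x| ≤ M)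
    (hae : ∀ᵐ x, h' x = h x) (x : ℝ) :
    Tendsto (fun n : ℕ => ∫ y in (0 : ℝ)..1, h' (x + y / (n + 1))) atTop (𝓝 (h x)) := by
  have h1 : ∀ n : ℕ, ∫ y in (0 : ℝ)..1, h' (x + y / (n + 1)) =
      ∫ y in (0 : ℝ)..1, h (x + y / (n + 1)) := by
    intro n
    have hn : (n + 1 : ℝ) ≠ 0 := by positivity
    rw [intervalIntegral.integral_comp_add_div _ hn, intervalIntegral.integral_comp_add_div _ hn]
    congr 1
    refine intervalIntegral.integral_congr_ae ?_
    filter_upwards [hae] with y hy _ using hy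
  simp_rw [h1]
  have h2 : Tendsto (fun n : ℕ => ∫ y in (0 : ℝ)..1, h (x + y / (n + 1))) atTop
      (𝓝 (∫ y in (0 : ℝ)..1, h x)) := by
    refine intervalIntegral.tendsto_integral_filter_of_dominated_convergence (fun _ => M) ?_ ?_
      (by simp) ?_
    · exact Eventually.of_forall fun n => by fun_prop
    · exact Eventually.of_forall fun n => Eventually.of_forall fun y _ => hM _
    · refine Eventually.of_forall fun y _ => ?_
      have h3 : Tendsto (fun n : ℕ => x + y * (1 / ((n : ℝ) + 1))) atTop (𝓝 (x + y * 0)) :=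
        (tendsto_one_div_add_atTop_nhds_zero_nat.const_mul y).const_add x
      rw [mul_zero, add_zero] at h3
      have := (hc.tendsto x).comp h3
      refine this.congr fun n => ?_
      simp only [Function.comp]
      congr 1; ring
  simpa using h2

/-- Altering `f` on a null set of times changes neither Duhamel's formula nor the transforms, and
gives a Borel function that is `C₀` at all times. The last clause says that the majorant is no
larger than needed, so that local boundedness of `f` passes on to it. -/
theorem IsExpTypeC0.exists_hasMajorant {f : ℝ → ℝ → ℝ} (hf : IsExpTypeC0 f) :
    ∃ (F : ℝ → ℝ → ℝ) (ρ : ℝ → ℝ), HasMajorant F ρ ∧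
      (∀ᵐ t ∂(volume.restrict (Ioi (0 : ℝ))), ∀ x, F x t = f x t) ∧
      ∀ t M, 0 ≤ M → (∀ x, |f x t| ≤ M) → ρ t ≤ M := by
  obtain ⟨ρ₀, hρ₀, hfρ₀⟩ := hf.locallyIntegrable
  obtain ⟨M, a, t₀, hexp⟩ := hf.expType
  have hmeas := hf.measurable
  set f' : ℝ × ℝ → ℝ := hmeas.mk _ with hf'
  have hf'm : StronglyMeasurable f' := hmeas.stronglyMeasurable_mk
  have hae : ∀ᵐ t ∂(volume.restrict (Ioi (0 : ℝ))), ∀ᵐ x, f' (x, t) = f x t := by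
    have h1 : ∀ᵐ z ∂((volume : Measure (ℝ × ℝ)).restrict (univ ×ˢ Ioi 0)), f z.1 z.2 = f' z :=
      hmeas.ae_eq_mk
    rw [Measure.volume_eq_prod, ← Measure.prod_restrict, Measure.restrict_univ] at h1
    have h2 := Measure.ae_ae_of_ae_prod (Measure.measurePreserving_swap.quasiMeasurePreserving.ae h1)
    filter_upwards [h2] with t ht
    filter_upwards [ht] with x hx
    exact hx.symm
  have hgood : ∀ᵐ t ∂(volume.restrict (Ioi (0 : ℝ))), 0 < t ∧ (∃ h : C₀(ℝ, ℝ), ∀ x, h x = f x t) ∧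
      (∀ x, |f x t| ≤ ρ₀ t) ∧ ∀ᵐ x, f' (x, t) = f x t := by
    filter_upwards [hae, hfρ₀, hf.zeroAtInfty, ae_restrict_mem measurableSet_Ioi] with t h1 h2 h3 h4
    exact ⟨h4, h3, h2, h1⟩
  -- The new function is `f` on this measurable set of good times and zero elsewhere. On good times
  -- it is the limit of averages of a Borel version `f'`.
  obtain ⟨T, hT, hTm, hTgood⟩ := hgood.exists_measurable_mem
  set F : ℝ → ℝ → ℝ := fun x t => T.indicator (fun t => f x t) t with hF
  have hFT : ∀ t ∈ T, ∀ x, F x t = f x t := fun t ht x => indicator_of_mem ht _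
  have hFT' : ∀ t ∉ T, ∀ x, F x t = 0 := fun t ht x => indicator_of_notMem ht _
  have hFae : ∀ᵐ t ∂(volume.restrict (Ioi (0 : ℝ))), ∀ x, F x t = f x t := by
    filter_upwards [hT] with t ht using hFT t ht
  have hC0 : ∀ t, ∃ h : C₀(ℝ, ℝ), ∀ x, h x = F x t := by
    intro t
    by_cases ht : t ∈ T
    · obtain ⟨h, hh⟩ := (hTgood t ht).2.1
      exact ⟨h, fun x => by rw [hh, hFT t ht]⟩
    · exact ⟨0, fun x => by rw [hFT' t ht]; rfl⟩
  have hFm : Measurable (Function.uncurry F) := by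
    have h1 : ∀ n : ℕ, Measurable fun z : ℝ × ℝ =>
        T.indicator (fun t => ∫ y in (0 : ℝ)..1, f' (z.1 + y / (n + 1), t)) z.2 := by
      intro n
      have h2 : Measurable fun z : ℝ × ℝ => ∫ y in (0 : ℝ)..1, f' (z.1 + y / (n + 1), z.2) := by
        simp_rw [intervalIntegral.integral_of_le zero_le_one]
        refine StronglyMeasurable.measurable ?_
        refine StronglyMeasurable.integral_prod_right
          (f := fun (z : ℝ × ℝ) (y : ℝ) => f' (z.1 + y / (n + 1), z.2)) ?_
        exact hf'm.comp_measurable (by fun_prop)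
      have h3 := h2.indicator (measurable_snd hTm)
      exact h3
    refine measurable_of_tendsto_metrizable h1 ?_
    rw [tendsto_pi_nhds]
    rintro ⟨x, t⟩
    by_cases ht : t ∈ T
    · obtain ⟨_, ⟨h, hh⟩, _, h4⟩ := hTgood t ht
      simp only [indicator_of_mem ht, Function.uncurry, hFT t ht]
      rw [← hh]
      refine tendsto_integral_average (h' := fun y => f' (y, t)) h.continuous h.abs_apply_le ?_ x
      filter_upwards [h4] with y hy
      rw [hy]; exact (hh y).symm
    · simp only [indicator_of_notMem ht, Function.uncurry, hFT' t ht]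
      exact tendsto_const_nhds
  -- A supremum over the rationals is measurable in `t`, and by continuity in `x` it still bounds
  -- the values at every real point.
  set ρ : ℝ → ℝ := fun t => ⨆ r : ℚ, |F r t| with hρ
  have hbdd : ∀ t, BddAbove (range fun r : ℚ => |F r t|) := by
    intro t
    obtain ⟨h, hh⟩ := hC0 t
    refine ⟨‖h‖, ?_⟩
    rintro _ ⟨r, rfl⟩
    simp only
    rw [← hh]
    exact h.abs_apply_le _
  have hbound : ∀ x t, |F x t| ≤ ρ t := by
    intro x t
    obtain ⟨h, hh⟩ := hC0 t
    have hcl : IsClosed {y : ℝ | |h y| ≤ ρ t} :=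
      isClosed_le (h.continuous.abs) continuous_const
    have hd : range ((↑) : ℚ → ℝ) ⊆ {y : ℝ | |h y| ≤ ρ t} := by
      rintro _ ⟨r, rfl⟩
      show |h r| ≤ ρ t
      rw [hh]
      exact le_ciSup (hbdd t) r
    have := (hcl.closure_subset_iff.2 hd) (Rat.denseRange_cast x)
    rw [← hh]
    exact this
  have hle : ∀ t M, 0 ≤ M → (∀ x, |f x t| ≤ M) → ρ t ≤ M := by
    intro t M hM h
    refine ciSup_le fun r => ?_
    by_cases ht : t ∈ T
    · rw [hFT t ht]; exact h r
    · rw [hFT' t ht, abs_zero]; exact hM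
  have hρm : Measurable ρ := by
    refine Measurable.iSup fun r => ?_
    exact (hFm.comp (measurable_const.prodMk measurable_id)).abs
  refine ⟨F, ρ, ⟨hFm, hC0, hρm, hbound, fun S => ?_, ?_⟩, hFae, hle⟩
  · refine Integrable.mono (hρ₀ S) hρm.aestronglyMeasurable ?_
    have hfρ' := ae_restrict_of_ae_restrict_of_subset (Ioc_subset_Ioi_self : Ioc 0 S ⊆ Ioi 0) hfρ₀
    filter_upwards [hfρ'] with t ht
    have h0 : 0 ≤ ρ₀ t := (abs_nonneg _).trans (ht 0)
    have h1 : 0 ≤ ρ t := (abs_nonneg _).trans (hbound 0 t)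
    rw [Real.norm_of_nonneg h0, Real.norm_of_nonneg h1]
    exact hle t _ h0 ht
  · refine ⟨|M|, |a|, max t₀ 1, abs_nonneg _, abs_nonneg _, by positivity, fun t ht => ?_⟩
    have ht0 : t₀ ≤ t := (le_max_left _ _).trans ht
    have ht1 : 0 ≤ t := zero_le_one.trans ((le_max_right _ _).trans ht)
    refine hle t _ (by positivity) fun x => (hexp t ht0 x).trans ?_
    gcongr
    · exact le_abs_self _
    · exact le_abs_self _

/-! ### Duhamel's formula: convergence and growth -/

/-- Duhamel's formula for a self-similar kernel, written with averages. -/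
noncomputable def duhamelAvg (α : ℝ) (Φ : ℝ → ℝ) (F : ℝ → ℝ → ℝ) (g : ℝ → ℝ) (x t : ℝ) : ℝ :=
  t ^ (α - 1) * profileAvg Φ g t x +
    ∫ τ in Ioo 0 t, (t - τ) ^ (α - 1) * profileAvg Φ (fun y => F y τ) (t - τ) x

/-- The convolution `∫₀ᵗ (t - τ)^(α-1) ρ(τ) dτ`. -/
noncomputable def rieszPotential (α : ℝ) (ρ : ℝ → ℝ) (t : ℝ) : ℝ :=
  ∫ τ in Ioo 0 t, (t - τ) ^ (α - 1) * ρ τ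

theorem ae_restrict_Ioo_of_Ioi {P : ℝ → Prop} (h : ∀ᵐ t ∂(volume.restrict (Ioi (0 : ℝ))), P t)
    (t : ℝ) : ∀ᵐ τ ∂(volume.restrict (Ioo 0 t)), P τ :=
  ae_restrict_of_ae_restrict_of_subset Ioo_subset_Ioi_self h

theorem duhamel_selfSimilar_eq (α : ℝ) (Φ : ℝ → ℝ) {f F : ℝ → ℝ → ℝ} (g : ℝ → ℝ)
    (hfF : ∀ᵐ t ∂(volume.restrict (Ioi (0 : ℝ))), ∀ x, F x t = f x t) {t : ℝ} (ht : 0 < t) (x : ℝ) :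
    duhamel (selfSimilar α Φ) f g x t = duhamelAvg α Φ F g x t := by
  rw [duhamel, duhamelAvg, integral_selfSimilar_mul α Φ g ht,
    intervalIntegral.integral_of_le ht.le, integral_Ioc_eq_integral_Ioo]
  congr 1
  refine integral_congr_ae ?_
  filter_upwards [ae_restrict_Ioo_of_Ioi hfF t, ae_restrict_mem measurableSet_Ioo] with τ hτ hmem
  simp_rw [← hτ]
  exact integral_selfSimilar_mul α Φ (fun y => F y τ) (sub_pos.2 hmem.2) x

theorem measurable_selfSimilar (α : ℝ) {Φ : ℝ → ℝ} (hΦm : Measurable Φ) :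
    Measurable fun z : ℝ × ℝ => selfSimilar α Φ z.1 z.2 := by
  unfold selfSimilar
  fun_prop

theorem DuhamelConverges.congr {G : ℝ → ℝ → ℝ} {f F : ℝ → ℝ → ℝ}
    (hfF : ∀ᵐ t ∂(volume.restrict (Ioi (0 : ℝ))), ∀ x, F x t = f x t) {x t : ℝ}
    (h : DuhamelConverges G F x t) : DuhamelConverges G f x t := by
  refine Integrable.congr h ?_
  have h1 : ∀ᵐ z ∂((volume : Measure (ℝ × ℝ)).restrict (univ ×ˢ Ioo 0 t)),
      ∀ x, F x z.2 = f x z.2 := by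
    rw [Measure.volume_eq_prod, ← Measure.prod_restrict]
    exact Measure.quasiMeasurePreserving_snd.ae (ae_restrict_Ioo_of_Ioi hfF t)
  filter_upwards [h1] with z hz
  rw [hz]

section
variable {α : ℝ} {Φ : ℝ → ℝ} {F : ℝ → ℝ → ℝ} {ρ : ℝ → ℝ}

/-- Tonelli with the space integral inside: the kernel at time `t - τ` has `L¹` norm `(t-τ)^(α-1) ∫
|Φ|`, so one is left with the Riesz potential of the majorant. -/
theorem duhamelConverges_of_integrableOn (hΦm : Measurable Φ) (hΦ : Integrable Φ)
    (hF : HasMajorant F ρ) {t : ℝ} (ht : IntegrableOn (fun τ => (t - τ) ^ (α - 1) * ρ τ) (Ioo 0 t))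
    (x : ℝ) : DuhamelConverges (selfSimilar α Φ) F x t := by
  have hm : Measurable fun z : ℝ × ℝ => selfSimilar α Φ (t - z.2) (x - z.1) * F z.1 z.2 :=
    ((measurable_selfSimilar α hΦm).comp (by fun_prop : Measurable fun z : ℝ × ℝ =>
      (t - z.2, x - z.1))).mul hF.measurable
  have hnorm : ∀ τ, τ < t → ∀ y, ‖selfSimilar α Φ (t - τ) (x - y) * F y τ‖ =
      selfSimilar α (fun η => |Φ η|) (t - τ) (x - y) * |F y τ| := by
    intro τ hτ y
    have : 0 < t - τ := sub_pos.2 hτ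
    rw [norm_mul, Real.norm_eq_abs, Real.norm_eq_abs, selfSimilar, selfSimilar, abs_mul,
      abs_of_nonneg (by positivity : 0 ≤ (t - τ) ^ (α - 2))]
  rw [DuhamelConverges, IntegrableOn, Measure.volume_eq_prod, ← Measure.prod_restrict,
    Measure.restrict_univ, integrable_prod_iff' hm.aestronglyMeasurable]
  refine ⟨?_, ?_⟩
  · filter_upwards [ae_restrict_mem measurableSet_Ioo] with τ hτ
    refine Integrable.mul_bdd (c := ρ τ) (integrable_selfSimilar α hΦ _ (sub_pos.2 hτ.2) x)
      (hF.continuous τ).aestronglyMeasurable (Eventually.of_forall fun y => hF.bound y τ)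
  · refine Integrable.mono' (ht.const_mul (∫ η, |Φ η|)) ?_ ?_
    · exact hm.norm.stronglyMeasurable.integral_prod_left'.aestronglyMeasurable
    · filter_upwards [ae_restrict_mem measurableSet_Ioo] with τ hτ
      have h0 : 0 < t - τ := sub_pos.2 hτ.2
      simp_rw [hnorm τ hτ.2]
      rw [integral_selfSimilar_mul α _ (fun y => |F y τ|) h0, norm_mul,
        Real.norm_of_nonneg (by positivity), Real.norm_eq_abs]
      have h1 := abs_profileAvg_le (h := fun y => |F y τ|) hΦ.abs
        (fun y => by rw [abs_abs]; exact hF.bound y τ) (t - τ) x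
      simp only [abs_abs] at h1
      calc _ ≤ (t - τ) ^ (α - 1) * ((∫ η, |Φ η|) * ρ τ) := by gcongr
        _ = _ := by ring

theorem measurable_profileAvg_comp (hΦm : Measurable Φ) (hF : Measurable (Function.uncurry F))
    {X : Type*} [MeasurableSpace X] {a b c : X → ℝ} (ha : Measurable a) (hb : Measurable b)
    (hc : Measurable c) : Measurable fun z => profileAvg Φ (fun y => F y (a z)) (b z) (c z) := by
  unfold profileAvg
  refine StronglyMeasurable.measurable ?_
  refine StronglyMeasurable.integral_prod_right
    (f := fun (z : X) (η : ℝ) => Φ η * F (c z - b z * η) (a z)) ?_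
  refine Measurable.stronglyMeasurable ?_
  refine Measurable.mul (by fun_prop) ?_
  exact hF.comp (by fun_prop : Measurable fun z : X × ℝ => (c z.1 - b z.1 * z.2, a z.1))

theorem measurable_duhamelAvg (hΦm : Measurable Φ) (hF : Measurable (Function.uncurry F))
    {g : ℝ → ℝ} (hg : Measurable g) :
    Measurable fun z : ℝ × ℝ => duhamelAvg α Φ F g z.1 z.2 := by
  unfold duhamelAvg
  refine Measurable.add ?_ ?_
  · refine Measurable.mul (by fun_prop) ?_
    exact measurable_profileAvg_comp (F := fun y _ => g y) (a := fun _ => (0 : ℝ)) hΦm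
      (hg.comp measurable_fst) measurable_const measurable_snd measurable_fst
  · simp_rw [← integral_indicator (measurableSet_Ioo : MeasurableSet (Ioo (0 : ℝ) _))]
    refine StronglyMeasurable.measurable ?_
    refine StronglyMeasurable.integral_prod_right (f := fun (z : ℝ × ℝ) (τ : ℝ) =>
      (Ioo 0 z.2).indicator (fun τ => (z.2 - τ) ^ (α - 1) *
        profileAvg Φ (fun y => F y τ) (z.2 - τ) z.1) τ) ?_
    refine Measurable.stronglyMeasurable ?_
    have h1 : Measurable fun w : (ℝ × ℝ) × ℝ => (w.1.2 - w.2) ^ (α - 1) *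
        profileAvg Φ (fun y => F y w.2) (w.1.2 - w.2) w.1.1 :=
      Measurable.mul (by fun_prop)
        (measurable_profileAvg_comp hΦm hF (by fun_prop) (by fun_prop) (by fun_prop))
    have hs : MeasurableSet {w : (ℝ × ℝ) × ℝ | 0 < w.2 ∧ w.2 < w.1.2} :=
      (measurableSet_lt measurable_const measurable_snd).inter
        (measurableSet_lt measurable_snd (by fun_prop))
    exact h1.indicator hs

theorem norm_duhamel_integrand_le (hΦ : Integrable Φ) (hF : HasMajorant F ρ) {t τ : ℝ}
    (hτ : τ < t) (x : ℝ) :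
    ‖(t - τ) ^ (α - 1) * profileAvg Φ (fun y => F y τ) (t - τ) x‖ ≤
      (∫ η, |Φ η|) * ((t - τ) ^ (α - 1) * ρ τ) := by
  have h0 : 0 < t - τ := sub_pos.2 hτ
  rw [norm_mul, Real.norm_of_nonneg (by positivity), Real.norm_eq_abs]
  calc _ ≤ (t - τ) ^ (α - 1) * ((∫ η, |Φ η|) * ρ τ) := by
        gcongr
        exact abs_profileAvg_le hΦ (fun y => hF.bound y τ) _ _
    _ = _ := by ring

theorem measurable_duhamel_integrand (hΦm : Measurable Φ) (hF : HasMajorant F ρ) (t x : ℝ) :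
    Measurable fun τ => (t - τ) ^ (α - 1) * profileAvg Φ (fun y => F y τ) (t - τ) x :=
  Measurable.mul (by fun_prop)
    (measurable_profileAvg_comp hΦm hF.measurable (by fun_prop) (by fun_prop) (by fun_prop))

theorem abs_duhamelAvg_le (hΦ : Integrable Φ) (hF : HasMajorant F ρ) (g : C₀(ℝ, ℝ)) {t : ℝ}
    (ht0 : 0 < t) (ht : IntegrableOn (fun τ => (t - τ) ^ (α - 1) * ρ τ) (Ioo 0 t)) (x : ℝ) :
    |duhamelAvg α Φ F g x t| ≤
      (∫ η, |Φ η|) * (t ^ (α - 1) * ‖g‖ + rieszPotential α ρ t) := by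
  rw [duhamelAvg, mul_add]
  refine (abs_add_le _ _).trans (add_le_add ?_ ?_)
  · rw [abs_mul, abs_of_nonneg (by positivity : 0 ≤ t ^ (α - 1))]
    calc _ ≤ t ^ (α - 1) * ((∫ η, |Φ η|) * ‖g‖) := by
          gcongr
          exact abs_profileAvg_le hΦ g.abs_apply_le _ _
      _ = _ := by ring
  · rw [rieszPotential, ← integral_const_mul, ← Real.norm_eq_abs]
    refine norm_integral_le_of_norm_le (ht.const_mul _) ?_
    filter_upwards [ae_restrict_mem measurableSet_Ioo] with τ hτ
    exact norm_duhamel_integrand_le hΦ hF hτ.2 x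

/-- Each average is continuous and vanishes at infinity; both properties pass through the
`τ`-integral by dominated convergence. -/
theorem exists_zeroAtInfty_duhamelAvg (hΦm : Measurable Φ) (hΦ : Integrable Φ)
    (hF : HasMajorant F ρ) (g : C₀(ℝ, ℝ)) {t : ℝ}
    (ht : IntegrableOn (fun τ => (t - τ) ^ (α - 1) * ρ τ) (Ioo 0 t)) :
    ∃ h : C₀(ℝ, ℝ), ∀ x, h x = duhamelAvg α Φ F g x t := by
  have hcount : (cocompact ℝ).IsCountablyGenerated := by
    rw [cocompact_eq_atBot_atTop]; infer_instance
  have hcont : ∀ (h : C₀(ℝ, ℝ)) σ, Continuous (profileAvg Φ h σ) := fun h σ =>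
    (continuous_profileAvg hΦ h.continuous h.abs_apply_le).comp (by fun_prop :
      Continuous fun x : ℝ => (σ, x))
  have hFh : ∀ τ, ∃ h : C₀(ℝ, ℝ), (fun y => F y τ) = h := fun τ => by
    obtain ⟨h, hh⟩ := hF.zeroAtInfty τ
    exact ⟨h, by ext y; rw [hh]⟩
  refine ⟨⟨⟨fun x => duhamelAvg α Φ F g x t, ?_⟩, ?_⟩, fun x => rfl⟩
  · unfold duhamelAvg
    refine ((hcont g t).const_mul _).add ?_
    refine continuous_of_dominated (bound := fun τ => (∫ η, |Φ η|) * ((t - τ) ^ (α - 1) * ρ τ))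
      (fun x => (measurable_duhamel_integrand hΦm hF t x).aestronglyMeasurable) (fun x => ?_)
      (ht.const_mul _) ?_
    · filter_upwards [ae_restrict_mem measurableSet_Ioo] with τ hτ
      exact norm_duhamel_integrand_le hΦ hF hτ.2 x
    · refine Eventually.of_forall fun τ => ?_
      obtain ⟨h, hh⟩ := hFh τ
      rw [hh]
      exact (hcont h _).const_mul _
  · show Tendsto (fun x => duhamelAvg α Φ F g x t) _ _
    unfold duhamelAvg
    have h1 := (tendsto_profileAvg_cocompact hΦ g t).const_mul (t ^ (α - 1))
    have h2 : Tendsto (fun x => ∫ τ in Ioo 0 t, (t - τ) ^ (α - 1) *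
        profileAvg Φ (fun y => F y τ) (t - τ) x) (cocompact ℝ)
        (𝓝 (∫ τ in Ioo 0 t, (0 : ℝ))) := by
      refine tendsto_integral_filter_of_dominated_convergence
        (fun τ => (∫ η, |Φ η|) * ((t - τ) ^ (α - 1) * ρ τ))
        (Eventually.of_forall fun x => (measurable_duhamel_integrand hΦm hF t x).aestronglyMeasurable)
        (Eventually.of_forall fun x => ?_) (ht.const_mul _) ?_
      · filter_upwards [ae_restrict_mem measurableSet_Ioo] with τ hτ
        exact norm_duhamel_integrand_le hΦ hF hτ.2 x
      · refine Eventually.of_forall fun τ => ?_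
        obtain ⟨h, hh⟩ := hFh τ
        rw [hh]
        simpa using (tendsto_profileAvg_cocompact hΦ h (t - τ)).const_mul ((t - τ) ^ (α - 1))
    have h3 := h1.add h2
    rw [integral_zero, mul_zero, add_zero] at h3
    exact h3

/-- The integral is split at distance `δ` from the singularity: farther away the kernel is at most
`δ^(α-1)`, nearer the majorant is at most `M` and the kernel has integral `δ^α/α`. -/
theorem integrableOn_sub_rpow_mul_of_le (hα : 0 < α) (hα1 : α < 1) (hF : HasMajorant F ρ)
    {t δ M : ℝ} (hδ : 0 < δ) (hM : ∀ τ ∈ Ioo (t - δ) t, ρ τ ≤ M) :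
    IntegrableOn (fun τ => (t - τ) ^ (α - 1) * ρ τ) (Ioo 0 t) ∧
      rieszPotential α ρ t ≤ δ ^ (α - 1) * (∫ τ in Ioo 0 t, ρ τ) + M * (δ ^ α / α) := by
  have hρ : IntegrableOn ρ (Ioo 0 t) := (hF.integrable t).mono_set Ioo_subset_Ioc_self
  have hk : IntegrableOn (fun τ : ℝ => (t - τ) ^ (α - 1)) (Ioo (t - δ) t) := by
    have h1 : IntervalIntegrable (fun s : ℝ => s ^ (α - 1)) volume 0 δ :=
      intervalIntegral.intervalIntegrable_rpow' (by linarith)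
    have h2 := (h1.comp_sub_left t).symm
    rw [sub_zero, intervalIntegrable_iff_integrableOn_Ioo_of_le (by linarith)] at h2
    exact h2
  have hkval : ∫ τ in Ioo (t - δ) t, (t - τ) ^ (α - 1) = δ ^ α / α := by
    rw [← integral_Ioc_eq_integral_Ioo, ← intervalIntegral.integral_of_le (by linarith),
      intervalIntegral.integral_comp_sub_left (fun s : ℝ => s ^ (α - 1)) t, sub_self, sub_sub_cancel,
      integral_rpow (Or.inl (by linarith))]
    rw [sub_add_cancel, Real.zero_rpow hα.ne', sub_zero]
  set B : ℝ → ℝ := fun τ => δ ^ (α - 1) * (Ioo 0 t).indicator ρ τ +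
    M * (Ioo (t - δ) t).indicator (fun τ : ℝ => (t - τ) ^ (α - 1)) τ with hB
  have hi1 := (integrable_indicator_iff measurableSet_Ioo).2 hρ
  have hi2 := (integrable_indicator_iff measurableSet_Ioo).2 hk
  have hBint : Integrable B := (hi1.const_mul _).add (hi2.const_mul _)
  have hM0 : 0 ≤ M := (hF.nonneg _).trans (hM (t - δ / 2) ⟨by linarith, by linarith⟩)
  have hle : ∀ τ ∈ Ioo 0 t, ‖(t - τ) ^ (α - 1) * ρ τ‖ ≤ B τ := by
    intro τ hτ
    have h0 : 0 < t - τ := sub_pos.2 hτ.2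
    have hρ0 := hF.nonneg τ
    rw [Real.norm_of_nonneg (by positivity)]
    simp only [hB]
    rw [indicator_of_mem hτ]
    by_cases h : τ ∈ Ioo (t - δ) t
    · rw [indicator_of_mem h]
      have h1 : (t - τ) ^ (α - 1) * ρ τ ≤ (t - τ) ^ (α - 1) * M := by
        gcongr; exact hM τ h
      have h2 : 0 ≤ δ ^ (α - 1) * ρ τ := by positivity
      linarith
    · rw [indicator_of_notMem h, mul_zero, add_zero]
      have h1 : δ ≤ t - τ := by
        by_contra h'
        exact h ⟨by linarith, hτ.2⟩
      gcongr ?_ * _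
      exact Real.rpow_le_rpow_of_nonpos hδ h1 (by linarith)
  have hint : IntegrableOn (fun τ => (t - τ) ^ (α - 1) * ρ τ) (Ioo 0 t) := by
    refine Integrable.mono' hBint.integrableOn ?_ ?_
    · have := hF.measurable_bound
      exact (by fun_prop : Measurable fun τ => (t - τ) ^ (α - 1) * ρ τ).aestronglyMeasurable
    · filter_upwards [ae_restrict_mem measurableSet_Ioo] with τ hτ using hle τ hτ
  refine ⟨hint, ?_⟩
  have hB0 : 0 ≤ᵐ[volume] B := by
    refine Eventually.of_forall fun τ => ?_
    simp only [hB]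
    refine add_nonneg (mul_nonneg (by positivity) ?_) (mul_nonneg hM0 ?_)
    · exact indicator_nonneg (fun τ _ => hF.nonneg τ) τ
    · exact indicator_nonneg (fun τ hτ => Real.rpow_nonneg (sub_nonneg.2 hτ.2.le) _) τ
  calc rieszPotential α ρ t ≤ ∫ τ in Ioo 0 t, B τ := by
        refine setIntegral_mono_on hint hBint.integrableOn measurableSet_Ioo fun τ hτ => ?_
        exact (le_abs_self _).trans (hle τ hτ)
    _ ≤ ∫ τ, B τ := setIntegral_le_integral hBint hB0
    _ = _ := by
      simp only [hB]
      rw [integral_add (hi1.const_mul _) (hi2.const_mul _), integral_const_mul, integral_const_mul,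
        integral_indicator measurableSet_Ioo, integral_indicator measurableSet_Ioo, hkval]

theorem HasMajorant.exists_integrableOn_exp (hF : HasMajorant F ρ) :
    ∃ a : ℝ, 0 ≤ a ∧ ∀ c, a < c → IntegrableOn (fun t => Real.exp (-(c * t)) * ρ t) (Ioi 0) := by
  obtain ⟨M, a, t₀, hM, ha, ht₀, hle⟩ := hF.expType
  refine ⟨a, ha, fun c hc => integrableOn_exp_neg_mul_of_expType hF.integrable (M := M) (t₀ := t₀)
    (fun t ht => ?_) hc⟩
  rw [abs_of_nonneg (hF.nonneg t)]
  exact hle t ht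

theorem integrableOn_kernel_mul_majorant (hα : 0 < α) {c : ℝ} (hc : 0 < c)
    (hcρ : IntegrableOn (fun t => Real.exp (-(c * t)) * ρ t) (Ioi 0)) :
    IntegrableOn (Function.uncurry fun σ τ : ℝ => (σ ^ (α - 1) * Real.exp (-(c * σ))) *
      (Real.exp (-(c * τ)) * ρ τ)) (Ioi (0 : ℝ) ×ˢ Ioi (0 : ℝ)) := by
  have := (integrableOn_rpow_mul_exp_neg_mul hα hc).mul_prod hcρ
  rw [Measure.prod_restrict] at this
  exact this

theorem kernel_mul_majorant_shear (c t τ : ℝ) :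
    ((t - τ) ^ (α - 1) * Real.exp (-(c * (t - τ)))) * (Real.exp (-(c * τ)) * ρ τ) =
      Real.exp (-(c * t)) * ((t - τ) ^ (α - 1) * ρ τ) := by
  have : Real.exp (-(c * t)) = Real.exp (-(c * (t - τ))) * Real.exp (-(c * τ)) := by
    rw [← Real.exp_add]; congr 1; ring
  rw [this]; ring

/-- The weight `e^{-ct}` factors as `e^{-c(t-τ)} e^{-cτ}` and makes both convolution factors
integrable on the half line. Fubini on the sheared quadrant then gives convergence for almost every
`t`, and the weight is divided out. -/
theorem HasMajorant.ae_integrableOn_sub_rpow_mul (hF : HasMajorant F ρ) (hα : 0 < α) :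
    ∀ᵐ t : ℝ, IntegrableOn (fun τ => (t - τ) ^ (α - 1) * ρ τ) (Ioo 0 t) := by
  obtain ⟨a, ha, hac⟩ := hF.exists_integrableOn_exp
  filter_upwards [ae_integrableOn_shear (integrableOn_kernel_mul_majorant hα
    (by linarith : 0 < a + 1) (hac (a + 1) (by linarith)))] with t ht
  simp only [kernel_mul_majorant_shear] at ht
  have h2 := ht.const_mul (Real.exp ((a + 1) * t))
  refine h2.congr (Eventually.of_forall fun τ => ?_)
  simp only
  rw [← mul_assoc, ← Real.exp_add, add_neg_cancel, Real.exp_zero, one_mul]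

theorem integrable_exp_mul_rieszPotential (hα : 0 < α) {c : ℝ} (hc : 0 < c)
    (hcρ : IntegrableOn (fun t => Real.exp (-(c * t)) * ρ t) (Ioi 0)) :
    Integrable (fun t => Real.exp (-(c * t)) * rieszPotential α ρ t) := by
  have := integrable_integral_shear (integrableOn_kernel_mul_majorant hα hc hcρ)
  simp only [kernel_mul_majorant_shear, integral_const_mul] at this
  exact this

theorem HasMajorant.integrableOn_rieszPotential (hF : HasMajorant F ρ) (hα : 0 < α) (T : ℝ) :
    IntegrableOn (rieszPotential α ρ) (Ioc 0 T) := by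
  obtain ⟨a, ha, hac⟩ := hF.exists_integrableOn_exp
  have h1 := integrable_exp_mul_rieszPotential hα (by linarith : 0 < a + 1)
    (hac (a + 1) (by linarith))
  have h2 := IntegrableOn.continuousOn_mul_of_subset (K := Icc 0 T)
      (g := fun t => Real.exp ((a + 1) * t)) (by fun_prop) (h1.integrableOn (s := Ioc 0 T))
      isCompact_Icc measurableSet_Ioc Ioc_subset_Icc_self
  refine h2.congr (Eventually.of_forall fun t => ?_)
  simp only
  rw [← mul_assoc, ← Real.exp_add, add_neg_cancel, Real.exp_zero, one_mul]

/-- The split is made at `δ = 1`: once `t ≥ t₀ + 1` the window `(t-1,t)` lies where the majorant is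
exponentially bounded, and `∫₀ᵗ ρ ≤ e^{ct} ∫ e^{-cτ} ρ` handles the rest. -/
theorem HasMajorant.exists_expType_rieszPotential (hF : HasMajorant F ρ) (hα : 0 < α)
    (hα1 : α < 1) : ∃ M a t₁ : ℝ, 0 ≤ M ∧ 0 ≤ a ∧ 1 ≤ t₁ ∧ ∀ t, t₁ ≤ t →
      IntegrableOn (fun τ => (t - τ) ^ (α - 1) * ρ τ) (Ioo 0 t) ∧
      rieszPotential α ρ t ≤ M * Real.exp (a * t) := by
  obtain ⟨M, a, t₀, hM, ha, ht₀, hle⟩ := hF.expType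
  obtain ⟨a', ha', hac⟩ := hF.exists_integrableOn_exp
  set c := max a (a' + 1) with hc
  have hca : a ≤ c := le_max_left _ _
  have hc0 : 0 ≤ c := ha.trans hca
  have hint := hac c (lt_of_lt_of_le (by linarith) (le_max_right _ _))
  set I := ∫ τ in Ioi (0 : ℝ), Real.exp (-(c * τ)) * ρ τ with hI
  have hI0 : 0 ≤ I := integral_nonneg fun τ => mul_nonneg (Real.exp_pos _).le (hF.nonneg τ)
  refine ⟨I + M / α, c, t₀ + 1, by positivity, hc0, by linarith, fun t ht => ?_⟩
  have h := integrableOn_sub_rpow_mul_of_le (t := t) (δ := 1) (M := M * Real.exp (a * t)) hα hα1 hF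
    one_pos (fun τ hτ => by
      refine (hle τ (by linarith [hτ.1])).trans ?_
      have := hτ.2.le
      gcongr)
  refine ⟨h.1, h.2.trans ?_⟩
  have hρint : ∫ τ in Ioo 0 t, ρ τ ≤ I * Real.exp (c * t) := by
    have h1 : ∫ τ in Ioo 0 t, ρ τ ≤ ∫ τ in Ioo 0 t, Real.exp (c * t) *
        (Real.exp (-(c * τ)) * ρ τ) := by
      refine setIntegral_mono_on ((hF.integrable t).mono_set Ioo_subset_Ioc_self)
        ((hint.mono_set Ioo_subset_Ioi_self).const_mul _) measurableSet_Ioo fun τ hτ => ?_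
      rw [← mul_assoc, ← Real.exp_add]
      refine le_mul_of_one_le_left (hF.nonneg τ) (Real.one_le_exp ?_)
      have : c * τ ≤ c * t := by have := hτ.2.le; gcongr
      linarith
    refine h1.trans ?_
    rw [integral_const_mul, mul_comm]
    gcongr
    refine setIntegral_mono_set hint (Eventually.of_forall fun τ =>
      mul_nonneg (Real.exp_pos _).le (hF.nonneg τ)) (Eventually.of_forall Ioo_subset_Ioi_self)
  have hexp : Real.exp (a * t) ≤ Real.exp (c * t) := by
    have : 0 ≤ t := by linarith
    gcongr
  rw [Real.one_rpow, Real.one_rpow, one_mul, add_mul]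
  refine add_le_add hρint ?_
  calc _ = M / α * Real.exp (a * t) := by ring
    _ ≤ _ := by gcongr

theorem isExpTypeC0_duhamelAvg (hα : 0 < α) (hα1 : α < 1) (hΦm : Measurable Φ) (hΦ : Integrable Φ)
    (hF : HasMajorant F ρ) (g : C₀(ℝ, ℝ)) : IsExpTypeC0 (duhamelAvg α Φ F g) where
  measurable := (measurable_duhamelAvg hΦm hF.measurable g.continuous.measurable).aestronglyMeasurable
  zeroAtInfty := by
    filter_upwards [ae_restrict_of_ae (hF.ae_integrableOn_sub_rpow_mul hα)] with t ht
    exact exists_zeroAtInfty_duhamelAvg hΦm hΦ hF g ht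
  locallyIntegrable := by
    refine ⟨fun t => (∫ η, |Φ η|) * (t ^ (α - 1) * ‖g‖ + rieszPotential α ρ t), fun T => ?_, ?_⟩
    · refine Integrable.const_mul (Integrable.add ?_ (hF.integrableOn_rieszPotential hα T)) _
      refine Integrable.mul_const ?_ _
      rcases le_or_gt T 0 with hT | hT
      · rw [Ioc_eq_empty (not_lt.2 hT)]; simp
      · have h1 : IntervalIntegrable (fun s : ℝ => s ^ (α - 1)) volume 0 T :=
          intervalIntegral.intervalIntegrable_rpow' (by linarith)
        exact (intervalIntegrable_iff_integrableOn_Ioc_of_le hT.le).1 h1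
    · filter_upwards [ae_restrict_of_ae (hF.ae_integrableOn_sub_rpow_mul hα),
        ae_restrict_mem measurableSet_Ioi] with t ht ht0 x
      exact abs_duhamelAvg_le hΦ hF g ht0 ht x
  expType := by
    obtain ⟨M, a, t₁, hM, ha, ht₁, hle⟩ := hF.exists_expType_rieszPotential hα hα1
    refine ⟨(∫ η, |Φ η|) * (‖g‖ + M), a, t₁, fun t ht x => ?_⟩
    have ht1 : 1 ≤ t := ht₁.trans ht
    have hC : 0 ≤ ∫ η, |Φ η| := integral_nonneg fun _ => abs_nonneg _
    refine (abs_duhamelAvg_le hΦ hF g (by linarith) (hle t ht).1 x).trans ?_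
    rw [mul_assoc, add_mul]
    refine mul_le_mul_of_nonneg_left (add_le_add ?_ (hle t ht).2) hC
    · have h1 : t ^ (α - 1) ≤ 1 := Real.rpow_le_one_of_one_le_of_nonpos ht1 (by linarith)
      have h2 : 1 ≤ Real.exp (a * t) := Real.one_le_exp (by positivity)
      calc _ ≤ 1 * ‖g‖ := by gcongr
        _ = ‖g‖ * 1 := by ring
        _ ≤ _ := by gcongr

end

/-! ### Powers as Schwartz multipliers -/

theorem iteratedDeriv_cpow_affine {s c : ℂ} (hs : 0 < s.re) (hc : c.re = 0) (n : ℕ) (β : ℂ) :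
    ∃ K : ℂ, iteratedDeriv n (fun ξ : ℝ => (s + c * ξ) ^ β) =
      fun ξ : ℝ => K * (s + c * ξ) ^ (β - n) := by
  induction n with
  | zero => exact ⟨1, by simp⟩
  | succ n ih =>
    obtain ⟨K, hK⟩ := ih
    refine ⟨K * ((β - n) * c), ?_⟩
    rw [iteratedDeriv_succ, hK]
    ext ξ
    have h1 : HasDerivAt (fun z : ℂ => s + c * z) c (ξ : ℂ) := by
      simpa using ((hasDerivAt_id (ξ : ℂ)).const_mul c).const_add s
    have hre : 0 < (s + c * ξ).re := by simp [hc, hs]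
    have h2 := ((h1.cpow_const (c := β - n) (Or.inl hre)).const_mul K).comp_ofReal
    rw [h2.deriv]
    push_cast
    rw [show β - (n + 1 : ℂ) = β - n - 1 by ring]
    ring

theorem differentiable_cpow_affine {s c : ℂ} (hs : 0 < s.re) (hc : c.re = 0) (β : ℂ) :
    Differentiable ℝ (fun ξ : ℝ => (s + c * ξ) ^ β) := by
  intro ξ
  have h1 : HasDerivAt (fun z : ℂ => s + c * z) c (ξ : ℂ) := by
    simpa using ((hasDerivAt_id (ξ : ℂ)).const_mul c).const_add s
  have hre : 0 < (s + c * ξ).re := by simp [hc, hs]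
  exact (h1.cpow_const (c := β) (Or.inl hre)).comp_ofReal.differentiableAt

/-- The `n`-th derivative is a constant times the power `α - n ≤ 1` of a quantity whose modulus is
at least `Re s` and at most linear in `ξ`. Negative exponents are controlled by the lower bound,
positive ones by the upper. -/
theorem hasTemperateGrowth_cpow_affine {s c : ℂ} (hs : 0 < s.re) (hc : c.re = 0) {α : ℝ}
    (hα : α ≤ 1) : Function.HasTemperateGrowth (fun ξ : ℝ => (s + c * ξ) ^ (α : ℂ)) := by
  refine ⟨contDiff_of_differentiable_iteratedDeriv fun m _ => ?_, fun n => ?_⟩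
  · obtain ⟨K, hK⟩ := iteratedDeriv_cpow_affine hs hc m α
    rw [hK]
    exact (differentiable_cpow_affine hs hc _).const_mul K
  · obtain ⟨K, hK⟩ := iteratedDeriv_cpow_affine hs hc n α
    set r : ℝ := α - n with hr
    have hr1 : r ≤ 1 := by have : (0 : ℝ) ≤ n := n.cast_nonneg; linarith
    refine ⟨1, ‖K‖ * (s.re ^ r + 1 + ‖s‖ + ‖c‖), fun ξ => ?_⟩
    rw [norm_iteratedFDeriv_eq_norm_iteratedDeriv, hK]
    have e : (α : ℂ) - n = (r : ℂ) := by rw [hr]; push_cast; rfl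
    simp only
    rw [norm_mul, e, Complex.norm_cpow_real, pow_one, mul_assoc]
    gcongr
    set x := ‖s + c * ξ‖ with hx
    have hx1 : s.re ≤ x := by
      have := Complex.re_le_norm (s + c * ξ)
      simpa [hc] using this
    have hx0 : 0 < x := hs.trans_le hx1
    have hx2 : x ≤ ‖s‖ + ‖c‖ * ‖ξ‖ := by
      refine (norm_add_le _ _).trans ?_
      rw [norm_mul, Complex.norm_real]
    have h3 : x ^ r ≤ s.re ^ r + 1 + x := by
      have hp : 0 < s.re ^ r := by positivity
      rcases le_or_gt r 0 with h | h
      · have := Real.rpow_le_rpow_of_nonpos hs hx1 h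
        linarith
      · have h4 : x ^ r ≤ (1 + x) ^ r := by gcongr; linarith
        have h5 : (1 + x) ^ r ≤ (1 + x) ^ (1 : ℝ) := by gcongr; linarith
        rw [Real.rpow_one] at h5
        linarith
    have hp : 0 < s.re ^ r := by positivity
    have hξ := norm_nonneg ξ
    have hsn := norm_nonneg s
    have hcn := norm_nonneg c
    nlinarith [mul_nonneg (add_nonneg (add_nonneg hp.le zero_le_one) hsn) hξ]

/-! ### The unnormalised Fourier transform -/

section FourierT

theorem norm_exp_neg_I_mul (x ξ : ℝ) : ‖Complex.exp (-(Complex.I * x * ξ))‖ = 1 := by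
  have : -(Complex.I * x * ξ) = ((-(x * ξ) : ℝ) : ℂ) * Complex.I := by push_cast; ring
  rw [this, Complex.norm_exp_ofReal_mul_I]

theorem norm_fourierT_le (φ : ℝ → ℂ) (x : ℝ) : ‖fourierT φ x‖ ≤ ∫ ξ, ‖φ ξ‖ := by
  rw [fourierT]
  refine (norm_integral_le_integral_norm _).trans (le_of_eq ?_)
  refine integral_congr_ae (Eventually.of_forall fun ξ => ?_)
  simp only
  rw [norm_mul, norm_exp_neg_I_mul, one_mul]

theorem integrable_exp_mul {φ : ℝ → ℂ} (hφ : Integrable φ) (x : ℝ) :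
    Integrable fun ξ : ℝ => Complex.exp (-(Complex.I * x * ξ)) * φ ξ := by
  refine Integrable.bdd_mul (c := 1) hφ (by fun_prop) (Eventually.of_forall fun ξ => ?_)
  rw [norm_exp_neg_I_mul]

theorem continuous_fourierT {φ : ℝ → ℂ} (hφ : Integrable φ) : Continuous (fourierT φ) := by
  unfold fourierT
  refine continuous_of_dominated (bound := fun ξ => ‖φ ξ‖) ?_ ?_ hφ.norm ?_
  · exact fun x => (integrable_exp_mul hφ x).aestronglyMeasurable
  · refine fun x => Eventually.of_forall fun ξ => ?_
    rw [norm_mul, norm_exp_neg_I_mul, one_mul]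
  · exact Eventually.of_forall fun ξ => by fun_prop

theorem fourierT_eq_fourier (φ : ℝ → ℂ) (x : ℝ) : fourierT φ x = 𝓕 φ (x / (2 * Real.pi)) := by
  rw [Real.fourier_real_eq_integral_exp_smul, fourierT]
  refine integral_congr_ae (Eventually.of_forall fun ξ => ?_)
  simp only [smul_eq_mul]
  congr 2
  have := Real.pi_ne_zero
  push_cast
  field_simp

theorem integrable_fourierT_schwartz (φ : 𝓢(ℝ, ℂ)) : Integrable (fourierT φ) := by
  have h : fourierT φ = fun x => (𝓕 φ : 𝓢(ℝ, ℂ)) (x / (2 * Real.pi)) := by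
    ext x
    rw [fourierT_eq_fourier]; rfl
  rw [h]
  exact (𝓕 φ : 𝓢(ℝ, ℂ)).integrable.comp_div (by positivity)

theorem integral_mul_fourierT {a b : ℝ → ℂ} (ha : Integrable a) (hb : Integrable b) :
    ∫ ξ, fourierT a ξ * b ξ = ∫ x, a x * fourierT b x := by
  have h1 : ∀ ξ, fourierT a ξ * b ξ =
      ∫ x : ℝ, Complex.exp (-(Complex.I * ξ * x)) * (a x * b ξ) := by
    intro ξ
    rw [fourierT, ← integral_mul_const]
    refine integral_congr_ae (Eventually.of_forall fun x => ?_)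
    simp only; ring
  have h2 : ∀ x, a x * fourierT b x =
      ∫ ξ : ℝ, Complex.exp (-(Complex.I * ξ * x)) * (a x * b ξ) := by
    intro x
    rw [fourierT, ← integral_const_mul]
    refine integral_congr_ae (Eventually.of_forall fun ξ => ?_)
    simp only
    rw [show Complex.I * ξ * x = Complex.I * x * ξ by ring]
    ring
  simp_rw [h1, h2]
  refine integral_integral_swap ?_
  have h3 : Integrable (fun z : ℝ × ℝ => a z.2 * b z.1) := by
    have := hb.mul_prod ha
    exact this.congr (Eventually.of_forall fun z => mul_comm _ _)
  refine Integrable.bdd_mul (c := 1) h3 (by fun_prop) (Eventually.of_forall fun z => ?_)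
  rw [norm_exp_neg_I_mul]

theorem fourierT_exp_mul (ψ : ℝ → ℂ) (y z : ℝ) :
    fourierT (fun ξ => Complex.exp (-(Complex.I * y * ξ)) * ψ ξ) z = fourierT ψ (y + z) := by
  unfold fourierT
  refine integral_congr_ae (Eventually.of_forall fun ξ => ?_)
  simp only
  rw [← mul_assoc, ← Complex.exp_add]
  congr 2
  push_cast; ring

theorem fourierT_comp_mul (Φ : ℝ → ℂ) (σ ξ : ℝ) (hσ : 0 < σ) :
    fourierT (fun x => Φ (x / σ)) ξ = σ * fourierT Φ (ξ * σ) := by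
  unfold fourierT
  have := Measure.integral_comp_mul_left (fun x : ℝ => Complex.exp (-(Complex.I * ξ * x)) *
    Φ (x / σ)) σ
  rw [abs_of_pos (by positivity), eq_inv_smul_iff₀ hσ.ne', Complex.real_smul] at this
  rw [← this]
  congr 1
  refine integral_congr_ae (Eventually.of_forall fun x => ?_)
  simp only
  rw [mul_div_cancel_left₀ _ hσ.ne']
  congr 2
  push_cast; ring

end FourierT

/-! ### The kernel as an inverse Fourier-Laplace transform -/

section
variable {α : ℝ} {Φ : ℝ → ℝ}

theorem fourierT_selfSimilar {t : ℝ} (ht : 0 < t) (ξ : ℝ) :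
    fourierT (fun x => (selfSimilar α Φ t x : ℂ)) ξ =
      ((t ^ (α - 1) : ℝ) : ℂ) * fourierT (fun y => (Φ y : ℂ)) (ξ * t) := by
  have h1 : fourierT (fun x => (selfSimilar α Φ t x : ℂ)) ξ =
      ((t ^ (α - 2) : ℝ) : ℂ) * fourierT (fun x => (Φ (x / t) : ℂ)) ξ := by
    unfold fourierT selfSimilar
    rw [← integral_const_mul]
    refine integral_congr_ae (Eventually.of_forall fun x => ?_)
    simp only
    push_cast; ring
  have h2 := fourierT_comp_mul (fun y => (Φ y : ℂ)) t ξ ht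
  rw [h1, h2, ← mul_assoc, ← Complex.ofReal_mul]
  congr 2
  rw [show α - 2 = (α - 1) - 1 by ring, Real.rpow_sub_one ht.ne' (α - 1), div_mul_cancel₀ _ ht.ne']

theorem norm_laplace_integrand_le (Φ : ℝ → ℝ) {s : ℂ} {t : ℝ} (ht : 0 < t) (ξ : ℝ) :
    ‖Complex.exp (-(s * t)) * (((t ^ (α - 1) : ℝ) : ℂ) * fourierT (fun y => (Φ y : ℂ)) (ξ * t))‖ ≤
      (t ^ (α - 1) * Real.exp (-(s.re * t))) * ∫ η, |Φ η| := by
  have h1 := norm_fourierT_le (fun y => (Φ y : ℂ)) (ξ * t)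
  simp only [Complex.norm_real, Real.norm_eq_abs] at h1
  rw [norm_mul, norm_mul, Complex.norm_real, Real.norm_of_nonneg (by positivity), Complex.norm_exp]
  have e : (-(s * t)).re = -(s.re * t) := by simp
  rw [e]
  calc _ ≤ Real.exp (-(s.re * t)) * (t ^ (α - 1) * ∫ η, |Φ η|) := by gcongr
    _ = _ := by ring

theorem integrableOn_laplace_integrand (hα : 0 < α) (hΦ : Integrable Φ) {s : ℂ} (hs : 0 < s.re)
    (ξ : ℝ) : IntegrableOn (fun t : ℝ => Complex.exp (-(s * t)) *
      (((t ^ (α - 1) : ℝ) : ℂ) * fourierT (fun y => (Φ y : ℂ)) (ξ * t))) (Ioi 0) := by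
  refine Integrable.mono' ((integrableOn_rpow_mul_exp_neg_mul hα hs).mul_const (∫ η, |Φ η|)) ?_ ?_
  · have := (continuous_fourierT (φ := fun y => (Φ y : ℂ)) hΦ.ofReal).measurable
    exact (by fun_prop : Measurable fun t : ℝ => Complex.exp (-(s * t)) *
      (((t ^ (α - 1) : ℝ) : ℂ) * fourierT (fun y => (Φ y : ℂ)) (ξ * t))).aestronglyMeasurable
  · filter_upwards [ae_restrict_mem measurableSet_Ioi] with t ht
    exact norm_laplace_integrand_le Φ ht ξ

/-- The witness `t^(α-1) Φ̂(ξt)` is the Fourier transform of the integrable kernel at time `t`, so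
the duality is the multiplication formula for `L¹` functions. -/
theorem isInverseFourierLaplace_selfSimilar (hα : 0 < α) (hΦ : Integrable Φ) {K : ℝ → ℂ → ℂ}
    (hL : ∀ ξ s, 0 < s.re → ∫ t in Ioi (0 : ℝ), Complex.exp (-(s * t)) *
      (((t ^ (α - 1) : ℝ) : ℂ) * fourierT (fun y => (Φ y : ℂ)) (ξ * t)) = K ξ s) :
    IsInverseFourierLaplace K (selfSimilar α Φ) := by
  have hc := continuous_fourierT (φ := fun y => (Φ y : ℂ)) hΦ.ofReal
  refine ⟨fun ξ t => ((t ^ (α - 1) : ℝ) : ℂ) * fourierT (fun y => (Φ y : ℂ)) (ξ * t),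
    fun ξ => ⟨?_, fun s hs => ⟨integrableOn_laplace_integrand hα hΦ hs ξ, hL ξ s hs⟩⟩,
    fun t ht φ => ?_⟩
  · refine ContinuousOn.mul ?_ (by fun_prop)
    refine Complex.continuous_ofReal.comp_continuousOn fun t ht => ?_
    exact (Real.continuousAt_rpow_const _ _ (Or.inl (ne_of_gt ht))).continuousWithinAt
  · have hG : Integrable fun x => (selfSimilar α Φ t x : ℂ) := by
      have := integrable_selfSimilar α hΦ t ht 0
      have h2 := this.comp_neg
      simp only [sub_neg_eq_add, zero_add] at h2
      exact h2.ofReal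
    refine ⟨?_, ?_, ?_⟩
    · refine Integrable.bdd_mul (c := t ^ (α - 1) * ∫ η, ‖(Φ η : ℂ)‖) φ.integrable
        (by fun_prop) (Eventually.of_forall fun ξ => ?_)
      rw [norm_mul, Complex.norm_real, Real.norm_of_nonneg (by positivity)]
      gcongr
      exact norm_fourierT_le _ _
    · exact hG.mul_bdd (c := ∫ ξ, ‖φ ξ‖) (continuous_fourierT φ.integrable).aestronglyMeasurable
        (Eventually.of_forall fun x => norm_fourierT_le _ _)
    · rw [← integral_mul_fourierT hG φ.integrable]
      refine integral_congr_ae (Eventually.of_forall fun ξ => ?_)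
      simp only
      rw [fourierT_selfSimilar ht]
end

/-! ### Pairing convolutions with test functions -/

section Convolution

theorem integrable_conv_mul {k : ℝ → ℝ} {a : ℝ → ℂ} (hk : Measurable k) (hki : Integrable k)
    (ha : Continuous a) (hai : Integrable a) :
    Integrable (fun z : ℝ × ℝ => (k (z.1 - z.2) : ℂ) * a z.1) := by
  have hm : Measurable (fun z : ℝ × ℝ => (k (z.1 - z.2) : ℂ) * a z.1) := by
    have := ha.measurable
    fun_prop
  rw [Measure.volume_eq_prod, integrable_prod_iff hm.aestronglyMeasurable]
  refine ⟨Eventually.of_forall fun x => ?_, ?_⟩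
  · exact ((hki.comp_sub_left x).ofReal (𝕜 := ℂ)).mul_const (a x)
  · have : ∀ x, ∫ y, ‖(k (x - y) : ℂ) * a x‖ = (∫ y, |k y|) * ‖a x‖ := by
      intro x
      simp_rw [norm_mul, Complex.norm_real, Real.norm_eq_abs]
      rw [integral_mul_const, integral_sub_left_eq_self (fun y => |k y|)]
    simp_rw [this]
    exact hai.norm.const_mul _

/-- A translation of `k` is a modulation of the test function; the multiplication formula then moves
the transform from `ψ` to `k`. -/
theorem integral_conv_mul_fourierT {k : ℝ → ℝ} {ψ : ℝ → ℂ} (hki : Integrable k)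
    (hψ : Integrable ψ) (y : ℝ) :
    ∫ x, (k (x - y) : ℂ) * fourierT ψ x =
      fourierT (fun ξ => fourierT (fun x => (k x : ℂ)) ξ * ψ ξ) y := by
  have h1 := integral_add_right_eq_self (fun x => (k (x - y) : ℂ) * fourierT ψ x) y (μ := volume)
  simp only [add_sub_cancel_right] at h1
  rw [← h1]
  have h2 := integral_mul_fourierT (a := fun x => (k x : ℂ)) hki.ofReal (integrable_exp_mul hψ y)
  simp_rw [fourierT_exp_mul] at h2
  simp_rw [add_comm _ y]
  rw [← h2, fourierT]
  refine integral_congr_ae (Eventually.of_forall fun ξ => ?_)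
  simp only; ring

/-- The function `h` is only bounded, so its own Fourier transform is never taken: Fubini moves the
convolution onto the transform of the test function, which is integrable. -/
theorem fourierPair_conv {k h : ℝ → ℝ} {ψ : ℝ → ℂ} (hk : Measurable k) (hki : Integrable k)
    (hψ : Integrable ψ) (hψ' : Integrable (fourierT ψ)) (hh : Measurable h) {M : ℝ}
    (hM : ∀ x, |h x| ≤ M) :
    fourierPair (fun x => ∫ y, k (x - y) * h y) ψ =
      fourierPair h (fun ξ => fourierT (fun x => (k x : ℂ)) ξ * ψ ξ) := by
  have hi : Integrable (fun z : ℝ × ℝ => (h z.2 : ℂ) * ((k (z.1 - z.2) : ℂ) * fourierT ψ z.1)) := by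
    refine Integrable.bdd_mul (c := M) (integrable_conv_mul hk hki (continuous_fourierT hψ) hψ')
      (Complex.measurable_ofReal.comp (hh.comp measurable_snd)).aestronglyMeasurable (Eventually.of_forall fun z => ?_)
    rw [Complex.norm_real]; exact hM _
  have hs := integral_integral_swap
    (f := fun x y => (h y : ℂ) * ((k (x - y) : ℂ) * fourierT ψ x)) hi
  have h1 : ∀ x, ∫ y, (h y : ℂ) * ((k (x - y) : ℂ) * fourierT ψ x) =
      ((∫ y, k (x - y) * h y : ℝ) : ℂ) * fourierT ψ x := by
    intro x
    rw [← integral_complex_ofReal, ← integral_mul_const]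
    refine integral_congr_ae (Eventually.of_forall fun y => ?_)
    simp only; push_cast; ring
  have h2 : ∀ y, ∫ x, (h y : ℂ) * ((k (x - y) : ℂ) * fourierT ψ x) =
      (h y : ℂ) * fourierT (fun ξ => fourierT (fun x => (k x : ℂ)) ξ * ψ ξ) y := by
    intro y
    rw [integral_const_mul, integral_conv_mul_fourierT hki hψ]
  simp_rw [h1, h2] at hs
  exact hs

/-- Multiplication by `k̂` correlates the transform of `ψ` with `k`. Integrability and the norm
bound therefore come from `k ∈ L¹`, with no regularity of `k̂` required. -/
theorem integrable_fourierT_mul {k : ℝ → ℝ} {ψ : ℝ → ℂ} (hk : Measurable k) (hki : Integrable k)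
    (hψ : Integrable ψ) (hψ' : Integrable (fourierT ψ)) :
    Integrable (fourierT (fun ξ => fourierT (fun x => (k x : ℂ)) ξ * ψ ξ)) ∧
    ∫ y, ‖fourierT (fun ξ => fourierT (fun x => (k x : ℂ)) ξ * ψ ξ) y‖ ≤
      (∫ x, |k x|) * ∫ x, ‖fourierT ψ x‖ := by
  have hi := integrable_conv_mul hk hki (continuous_fourierT hψ) hψ'
  have h1 : Integrable (fourierT (fun ξ => fourierT (fun x => (k x : ℂ)) ξ * ψ ξ)) := by
    have := hi.integral_prod_right
    simpa only [integral_conv_mul_fourierT hki hψ] using this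
  refine ⟨h1, ?_⟩
  have h2 : ∫ y, ‖fourierT (fun ξ => fourierT (fun x => (k x : ℂ)) ξ * ψ ξ) y‖ ≤
      ∫ y, ∫ x, ‖(k (x - y) : ℂ) * fourierT ψ x‖ := by
    refine integral_mono h1.norm hi.norm.integral_prod_right fun y => ?_
    simp only
    rw [← integral_conv_mul_fourierT hki hψ]
    exact norm_integral_le_integral_norm _
  refine h2.trans (le_of_eq ?_)
  rw [← integral_integral_swap (f := fun x y => ‖(k (x - y) : ℂ) * fourierT ψ x‖) hi.norm,
    ← integral_const_mul]
  refine integral_congr_ae (Eventually.of_forall fun x => ?_)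
  simp_rw [norm_mul, Complex.norm_real, Real.norm_eq_abs]
  rw [integral_mul_const, integral_sub_left_eq_self (fun y => |k y|)]

theorem norm_fourierPair_le {h : ℝ → ℝ} {ψ : ℝ → ℂ} (hψ' : Integrable (fourierT ψ))
    {M : ℝ} (hM : ∀ x, |h x| ≤ M) : ‖fourierPair h ψ‖ ≤ M * ∫ x, ‖fourierT ψ x‖ := by
  rw [fourierPair, ← integral_const_mul]
  refine norm_integral_le_of_norm_le (hψ'.norm.const_mul M) (Eventually.of_forall fun x => ?_)
  rw [norm_mul, Complex.norm_real]
  gcongr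
  exact hM x

end Convolution

/-! ### The Fourier-Laplace transform of Duhamel's formula -/

section Equation
variable {α : ℝ} {Φ : ℝ → ℝ} {F : ℝ → ℝ → ℝ} {ρ : ℝ → ℝ} {ψ : ℝ → ℂ}

theorem integral_abs_selfSimilar {t : ℝ} (ht : 0 < t) :
    ∫ x, |selfSimilar α Φ t x| = t ^ (α - 1) * ∫ η, |Φ η| := by
  have h := integral_selfSimilar_mul α (fun η => |Φ η|) (fun _ => 1) ht 0
  simp only [mul_one, profileAvg, zero_sub] at h
  rw [integral_neg_eq_self (fun y => selfSimilar α (fun η => |Φ η|) t y)] at h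
  rw [← h]
  refine integral_congr_ae (Eventually.of_forall fun x => ?_)
  simp only [selfSimilar]
  rw [abs_mul, abs_of_nonneg (by positivity : 0 ≤ t ^ (α - 2))]

theorem fourierPair_profileAvg (hΦm : Measurable Φ) (hΦ : Integrable Φ)
    (hψ : Integrable ψ) (hψ' : Integrable (fourierT ψ)) {h : ℝ → ℝ} (hh : Measurable h) {M : ℝ}
    (hM : ∀ x, |h x| ≤ M) {σ : ℝ} (hσ : 0 < σ) :
    fourierPair (fun x => σ ^ (α - 1) * profileAvg Φ h σ x) ψ =
      fourierPair h (fun ξ => fourierT (fun x => (selfSimilar α Φ σ x : ℂ)) ξ * ψ ξ) := by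
  have hk : Measurable (selfSimilar α Φ σ) :=
    (measurable_selfSimilar α hΦm).comp (measurable_const.prodMk measurable_id)
  have hki : Integrable (selfSimilar α Φ σ) := by
    have h2 := (integrable_selfSimilar α hΦ σ hσ 0).comp_neg
    simpa only [sub_neg_eq_add, zero_add] using h2
  simp_rw [← integral_selfSimilar_mul α Φ h hσ]
  exact fourierPair_conv hk hki hψ hψ' hh hM

/-- The kernel acts on the test function as multiplication by its Fourier transform, and the Laplace
integral in `σ` of that multiplier is `K`. The `σ`-integral has to pass inside two integrals, first
over the space variable and then over the frequency. -/
theorem integral_exp_mul_fourierPair_profileAvg (hα : 0 < α) (hΦm : Measurable Φ)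
    (hΦ : Integrable Φ) {K : ℝ → ℂ → ℂ}
    (hL : ∀ ξ s, 0 < s.re → ∫ t in Ioi (0 : ℝ), Complex.exp (-(s * t)) *
      (((t ^ (α - 1) : ℝ) : ℂ) * fourierT (fun y => (Φ y : ℂ)) (ξ * t)) = K ξ s)
    (hψc : Continuous ψ) (hψ : Integrable ψ) (hψ' : Integrable (fourierT ψ)) {h : ℝ → ℝ}
    (hh : Measurable h) {M : ℝ} (hM : ∀ x, |h x| ≤ M) {s : ℂ} (hs : 0 < s.re) :
    ∫ σ in Ioi (0 : ℝ), Complex.exp (-(s * σ)) *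
      fourierPair (fun x => σ ^ (α - 1) * profileAvg Φ h σ x) ψ =
      fourierPair h (fun ξ => K ξ s * ψ ξ) := by
  set P : ℝ → ℝ → ℂ := fun ξ σ => ((σ ^ (α - 1) : ℝ) : ℂ) * fourierT (fun y => (Φ y : ℂ)) (ξ * σ)
    with hP
  have hPm : Measurable fun z : ℝ × ℝ => P z.1 z.2 := by
    have := (continuous_fourierT (φ := fun y => (Φ y : ℂ)) hΦ.ofReal).measurable
    fun_prop
  have hM0 : 0 ≤ M := (abs_nonneg _).trans (hM 0)
  set R : ℝ → ℝ → ℂ := fun σ y => fourierT (fun ξ => P ξ σ * ψ ξ) y with hR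
  have hRm : Measurable fun z : ℝ × ℝ => R z.1 z.2 := by
    simp only [hR, fourierT]
    refine StronglyMeasurable.measurable ?_
    refine StronglyMeasurable.integral_prod_right (f := fun (z : ℝ × ℝ) (ξ : ℝ) =>
      Complex.exp (-(Complex.I * z.2 * ξ)) * (P ξ z.1 * ψ ξ)) ?_
    refine Measurable.stronglyMeasurable ?_
    have h1 : Measurable fun w : (ℝ × ℝ) × ℝ => P w.2 w.1.1 :=
      hPm.comp (by fun_prop : Measurable fun w : (ℝ × ℝ) × ℝ => (w.2, w.1.1))
    have h2 := hψc.measurable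
    fun_prop
  have hRσ : ∀ σ, 0 < σ → Integrable (R σ) ∧
      ∫ y, ‖R σ y‖ ≤ σ ^ (α - 1) * (∫ η, |Φ η|) * ∫ x, ‖fourierT ψ x‖ := by
    intro σ hσ
    have hk : Measurable (selfSimilar α Φ σ) :=
      (measurable_selfSimilar α hΦm).comp (measurable_const.prodMk measurable_id)
    have hki : Integrable (selfSimilar α Φ σ) := by
      have h2 := (integrable_selfSimilar α hΦ σ hσ 0).comp_neg
      simpa only [sub_neg_eq_add, zero_add] using h2
    have := integrable_fourierT_mul hk hki hψ hψ'
    simp_rw [fourierT_selfSimilar hσ, integral_abs_selfSimilar hσ] at this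
    exact this
  have step1 : ∫ σ in Ioi (0 : ℝ), Complex.exp (-(s * σ)) *
      fourierPair (fun x => σ ^ (α - 1) * profileAvg Φ h σ x) ψ =
      ∫ σ in Ioi (0 : ℝ), ∫ y, Complex.exp (-(s * σ)) * ((h y : ℂ) * R σ y) := by
    refine setIntegral_congr_fun measurableSet_Ioi fun σ hσ => ?_
    rw [fourierPair_profileAvg hΦm hΦ hψ hψ' hh hM hσ, fourierPair, ← integral_const_mul]
    simp_rw [fourierT_selfSimilar (α := α) (Φ := Φ) hσ]
    rfl
  -- First exchange: `h` is bounded and the `L¹` norm of `R σ` is at most a constant times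
  -- `σ^(α-1)`.
  have hint1 : Integrable (Function.uncurry fun (σ y : ℝ) =>
      Complex.exp (-(s * σ)) * ((h y : ℂ) * R σ y)) ((volume.restrict (Ioi (0 : ℝ))).prod volume) := by
    have hm : Measurable (Function.uncurry fun (σ y : ℝ) =>
      Complex.exp (-(s * σ)) * ((h y : ℂ) * R σ y)) := by
      simp only [Function.uncurry_def]
      fun_prop
    rw [integrable_prod_iff hm.aestronglyMeasurable]
    refine ⟨?_, ?_⟩
    · filter_upwards [ae_restrict_mem measurableSet_Ioi] with σ hσ
      show Integrable fun y : ℝ => Complex.exp (-(s * σ)) * ((h y : ℂ) * R σ y)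
      refine Integrable.const_mul ?_ _
      refine Integrable.bdd_mul (c := M) (hRσ σ hσ).1 (by fun_prop) (Eventually.of_forall fun y => ?_)
      rw [Complex.norm_real]; exact hM y
    · refine Integrable.mono' ((integrableOn_rpow_mul_exp_neg_mul hα hs).mul_const
        (M * ((∫ η, |Φ η|) * ∫ x, ‖fourierT ψ x‖))) ?_ ?_
      · exact hm.norm.stronglyMeasurable.integral_prod_right'.aestronglyMeasurable
      · filter_upwards [ae_restrict_mem measurableSet_Ioi] with σ hσ
        have hσ' : (0 : ℝ) < σ := hσ
        rw [Real.norm_of_nonneg (integral_nonneg fun _ => norm_nonneg _)]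
        simp only [Function.uncurry]
        have e : ‖Complex.exp (-(s * σ))‖ = Real.exp (-(s.re * σ)) := by
          rw [Complex.norm_exp]; simp
        have h3 : ∫ y, ‖Complex.exp (-(s * σ)) * ((h y : ℂ) * R σ y)‖ ≤
            ∫ y, Real.exp (-(s.re * σ)) * M * ‖R σ y‖ := by
          refine integral_mono_of_nonneg (Eventually.of_forall fun _ => norm_nonneg _)
            ((hRσ σ hσ).1.norm.const_mul _) (Eventually.of_forall fun y => ?_)
          simp only
          rw [norm_mul, norm_mul, e, Complex.norm_real, mul_assoc]
          gcongr
          exact hM y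
        refine h3.trans ?_
        rw [integral_const_mul]
        calc _ ≤ Real.exp (-(s.re * σ)) * M *
              (σ ^ (α - 1) * (∫ η, |Φ η|) * ∫ x, ‖fourierT ψ x‖) := by
              gcongr; exact (hRσ σ hσ).2
          _ = _ := by ring
  rw [step1, integral_integral_swap hint1, fourierPair]
  refine integral_congr_ae (Eventually.of_forall fun y => ?_)
  simp only
  -- Second exchange, at fixed `y`: here `ψ` is integrable and `Φ̂` is bounded by the `L¹` norm of
  -- `Φ`.
  have hint2 : Integrable (Function.uncurry fun (σ ξ : ℝ) => Complex.exp (-(s * σ)) *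
      (Complex.exp (-(Complex.I * y * ξ)) * (P ξ σ * ψ ξ)))
      ((volume.restrict (Ioi (0 : ℝ))).prod volume) := by
    have hb := ((integrableOn_rpow_mul_exp_neg_mul hα hs).mul_const (∫ η, |Φ η|)).mul_prod hψ.norm
    refine Integrable.mono' hb ?_ ?_
    · have h1 : Measurable fun w : ℝ × ℝ => P w.2 w.1 :=
        hPm.comp (by fun_prop : Measurable fun w : ℝ × ℝ => (w.2, w.1))
      have h2 := hψc.measurable
      simp only [Function.uncurry_def]
      exact (by fun_prop : Measurable fun z : ℝ × ℝ => Complex.exp (-(s * z.1)) *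
        (Complex.exp (-(Complex.I * y * z.2)) * (P z.2 z.1 * ψ z.2))).aestronglyMeasurable
    · have hmem : ∀ᵐ z ∂((volume.restrict (Ioi (0 : ℝ))).prod (volume : Measure ℝ)),
          z.1 ∈ Ioi (0 : ℝ) :=
        Measure.quasiMeasurePreserving_fst.ae (ae_restrict_mem measurableSet_Ioi)
      filter_upwards [hmem] with z hz
      have h1 := norm_laplace_integrand_le (α := α) Φ (s := s) hz z.2
      simp only [Function.uncurry]
      calc _ = ‖Complex.exp (-(s * z.1)) * P z.2 z.1‖ * ‖ψ z.2‖ := by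
            rw [norm_mul, norm_mul, norm_exp_neg_I_mul, one_mul, norm_mul (P z.2 z.1) (ψ z.2),
              norm_mul (Complex.exp (-(s * z.1))) (P z.2 z.1), mul_assoc]
        _ ≤ _ := by gcongr
  have step2 : ∫ σ in Ioi (0 : ℝ), Complex.exp (-(s * σ)) * ((h y : ℂ) * R σ y) =
      (h y : ℂ) * ∫ σ in Ioi (0 : ℝ), ∫ ξ : ℝ, Complex.exp (-(s * σ)) *
        (Complex.exp (-(Complex.I * y * ξ)) * (P ξ σ * ψ ξ)) := by
    rw [← integral_const_mul]
    refine integral_congr_ae (Eventually.of_forall fun σ => ?_)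
    simp only [hR, fourierT]
    rw [integral_const_mul]; ring
  rw [step2, integral_integral_swap hint2]
  congr 1
  rw [fourierT]
  refine integral_congr_ae (Eventually.of_forall fun ξ => ?_)
  simp only
  rw [← hL ξ s hs, ← integral_mul_const, ← integral_const_mul]
  refine integral_congr_ae (Eventually.of_forall fun σ => ?_)
  simp only [hP]
  ring

theorem norm_fourierPair_profileAvg_le (hΦ : Integrable Φ) (hψ' : Integrable (fourierT ψ))
    {h : ℝ → ℝ} {M : ℝ} (hM : ∀ x, |h x| ≤ M) {σ : ℝ} (hσ : 0 < σ) :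
    ‖fourierPair (fun x => σ ^ (α - 1) * profileAvg Φ h σ x) ψ‖ ≤
      σ ^ (α - 1) * M * ((∫ η, |Φ η|) * ∫ x, ‖fourierT ψ x‖) := by
  refine (norm_fourierPair_le hψ' (M := σ ^ (α - 1) * ((∫ η, |Φ η|) * M)) fun x => ?_).trans
    (le_of_eq (by ring))
  rw [abs_mul, abs_of_nonneg (by positivity)]
  gcongr
  exact abs_profileAvg_le hΦ hM _ _

theorem measurable_fourierPair_profileAvg (hΦm : Measurable Φ)
    (hF : Measurable (Function.uncurry F)) (hψ : Integrable ψ) {X : Type*} [MeasurableSpace X]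
    {a b : X → ℝ} (ha : Measurable a) (hb : Measurable b) :
    Measurable fun z =>
      fourierPair (fun x => b z ^ (α - 1) * profileAvg Φ (fun y => F y (a z)) (b z) x) ψ := by
  unfold fourierPair
  refine StronglyMeasurable.measurable ?_
  refine StronglyMeasurable.integral_prod_right (f := fun (z : X) (x : ℝ) =>
    ((b z ^ (α - 1) * profileAvg Φ (fun y => F y (a z)) (b z) x : ℝ) : ℂ) * fourierT ψ x) ?_
  refine Measurable.stronglyMeasurable ?_
  have h1 : Measurable fun w : X × ℝ => profileAvg Φ (fun y => F y (a w.1)) (b w.1) w.2 :=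
    measurable_profileAvg_comp hΦm hF (by fun_prop) (by fun_prop) (by fun_prop)
  have h2 := (continuous_fourierT hψ).measurable
  simp only [Function.uncurry_def]
  fun_prop

theorem fourierPair_duhamelAvg (hΦm : Measurable Φ) (hΦ : Integrable Φ)
    (hψ : Integrable ψ) (hψ' : Integrable (fourierT ψ)) (hF : HasMajorant F ρ) (g : C₀(ℝ, ℝ)) {t : ℝ}
    (ht : IntegrableOn (fun τ => (t - τ) ^ (α - 1) * ρ τ) (Ioo 0 t)) :
    fourierPair (fun x => duhamelAvg α Φ F g x t) ψ =
      fourierPair (fun x => t ^ (α - 1) * profileAvg Φ g t x) ψ +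
      ∫ τ in Ioo 0 t, fourierPair
        (fun x => (t - τ) ^ (α - 1) * profileAvg Φ (fun y => F y τ) (t - τ) x) ψ := by
  set I : ℝ → ℝ → ℝ := fun x τ => (t - τ) ^ (α - 1) * profileAvg Φ (fun y => F y τ) (t - τ) x with hI
  have hIm : Measurable fun z : ℝ × ℝ => I z.1 z.2 :=
    Measurable.mul (by fun_prop)
      (measurable_profileAvg_comp hΦm hF.measurable (by fun_prop) (by fun_prop) (by fun_prop))
  have hint : Integrable (Function.uncurry fun (x τ : ℝ) => ((I x τ : ℝ) : ℂ) * fourierT ψ x)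
      ((volume : Measure ℝ).prod (volume.restrict (Ioo 0 t))) := by
    have hb := hψ'.norm.mul_prod (ht.const_mul (∫ η, |Φ η|))
    refine Integrable.mono' hb ?_ ?_
    · have h2 := (continuous_fourierT hψ).measurable
      exact (by fun_prop : Measurable fun z : ℝ × ℝ =>
        ((I z.1 z.2 : ℝ) : ℂ) * fourierT ψ z.1).aestronglyMeasurable
    · have hmem : ∀ᵐ z ∂((volume : Measure ℝ).prod (volume.restrict (Ioo 0 t))),
          z.2 ∈ Ioo 0 t :=
        Measure.quasiMeasurePreserving_snd.ae (ae_restrict_mem measurableSet_Ioo)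
      filter_upwards [hmem] with z hz
      simp only [Function.uncurry]
      rw [norm_mul, Complex.norm_real, mul_comm]
      gcongr
      exact norm_duhamel_integrand_le hΦ hF hz.2 z.1
  have hswap := integral_integral_swap hint
  have h1 : ∀ x, ∫ τ in Ioo 0 t, ((I x τ : ℝ) : ℂ) * fourierT ψ x =
      ((∫ τ in Ioo 0 t, I x τ : ℝ) : ℂ) * fourierT ψ x := by
    intro x
    rw [integral_mul_const, integral_complex_ofReal]
  simp_rw [h1] at hswap
  have hgi : Integrable fun x => ((t ^ (α - 1) * profileAvg Φ g t x : ℝ) : ℂ) * fourierT ψ x := by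
    refine Integrable.bdd_mul (c := |t ^ (α - 1)| * ((∫ η, |Φ η|) * ‖g‖)) hψ' ?_
      (Eventually.of_forall fun x => ?_)
    · have h3 : Continuous fun x => profileAvg Φ g t x :=
        (continuous_profileAvg hΦ g.continuous g.abs_apply_le).comp (by fun_prop :
          Continuous fun x : ℝ => (t, x))
      exact (by fun_prop : Continuous fun x =>
        ((t ^ (α - 1) * profileAvg Φ g t x : ℝ) : ℂ)).aestronglyMeasurable
    · rw [Complex.norm_real, norm_mul, Real.norm_eq_abs, Real.norm_eq_abs]
      gcongr
      exact abs_profileAvg_le hΦ g.abs_apply_le _ _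
  have hIi : Integrable fun x => ((∫ τ in Ioo 0 t, I x τ : ℝ) : ℂ) * fourierT ψ x := by
    have := hint.integral_prod_left
    simpa only [Function.uncurry, h1] using this
  have e : fourierPair (fun x => duhamelAvg α Φ F g x t) ψ =
      ∫ x, (((t ^ (α - 1) * profileAvg Φ g t x : ℝ) : ℂ) * fourierT ψ x +
        ((∫ τ in Ioo 0 t, I x τ : ℝ) : ℂ) * fourierT ψ x) := by
    rw [fourierPair]
    refine integral_congr_ae (Eventually.of_forall fun x => ?_)
    simp only [duhamelAvg]
    rw [Complex.ofReal_add, add_mul]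
  rw [e, integral_add hgi hIi, hswap]
  rfl

theorem norm_exp_neg_mul_ofReal (s : ℂ) (t : ℝ) :
    ‖Complex.exp (-(s * t))‖ = Real.exp (-(s.re * t)) := by
  rw [Complex.norm_exp]; simp

/-- The exponential weight factors over the convolution, so the shear makes the two times
independent. The integral over the age `σ` puts the multiplier `K` on the test function, and the
integral over `τ` is the transform of the source. -/
theorem fourierLaplacePair_duhamelAvg (hα : 0 < α) (hΦm : Measurable Φ)
    (hΦ : Integrable Φ) {K : ℝ → ℂ → ℂ}
    (hL : ∀ ξ s, 0 < s.re → ∫ t in Ioi (0 : ℝ), Complex.exp (-(s * t)) *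
      (((t ^ (α - 1) : ℝ) : ℂ) * fourierT (fun y => (Φ y : ℂ)) (ξ * t)) = K ξ s)
    (hψc : Continuous ψ) (hψ : Integrable ψ) (hψ' : Integrable (fourierT ψ))
    (hF : HasMajorant F ρ) (g : C₀(ℝ, ℝ)) {s : ℂ} (hs : 0 < s.re)
    (hsρ : IntegrableOn (fun t => Real.exp (-(s.re * t)) * ρ t) (Ioi 0)) :
    fourierLaplacePair (duhamelAvg α Φ F g) s ψ =
      fourierPair g (fun ξ => K ξ s * ψ ξ) + fourierLaplacePair F s (fun ξ => K ξ s * ψ ξ) := by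
  set Q : ℝ → ℝ → ℂ := fun σ τ =>
    fourierPair (fun x => σ ^ (α - 1) * profileAvg Φ (fun y => F y τ) σ x) ψ with hQ
  have hQm : Measurable fun z : ℝ × ℝ => Q z.1 z.2 :=
    measurable_fourierPair_profileAvg hΦm hF.measurable hψ measurable_snd measurable_fst
  set q : ℝ → ℝ → ℂ := fun σ τ =>
    Complex.exp (-(s * τ)) * (Complex.exp (-(s * σ)) * Q σ τ) with hq
  have hqi : IntegrableOn (Function.uncurry q) (Ioi (0 : ℝ) ×ˢ Ioi (0 : ℝ)) := by
    refine Integrable.mono' ((integrableOn_kernel_mul_majorant hα hs hsρ).mul_const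
      ((∫ η, |Φ η|) * ∫ x, ‖fourierT ψ x‖)) ?_ ?_
    · simp only [hq, Function.uncurry_def]
      exact (by fun_prop : Measurable fun z : ℝ × ℝ => Complex.exp (-(s * z.2)) *
        (Complex.exp (-(s * z.1)) * Q z.1 z.2)).aestronglyMeasurable
    · filter_upwards [ae_restrict_mem (measurableSet_Ioi.prod measurableSet_Ioi)] with z hz
      have h1 : (0 : ℝ) < z.1 := hz.1
      simp only [hq, Function.uncurry]
      rw [norm_mul, norm_mul, norm_exp_neg_mul_ofReal, norm_exp_neg_mul_ofReal]
      calc _ ≤ Real.exp (-(s.re * z.2)) * (Real.exp (-(s.re * z.1)) * (z.1 ^ (α - 1) * ρ z.2 *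
            ((∫ η, |Φ η|) * ∫ x, ‖fourierT ψ x‖))) := by
            gcongr
            exact norm_fourierPair_profileAvg_le hΦ hψ' (fun x => hF.bound x z.2) h1
        _ = _ := by ring
  set g1 : ℝ → ℂ := fun t => Complex.exp (-(s * t)) *
    fourierPair (fun x => t ^ (α - 1) * profileAvg Φ g t x) ψ with hg1
  have hg1i : IntegrableOn g1 (Ioi 0) := by
    refine Integrable.mono' ((integrableOn_rpow_mul_exp_neg_mul hα hs).mul_const
      (‖g‖ * ((∫ η, |Φ η|) * ∫ x, ‖fourierT ψ x‖))) ?_ ?_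
    · have h1 : Measurable fun t : ℝ => fourierPair (fun x => t ^ (α - 1) * profileAvg Φ g t x) ψ :=
        measurable_fourierPair_profileAvg (F := fun y _ => g y) (a := fun _ => (0 : ℝ)) hΦm
          (g.continuous.measurable.comp measurable_fst) hψ measurable_const measurable_id
      exact (by fun_prop : Measurable g1).aestronglyMeasurable
    · filter_upwards [ae_restrict_mem measurableSet_Ioi] with t ht
      have ht' : (0 : ℝ) < t := ht
      simp only [hg1]
      rw [norm_mul, norm_exp_neg_mul_ofReal]
      calc _ ≤ Real.exp (-(s.re * t)) * (t ^ (α - 1) * ‖g‖ *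
            ((∫ η, |Φ η|) * ∫ x, ‖fourierT ψ x‖)) := by
            gcongr
            exact norm_fourierPair_profileAvg_le hΦ hψ' g.abs_apply_le ht'
        _ = _ := by ring
  have hmain : fourierLaplacePair (duhamelAvg α Φ F g) s ψ =
      ∫ t in Ioi (0 : ℝ), (g1 t + ∫ τ in Ioo 0 t, q (t - τ) τ) := by
    rw [fourierLaplacePair]
    refine integral_congr_ae ?_
    filter_upwards [ae_restrict_of_ae (hF.ae_integrableOn_sub_rpow_mul hα)] with t ht
    rw [fourierPair_duhamelAvg hΦm hΦ hψ hψ' hF g ht, mul_add]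
    congr 1
    rw [← integral_const_mul]
    refine integral_congr_ae (Eventually.of_forall fun τ => ?_)
    simp only [hq]
    rw [← mul_assoc, ← Complex.exp_add]
    congr 2
    push_cast; ring
  rw [hmain, integral_add hg1i (integrable_integral_shear hqi).integrableOn, integral_shear hqi]
  congr 1
  · exact integral_exp_mul_fourierPair_profileAvg hα hΦm hΦ hL hψc hψ hψ' g.continuous.measurable
      g.abs_apply_le hs
  · rw [fourierLaplacePair]
    refine integral_congr_ae (Eventually.of_forall fun τ => ?_)
    simp only [hq]
    rw [integral_const_mul]
    congr 1
    exact integral_exp_mul_fourierPair_profileAvg hα hΦm hΦ hL hψc hψ hψ'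
      (hF.continuous τ).measurable (fun x => hF.bound x τ) hs

end Equation

/-! ### The equation in terms of the full symbol -/

section FourierLaplace
variable {F : ℝ → ℝ → ℝ} {ρ : ℝ → ℝ}

theorem fourierLaplacePair_congr {w W : ℝ → ℝ → ℝ}
    (h : ∀ᵐ t ∂(volume.restrict (Ioi (0 : ℝ))), ∀ x, W x t = w x t) (s : ℂ) (ψ : ℝ → ℂ) :
    fourierLaplacePair W s ψ = fourierLaplacePair w s ψ := by
  refine integral_congr_ae ?_
  filter_upwards [h] with t ht
  simp_rw [ht]

theorem HasMajorant.integrableOn_fourierPair (hF : HasMajorant F ρ) {ψ : ℝ → ℂ}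
    (hψ : Integrable ψ) (hψ' : Integrable (fourierT ψ)) {s : ℂ}
    (hs : IntegrableOn (fun t => Real.exp (-(s.re * t)) * ρ t) (Ioi 0)) :
    IntegrableOn (fun t : ℝ => Complex.exp (-(s * t)) * fourierPair (fun x => F x t) ψ) (Ioi 0) := by
  refine Integrable.mono' (Integrable.mul_const hs (∫ x, ‖fourierT ψ x‖)) ?_ ?_
  · have hm : Measurable fun t => fourierPair (fun x => F x t) ψ := by
      unfold fourierPair
      refine StronglyMeasurable.measurable ?_
      refine StronglyMeasurable.integral_prod_right (f := fun (t : ℝ) (x : ℝ) =>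
        ((F x t : ℝ) : ℂ) * fourierT ψ x) ?_
      refine Measurable.stronglyMeasurable ?_
      have h1 : Measurable fun w : ℝ × ℝ => F w.2 w.1 :=
        hF.measurable.comp (by fun_prop : Measurable fun w : ℝ × ℝ => (w.2, w.1))
      have h2 := (continuous_fourierT hψ).measurable
      simp only [Function.uncurry_def]
      exact (Complex.measurable_ofReal.comp h1).mul (h2.comp measurable_snd)
    exact (by fun_prop : Measurable fun t : ℝ =>
      Complex.exp (-(s * t)) * fourierPair (fun x => F x t) ψ).aestronglyMeasurable
  · refine Eventually.of_forall fun t => ?_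
    rw [norm_mul, norm_exp_neg_mul_ofReal, mul_assoc]
    gcongr
    exact norm_fourierPair_le hψ' fun x => hF.bound x t

theorem IsExpTypeC0.exists_integrableOn_fourierPair {w : ℝ → ℝ → ℝ} (hw : IsExpTypeC0 w) :
    ∃ a : ℝ, 0 ≤ a ∧ ∀ s : ℂ, a < s.re → ∀ ψ : ℝ → ℂ, Integrable ψ → Integrable (fourierT ψ) →
      IntegrableOn (fun t : ℝ => Complex.exp (-(s * t)) * fourierPair (fun x => w x t) ψ)
        (Ioi 0) := by
  obtain ⟨F, ρ, hF, hFw, -⟩ := hw.exists_hasMajorant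
  obtain ⟨a, ha, hac⟩ := hF.exists_integrableOn_exp
  refine ⟨a, ha, fun s hs ψ hψ hψ' => ?_⟩
  refine (hF.integrableOn_fourierPair hψ hψ' (hac _ hs)).congr ?_
  filter_upwards [hFw] with t ht
  simp_rw [ht]

theorem fourierPair_linear {h : ℝ → ℝ} (hh : Measurable h) {M : ℝ} (hM : ∀ x, |h x| ≤ M)
    {ψ₁ ψ₂ : ℝ → ℂ} (h₁ : Integrable ψ₁) (h₂ : Integrable ψ₂) (h₁' : Integrable (fourierT ψ₁))
    (h₂' : Integrable (fourierT ψ₂)) (c₁ c₂ : ℂ) :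
    fourierPair h (fun ξ => c₁ * ψ₁ ξ + c₂ * ψ₂ ξ) =
      c₁ * fourierPair h ψ₁ + c₂ * fourierPair h ψ₂ := by
  have e : ∀ x, fourierT (fun ξ => c₁ * ψ₁ ξ + c₂ * ψ₂ ξ) x =
      c₁ * fourierT ψ₁ x + c₂ * fourierT ψ₂ x := by
    intro x
    unfold fourierT
    rw [← integral_const_mul, ← integral_const_mul, ← integral_add
      ((integrable_exp_mul h₁ x).const_mul _) ((integrable_exp_mul h₂ x).const_mul _)]
    refine integral_congr_ae (Eventually.of_forall fun ξ => ?_)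
    simp only; ring
  have hi : ∀ {φ : ℝ → ℂ}, Integrable φ → Integrable fun x => (h x : ℂ) * φ x := fun hφ =>
    Integrable.bdd_mul (c := M) hφ (by fun_prop) (Eventually.of_forall fun x => by
      rw [Complex.norm_real]; exact hM x)
  unfold fourierPair
  rw [← integral_const_mul, ← integral_const_mul, ← integral_add
    ((hi h₁').const_mul _) ((hi h₂').const_mul _)]
  refine integral_congr_ae (Eventually.of_forall fun x => ?_)
  simp only
  rw [e]; ring

theorem exists_schwartz_cpow_mul {s c : ℂ} (hs : 0 < s.re) (hc : c.re = 0) {α : ℝ} (hα : α ≤ 1)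
    (φ : 𝓢(ℝ, ℂ)) : ∃ χ : 𝓢(ℝ, ℂ), ∀ ξ : ℝ, χ ξ = (s + c * ξ) ^ (α : ℂ) * φ ξ :=
  ⟨SchwartzMap.smulLeftCLM ℂ (fun ξ : ℝ => (s + c * ξ) ^ (α : ℂ)) φ, fun ξ => by
    rw [SchwartzMap.smulLeftCLM_apply_apply (hasTemperateGrowth_cpow_affine hs hc hα), smul_eq_mul]⟩

/-- Both fractional powers keep the test function Schwartz, so by linearity the two derivative terms
merge into one pairing with the symbol. The weights `p` and `1 - p` add to one in front of `g`. -/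
theorem IsExpTypeC0.exists_materialDerivPair_eq {w : ℝ → ℝ → ℝ} (hw : IsExpTypeC0 w) {α : ℝ}
    (hα : α ≤ 1) (p : ℝ) (g : ℝ → ℝ) :
    ∃ a : ℝ, 0 ≤ a ∧ ∀ s : ℂ, a < s.re → ∀ φ : 𝓢(ℝ, ℂ),
      (p : ℂ) * materialDerivPair α (-1) w g s φ + (1 - p : ℂ) * materialDerivPair α 1 w g s φ =
        fourierLaplacePair w s (fun ξ => symbolZeta α p ξ s * φ ξ) - fourierPair g φ := by
  obtain ⟨F, ρ, hF, hFw, -⟩ := hw.exists_hasMajorant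
  obtain ⟨a, ha, hac⟩ := hF.exists_integrableOn_exp
  refine ⟨a, ha, fun s hs φ => ?_⟩
  have hs0 : 0 < s.re := ha.trans_lt hs
  obtain ⟨χ₁, hχ₁⟩ := exists_schwartz_cpow_mul (c := ((-1 : ℝ) : ℂ) * Complex.I) hs0 (by simp) hα φ
  obtain ⟨χ₂, hχ₂⟩ := exists_schwartz_cpow_mul (c := ((1 : ℝ) : ℂ) * Complex.I) hs0 (by simp) hα φ
  have e1 : (fun ξ : ℝ => (s + ((-1 : ℝ) : ℂ) * (Complex.I * ξ)) ^ (α : ℂ) * φ ξ) = χ₁ := by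
    ext ξ; rw [hχ₁, mul_assoc]
  have e2 : (fun ξ : ℝ => (s + ((1 : ℝ) : ℂ) * (Complex.I * ξ)) ^ (α : ℂ) * φ ξ) = χ₂ := by
    ext ξ; rw [hχ₂, mul_assoc]
  have e3 : (fun ξ : ℝ => symbolZeta α p ξ s * φ ξ) =
      fun ξ => (p : ℂ) * χ₁ ξ + (1 - p : ℂ) * χ₂ ξ := by
    ext ξ
    rw [hχ₁, hχ₂, symbolZeta]
    have h1 : s + ((-1 : ℝ) : ℂ) * Complex.I * ξ = s - Complex.I * ξ := by push_cast; ring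
    have h2 : s + ((1 : ℝ) : ℂ) * Complex.I * ξ = s + Complex.I * ξ := by push_cast; ring
    rw [h1, h2]; ring
  have hi : ∀ χ : 𝓢(ℝ, ℂ), IntegrableOn (fun t : ℝ => Complex.exp (-(s * t)) *
      fourierPair (fun x => F x t) χ) (Ioi 0) := fun χ =>
    hF.integrableOn_fourierPair χ.integrable (integrable_fourierT_schwartz χ) (hac _ hs)
  have hlin : fourierLaplacePair F s (fun ξ => (p : ℂ) * χ₁ ξ + (1 - p : ℂ) * χ₂ ξ) =
      (p : ℂ) * fourierLaplacePair F s χ₁ + (1 - p : ℂ) * fourierLaplacePair F s χ₂ := by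
    unfold fourierLaplacePair
    rw [← integral_const_mul, ← integral_const_mul, ← integral_add
      ((hi χ₁).const_mul _) ((hi χ₂).const_mul _)]
    refine integral_congr_ae (Eventually.of_forall fun t => ?_)
    simp only
    rw [fourierPair_linear (hF.continuous t).measurable (fun x => hF.bound x t) χ₁.integrable
      χ₂.integrable (integrable_fourierT_schwartz χ₁) (integrable_fourierT_schwartz χ₂)]
    ring
  rw [materialDerivPair, materialDerivPair, e1, e2, e3, ← fourierLaplacePair_congr hFw,
    ← fourierLaplacePair_congr hFw, ← fourierLaplacePair_congr hFw, hlin]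
  ring

end FourierLaplace

/-! ### The initial condition and existence -/

section Initial
variable {α : ℝ} {Φ : ℝ → ℝ} {F : ℝ → ℝ → ℝ} {ρ : ℝ → ℝ}

/-- This is the semigroup law `I^(1-α) I^α = I^1` without its Gamma normalisation: after Fubini the
integral over the intermediate time is the Beta integral `B(α, 1-α) = Γ(α) Γ(1-α)`, for every `τ <
t`. -/
theorem HasMajorant.integral_sub_rpow_mul_rieszPotential (hF : HasMajorant F ρ) (hα : 0 < α)
    (hα1 : α < 1) (t : ℝ) :
    IntegrableOn (fun s => (t - s) ^ (1 - α - 1) * rieszPotential α ρ s) (Ioo 0 t) ∧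
    ∫ s in Ioo 0 t, (t - s) ^ (1 - α - 1) * rieszPotential α ρ s =
      Real.Gamma α * Real.Gamma (1 - α) * ∫ τ in Ioo 0 t, ρ τ := by
  have hα' : 0 < 1 - α := by linarith
  -- Extending the kernel by zero to nonpositive arguments lets `s` run over the whole half line, so
  -- that the quadrant shear applies with `σ = s - τ`.
  set k : ℝ → ℝ := (Ioi (0 : ℝ)).indicator fun r => r ^ (1 - α - 1) with hk
  have hkm : Measurable k := Measurable.indicator (by fun_prop) measurableSet_Ioi
  have hk0 : ∀ r, 0 ≤ k r := indicator_nonneg fun r hr => Real.rpow_nonneg (le_of_lt hr) _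
  set q : ℝ → ℝ → ℝ := fun σ τ => (k (t - (σ + τ)) * σ ^ (α - 1)) * ρ τ with hq
  have hρm := hF.measurable_bound
  have hqm : Measurable (Function.uncurry q) := by
    simp only [hq, Function.uncurry_def]
    fun_prop
  have hin : ∀ τ, IntegrableOn (fun σ => k (t - (σ + τ)) * σ ^ (α - 1)) (Ioi 0) ∧
      ∫ σ in Ioi 0, k (t - (σ + τ)) * σ ^ (α - 1) =
        (Iio t).indicator (fun _ => Real.Gamma α * Real.Gamma (1 - α)) τ := by
    intro τ
    have e1 : ∀ σ ∈ Ioi (0 : ℝ), k (t - (σ + τ)) * σ ^ (α - 1) = (Ioo 0 (t - τ)).indicator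
        (fun σ => (t - τ - σ) ^ (1 - α - 1) * σ ^ (α - 1)) σ := by
      intro σ hσ
      have hσ' : (0 : ℝ) < σ := hσ
      simp only [hk, indicator, mem_Ioi, mem_Ioo]
      by_cases h : σ < t - τ
      · rw [if_pos (by linarith), if_pos ⟨hσ', h⟩]
        congr 2; ring
      · rw [if_neg (by linarith), if_neg (fun h' => h h'.2), zero_mul]
    rw [setIntegral_congr_fun measurableSet_Ioi e1, integrableOn_congr_fun e1 measurableSet_Ioi,
      setIntegral_indicator measurableSet_Ioo, inter_eq_right.2 Ioo_subset_Ioi_self]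
    by_cases h : τ < t
    · have h0 : 0 < t - τ := sub_pos.2 h
      constructor
      · exact ((integrable_indicator_iff measurableSet_Ioo).2
          (integrableOn_sub_rpow_mul_rpow h0 hα' hα)).integrableOn
      · rw [integral_sub_rpow_mul_rpow h0 hα' hα, indicator_of_mem (show τ ∈ Iio t from h)]
        rw [show α + (1 - α) = 1 by ring, show 1 - α + α - 1 = 0 by ring, Real.rpow_zero,
          Real.Gamma_one, one_mul, div_one]
    · rw [Ioo_eq_empty (fun h' => h (sub_pos.1 h')), indicator_of_notMem (show τ ∉ Iio t from h)]
      simp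
  have hqi : IntegrableOn (Function.uncurry q) (Ioi (0 : ℝ) ×ˢ Ioi (0 : ℝ)) := by
    rw [IntegrableOn, Measure.volume_eq_prod, ← Measure.prod_restrict,
      integrable_prod_iff' hqm.aestronglyMeasurable]
    refine ⟨Eventually.of_forall fun τ => (hin τ).1.mul_const (ρ τ), ?_⟩
    have e2 : ∀ τ, ∫ σ in Ioi (0 : ℝ), ‖Function.uncurry q (σ, τ)‖ =
        (Iio t).indicator (fun τ => Real.Gamma α * Real.Gamma (1 - α) * ρ τ) τ := by
      intro τ
      have : ∫ σ in Ioi (0 : ℝ), ‖Function.uncurry q (σ, τ)‖ =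
          (∫ σ in Ioi (0 : ℝ), k (t - (σ + τ)) * σ ^ (α - 1)) * ρ τ := by
        rw [← integral_mul_const]
        refine setIntegral_congr_fun measurableSet_Ioi fun σ hσ => ?_
        simp only [Function.uncurry, hq]
        exact Real.norm_of_nonneg (mul_nonneg (mul_nonneg (hk0 _)
          (Real.rpow_nonneg (le_of_lt hσ) _)) (hF.nonneg τ))
      rw [this, (hin τ).2, ← indicator_mul_left]
    simp_rw [e2]
    rw [integrable_indicator_iff measurableSet_Iio, IntegrableOn,
      Measure.restrict_restrict measurableSet_Iio, Iio_inter_Ioi]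
    exact ((hF.integrable t).mono_set Ioo_subset_Ioc_self).const_mul _
  have hsh : ∀ s, ∫ τ in Ioo 0 s, q (s - τ) τ = k (t - s) * rieszPotential α ρ s := by
    intro s
    rw [rieszPotential, ← integral_const_mul]
    refine integral_congr_ae (Eventually.of_forall fun τ => ?_)
    simp only [hq]
    rw [sub_add_cancel, mul_assoc]
  have h1 := integrable_integral_shear hqi
  have h2 := integral_shear hqi
  simp_rw [hsh] at h1 h2
  have e3 : ∀ s ∈ Ioo 0 t, k (t - s) * rieszPotential α ρ s =
      (t - s) ^ (1 - α - 1) * rieszPotential α ρ s := by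
    intro s hs
    rw [hk, indicator_of_mem (show t - s ∈ Ioi (0 : ℝ) from sub_pos.2 hs.2)]
  have h3 : ∫ s in Ioi 0, k (t - s) * rieszPotential α ρ s =
      ∫ s in Ioo 0 t, k (t - s) * rieszPotential α ρ s := by
    refine setIntegral_eq_of_subset_of_forall_sdiff_eq_zero measurableSet_Ioi Ioo_subset_Ioi_self
      fun s hs => ?_
    have : t - s ∉ Ioi (0 : ℝ) := fun h => hs.2 ⟨hs.1, sub_pos.1 h⟩
    rw [hk, indicator_of_notMem this, zero_mul]
  refine ⟨h1.integrableOn.congr_fun e3 measurableSet_Ioo, ?_⟩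
  rw [← setIntegral_congr_fun measurableSet_Ioo e3, ← h3, h2]
  have e4 : ∀ τ, ∫ σ in Ioi (0 : ℝ), q σ τ =
      (Iio t).indicator (fun τ => Real.Gamma α * Real.Gamma (1 - α) * ρ τ) τ := by
    intro τ
    simp only [hq]
    rw [integral_mul_const, (hin τ).2, ← indicator_mul_left]
  simp_rw [e4]
  rw [setIntegral_indicator measurableSet_Iio, inter_comm, Iio_inter_Ioi, integral_const_mul]

/-- Under `s = tr` all powers of `t` cancel, since `(1-α) + α = 1`. Only the scale `tr` of the
average still depends on `t`, and at scale zero the average is `g(x) ∫ Φ`. -/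
theorem tendsto_fracIntegral_profileAvg (hα : 0 < α) (hα1 : α < 1) (hΦ : Integrable Φ)
    (g : C₀(ℝ, ℝ)) (x : ℝ) :
    Tendsto (fun t => ∫ s in Ioo 0 t, (t - s) ^ (1 - α - 1) * (s ^ (α - 1) * profileAvg Φ g s x))
      (𝓝[>] 0) (𝓝 (Real.Gamma α * Real.Gamma (1 - α) * (g x * ∫ η, Φ η))) := by
  have hα' : 0 < 1 - α := by linarith
  have hc : Continuous fun s => profileAvg Φ g s x :=
    (continuous_profileAvg hΦ g.continuous g.abs_apply_le).comp (by fun_prop :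
      Continuous fun s : ℝ => (s, x))
  have h0 : profileAvg Φ g 0 x = g x * ∫ η, Φ η := by
    rw [profileAvg]
    simp only [zero_mul, sub_zero]
    rw [integral_mul_const, mul_comm]
  have hB := integral_rpow_mul_one_sub_rpow hα hα'
  rw [show α + (1 - α) = 1 by ring, Real.Gamma_one, div_one] at hB
  rw [← hB, ← h0, ← integral_mul_const]
  have hres : ∀ t ∈ Ioi (0 : ℝ), ∫ r in Ioo (0 : ℝ) 1, (r ^ (α - 1) * (1 - r) ^ (1 - α - 1)) *
      profileAvg Φ g (t * r) x =
      ∫ s in Ioo 0 t, (t - s) ^ (1 - α - 1) * (s ^ (α - 1) * profileAvg Φ g s x) := by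
    intro t ht
    have ht' : (0 : ℝ) < t := ht
    rw [setIntegral_Ioo_comp_mul ht', ← integral_smul]
    refine setIntegral_congr_fun measurableSet_Ioo fun r hr => ?_
    simp only [smul_eq_mul]
    rw [← mul_assoc ((t - t * r) ^ _), mul_rpow_mul_sub_rpow ht' hr,
      show 1 - α + α - 2 = (-1 : ℝ) by ring, Real.rpow_neg_one]
    field_simp
  refine Tendsto.congr' (eventually_nhdsWithin_of_forall hres) ?_
  refine tendsto_integral_filter_of_dominated_convergence
    (fun r => (r ^ (α - 1) * (1 - r) ^ (1 - α - 1)) * ((∫ η, |Φ η|) * ‖g‖)) ?_ ?_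
    ((integrableOn_rpow_mul_one_sub_rpow hα hα').mul_const _) ?_
  · refine Eventually.of_forall fun t => ?_
    have := hc.measurable
    exact (by fun_prop : Measurable fun r : ℝ => (r ^ (α - 1) * (1 - r) ^ (1 - α - 1)) *
      profileAvg Φ g (t * r) x).aestronglyMeasurable
  · refine Eventually.of_forall fun t => ?_
    filter_upwards [ae_restrict_mem measurableSet_Ioo] with r hr
    have h1 : 0 ≤ 1 - r := by linarith [hr.2]
    have h2 : 0 ≤ r := hr.1.le
    rw [norm_mul, Real.norm_of_nonneg (by positivity), Real.norm_eq_abs]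
    gcongr
    exact abs_profileAvg_le hΦ g.abs_apply_le _ _
  · refine Eventually.of_forall fun r => ?_
    refine Tendsto.const_mul _ ?_
    have h1 : Tendsto (fun t : ℝ => t * r) (𝓝[>] 0) (𝓝 0) := by
      have : Tendsto (fun t : ℝ => t * r) (𝓝 0) (𝓝 (0 * r)) := (continuous_mul_const r).tendsto 0
      rw [zero_mul] at this
      exact this.mono_left nhdsWithin_le_nhds
    exact (hc.tendsto 0).comp h1

theorem integrableOn_fracIntegrand_profileAvg (hα : 0 < α) (hα1 : α < 1) (hΦ : Integrable Φ)
    (g : C₀(ℝ, ℝ)) (x : ℝ) {t : ℝ} (ht : 0 < t) :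
    IntegrableOn (fun s => (t - s) ^ (1 - α - 1) * (s ^ (α - 1) * profileAvg Φ g s x))
      (Ioo 0 t) := by
  have hc : Continuous fun s => profileAvg Φ g s x :=
    (continuous_profileAvg hΦ g.continuous g.abs_apply_le).comp (by fun_prop :
      Continuous fun s : ℝ => (s, x))
  have h := (integrableOn_sub_rpow_mul_rpow ht (by linarith : 0 < 1 - α) hα)
  have h2 := Integrable.mul_bdd (c := (∫ η, |Φ η|) * ‖g‖) h hc.aestronglyMeasurable
    (Eventually.of_forall fun s => abs_profileAvg_le hΦ g.abs_apply_le _ _)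
  exact h2.congr (Eventually.of_forall fun s => mul_assoc _ _ _)

theorem duhamelAvg_eq_add (α : ℝ) (Φ : ℝ → ℝ) (F : ℝ → ℝ → ℝ) (g : ℝ → ℝ) (x t : ℝ) :
    duhamelAvg α Φ F g x t = t ^ (α - 1) * profileAvg Φ g t x +
      duhamelAvg α Φ F (fun _ => 0) x t := by
  simp only [duhamelAvg, profileAvg, mul_zero, integral_zero, zero_add]

theorem norm_fracIntegrand_duhamelAvg_le (hα : 0 < α) (hΦ : Integrable Φ) (hF : HasMajorant F ρ)
    (x t : ℝ) : ∀ᵐ s ∂(volume.restrict (Ioo 0 t)),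
    ‖(t - s) ^ (1 - α - 1) * duhamelAvg α Φ F (fun _ => 0) x s‖ ≤
      (∫ η, |Φ η|) * ((t - s) ^ (1 - α - 1) * rieszPotential α ρ s) := by
  filter_upwards [ae_restrict_of_ae (hF.ae_integrableOn_sub_rpow_mul hα),
    ae_restrict_mem measurableSet_Ioo] with s hs hst
  have h1 := abs_duhamelAvg_le hΦ hF 0 hst.1 hs x
  rw [norm_zero, mul_zero, zero_add] at h1
  have h2 : 0 ≤ t - s := by linarith [hst.2]
  rw [norm_mul, Real.norm_of_nonneg (by positivity), Real.norm_eq_abs]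
  calc _ ≤ (t - s) ^ (1 - α - 1) * ((∫ η, |Φ η|) * rieszPotential α ρ s) := by
        gcongr
        exact h1
    _ = _ := by ring

theorem integrableOn_fracIntegrand_duhamelAvg (hα : 0 < α) (hα1 : α < 1) (hΦm : Measurable Φ)
    (hΦ : Integrable Φ) (hF : HasMajorant F ρ) (x t : ℝ) :
    IntegrableOn (fun s => (t - s) ^ (1 - α - 1) * duhamelAvg α Φ F (fun _ => 0) x s)
      (Ioo 0 t) := by
  refine Integrable.mono' ((hF.integral_sub_rpow_mul_rieszPotential hα hα1 t).1.const_mul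
    (∫ η, |Φ η|)) ?_ (norm_fracIntegrand_duhamelAvg_le hα hΦ hF x t)
  have h := (measurable_duhamelAvg (α := α) (Φ := Φ) (g := fun _ => 0) hΦm hF.measurable
    measurable_const).comp (measurable_const.prodMk measurable_id : Measurable fun t : ℝ => (x, t))
  exact ((by fun_prop : Measurable fun s : ℝ => (t - s) ^ (1 - α - 1)).mul h).aestronglyMeasurable

/-- By the semigroup law the contribution of the source is at most a constant times `∫₀ᵗ ρ`, which
vanishes with `t`. -/
theorem tendsto_fracIntegral_duhamelAvg_zero (hα : 0 < α) (hα1 : α < 1)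
    (hΦ : Integrable Φ) (hF : HasMajorant F ρ) (x : ℝ) :
    Tendsto (fun t => ∫ s in Ioo 0 t, (t - s) ^ (1 - α - 1) * duhamelAvg α Φ F (fun _ => 0) x s)
      (𝓝[>] 0) (𝓝 0) := by
  have hle : ∀ t, ‖∫ s in Ioo 0 t, (t - s) ^ (1 - α - 1) * duhamelAvg α Φ F (fun _ => 0) x s‖ ≤
      (∫ η, |Φ η|) * (Real.Gamma α * Real.Gamma (1 - α) * ∫ τ in Ioc 0 t, ρ τ) := by
    intro t
    have h := hF.integral_sub_rpow_mul_rieszPotential hα hα1 t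
    refine (norm_integral_le_of_norm_le (h.1.const_mul _)
      (norm_fracIntegrand_duhamelAvg_le hα hΦ hF x t)).trans (le_of_eq ?_)
    rw [integral_const_mul, h.2, integral_Ioc_eq_integral_Ioo]
  have hρ : Tendsto (fun t => ∫ τ in Ioc 0 t, ρ τ) (𝓝[>] 0) (𝓝 0) := by
    have h1 : IntegrableOn ρ (Icc 0 1) :=
      by rw [integrableOn_Icc_iff_integrableOn_Ioc]; exact hF.integrable 1
    have h2 := (intervalIntegral.continuousOn_primitive h1) 0 (left_mem_Icc.2 zero_le_one)
    have h3 : Tendsto (fun t => ∫ τ in Ioc 0 t, ρ τ) (𝓝[Icc 0 1] 0) (𝓝 0) := by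
      simpa [ContinuousWithinAt] using h2
    refine h3.mono_left ?_
    rw [← nhdsWithin_Ioo_eq_nhdsGT (zero_lt_one' ℝ)]
    exact nhdsWithin_mono _ Ioo_subset_Icc_self
  refine squeeze_zero_norm hle ?_
  have := (hρ.const_mul (Real.Gamma α * Real.Gamma (1 - α))).const_mul (∫ η, |Φ η|)
  simpa using this

theorem isMildSolution_duhamelAvg {p : ℝ} (hα : 0 < α) (hα1 : α < 1) (hp0 : 0 < p) (hp1 : p < 1)
    (hΦm : Measurable Φ) (hΦ : Integrable Φ)
    (hL : ∀ (ξ : ℝ) (s : ℂ), 0 < s.re → ∫ t in Ioi (0 : ℝ), Complex.exp (-(s * t)) *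
      (((t ^ (α - 1) : ℝ) : ℂ) * fourierT (fun y => (Φ y : ℂ)) (ξ * t)) = 1 / symbolZeta α p ξ s)
    (hmass : Real.Gamma α * ∫ η, Φ η = 1) (hF : HasMajorant F ρ) (g : C₀(ℝ, ℝ)) :
    IsMildSolution α p F g (duhamelAvg α Φ F g) := by
  have hα' : 0 < 1 - α := by linarith
  have hu := isExpTypeC0_duhamelAvg hα hα1 hΦm hΦ hF g
  have hexp : -α = 1 - α - 1 := by ring
  have hsum : ∀ t x, (fun s => (t - s) ^ (1 - α - 1) * duhamelAvg α Φ F g x s) = fun s =>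
      (t - s) ^ (1 - α - 1) * (s ^ (α - 1) * profileAvg Φ g s x) +
        (t - s) ^ (1 - α - 1) * duhamelAvg α Φ F (fun _ => 0) x s := by
    intro t x
    ext s
    rw [duhamelAvg_eq_add α Φ F g]; ring
  refine ⟨hu, ?_, fun x => ?_, fun x => ?_⟩
  · obtain ⟨a, ha, h⟩ := hu.exists_materialDerivPair_eq hα1.le p g
    obtain ⟨b, hb, hbc⟩ := hF.exists_integrableOn_exp
    refine ⟨max a b + 1, by positivity, fun s hs φ => ?_⟩
    have hsa : a < s.re := by linarith [le_max_left a b]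
    have hsb : b < s.re := by linarith [le_max_right a b]
    have hs0 : 0 < s.re := ha.trans_lt hsa
    obtain ⟨χ₁, hχ₁⟩ := exists_schwartz_cpow_mul (c := -Complex.I) hs0 (by simp) hα1.le φ
    obtain ⟨χ₂, hχ₂⟩ := exists_schwartz_cpow_mul (c := Complex.I) hs0 (by simp) hα1.le φ
    have e : (fun ξ : ℝ => symbolZeta α p ξ s * φ ξ) =
        ((p : ℂ) • χ₁ + (1 - p : ℂ) • χ₂ : 𝓢(ℝ, ℂ)) := by
      ext ξ
      rw [add_apply, smul_apply, smul_apply, hχ₁, hχ₂,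
        symbolZeta, smul_eq_mul, smul_eq_mul, neg_mul, ← sub_eq_add_neg]
      ring
    -- The test function for Duhamel's formula is the symbol times `φ`, which is Schwartz; the
    -- reciprocal symbol coming from the kernel restores `φ`.
    set χ : 𝓢(ℝ, ℂ) := (p : ℂ) • χ₁ + (1 - p : ℂ) • χ₂ with hχ
    have e2 : (fun ξ : ℝ => 1 / symbolZeta α p ξ s * χ ξ) = φ := by
      ext ξ
      rw [← congrFun e ξ]
      have := symbolZeta_ne_zero hα hα1 hp0 hp1 (ξ := ξ) hs0
      field_simp
    have hmain := fourierLaplacePair_duhamelAvg hα hΦm hΦ hL χ.continuous χ.integrable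
      (integrable_fourierT_schwartz χ) hF g hs0 (hbc _ hsb)
    rw [h s hsa, e, hmain, e2]
    ring
  · filter_upwards [self_mem_nhdsWithin] with t ht
    rw [hexp, intervalIntegrable_iff_integrableOn_Ioo_of_le (le_of_lt ht), hsum]
    exact (integrableOn_fracIntegrand_profileAvg hα hα1 hΦ g x ht).add
      (integrableOn_fracIntegrand_duhamelAvg hα hα1 hΦm hΦ hF x t)
  · have h1 := ((tendsto_fracIntegral_profileAvg hα hα1 hΦ g x).add
      (tendsto_fracIntegral_duhamelAvg_zero hα hα1 hΦ hF x)).const_mul (Real.Gamma (1 - α))⁻¹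
    have hlim : (Real.Gamma (1 - α))⁻¹ *
        (Real.Gamma α * Real.Gamma (1 - α) * (g x * ∫ η, Φ η) + 0) = g x := by
      have h2 := (Real.Gamma_pos_of_pos hα').ne'
      calc _ = ((Real.Gamma (1 - α))⁻¹ * Real.Gamma (1 - α)) *
            (Real.Gamma α * ∫ η, Φ η) * g x := by ring
        _ = g x := by rw [hmass, inv_mul_cancel₀ h2]; ring
    rw [hlim] at h1
    refine Tendsto.congr' ?_ h1
    filter_upwards [self_mem_nhdsWithin] with t ht
    rw [fracIntegral, intervalIntegral.integral_of_le (le_of_lt ht), integral_Ioc_eq_integral_Ioo,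
      hsum, integral_add (integrableOn_fracIntegrand_profileAvg hα hα1 hΦ g x ht)
      (integrableOn_fracIntegrand_duhamelAvg hα hα1 hΦm hΦ hF x t)]

end Initial

/-! ### Uniqueness -/

theorem exists_fourierT_eq {g : ℝ → ℂ} (hg : ContDiff ℝ (⊤ : ℕ∞) g) (hgc : HasCompactSupport g) :
    ∃ b : 𝓢(ℝ, ℂ), ∀ x, fourierT b x = g x := by
  have hπ : (2 * Real.pi) ≠ 0 := by positivity
  have h1 : HasCompactSupport fun x => g (2 * Real.pi * x) :=
    hgc.comp_homeomorph (Homeomorph.mulLeft₀ (2 * Real.pi) hπ)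
  have h2 : ContDiff ℝ (⊤ : ℕ∞) fun x : ℝ => g (2 * Real.pi * x) := by fun_prop
  refine ⟨𝓕⁻ (h1.toSchwartzMap h2), fun x => ?_⟩
  rw [fourierT_eq_fourier, ← SchwartzMap.fourier_coe, FourierTransform.fourier_fourierInv_eq]
  change g (2 * Real.pi * (x / (2 * Real.pi))) = g x
  rw [mul_div_cancel₀ _ hπ]

/-- Every smooth compactly supported function is the Fourier transform of a Schwartz function, so
the multiplication formula makes `a` orthogonal to all of them. -/
theorem ae_eq_zero_of_fourierT_eq_zero {a : ℝ → ℂ} (ha : Integrable a) (h : ∀ ω, fourierT a ω = 0) :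
    ∀ᵐ t, a t = 0 := by
  refine ae_eq_zero_of_integral_contDiff_smul_eq_zero ha.locallyIntegrable fun g hg hgc => ?_
  obtain ⟨b, hb⟩ := exists_fourierT_eq (g := fun x => (g x : ℂ))
    (Complex.ofRealCLM.contDiff.comp hg) (hgc.comp_left Complex.ofReal_zero)
  have := integral_mul_fourierT ha b.integrable
  simp only [h, zero_mul, integral_zero, hb] at this
  rw [this]
  refine integral_congr_ae (Eventually.of_forall fun x => ?_)
  simp only [Complex.real_smul, mul_comm]

/-- On the single vertical line `Re s = b` the Laplace transform is the Fourier transform of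
`e^{-bt} q(t)` extended by zero to the left half line. -/
theorem ae_eq_of_laplace_eq {q₁ q₂ : ℝ → ℂ} {b : ℝ}
    (h₁ : ∀ s : ℂ, s.re = b → IntegrableOn (fun t : ℝ => Complex.exp (-(s * t)) * q₁ t) (Ioi 0))
    (h₂ : ∀ s : ℂ, s.re = b → IntegrableOn (fun t : ℝ => Complex.exp (-(s * t)) * q₂ t) (Ioi 0))
    (h : ∀ s : ℂ, s.re = b → ∫ t in Ioi (0 : ℝ), Complex.exp (-(s * t)) * q₁ t =
      ∫ t in Ioi (0 : ℝ), Complex.exp (-(s * t)) * q₂ t) :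
    ∀ᵐ t ∂(volume.restrict (Ioi (0 : ℝ))), q₁ t = q₂ t := by
  set a : ℝ → ℂ := (Ioi (0 : ℝ)).indicator fun t =>
    Complex.exp (-((b : ℂ) * t)) * q₁ t - Complex.exp (-((b : ℂ) * t)) * q₂ t with ha
  have hai : Integrable a :=
    (integrable_indicator_iff measurableSet_Ioi).2 ((h₁ b (by simp)).sub (h₂ b (by simp)))
  have h0 := ae_eq_zero_of_fourierT_eq_zero hai fun ω => ?_
  · rw [ae_restrict_iff' measurableSet_Ioi]
    filter_upwards [h0] with t ht htp
    rw [ha, indicator_of_mem htp, ← mul_sub, mul_eq_zero, sub_eq_zero] at ht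
    exact ht.resolve_left (Complex.exp_ne_zero _)
  · have hs : ((b : ℂ) + Complex.I * ω).re = b := by simp
    have e : ∀ t : ℝ, Complex.exp (-(Complex.I * ω * t)) * a t = (Ioi (0 : ℝ)).indicator (fun t =>
        Complex.exp (-(((b : ℂ) + Complex.I * ω) * t)) * q₁ t -
          Complex.exp (-(((b : ℂ) + Complex.I * ω) * t)) * q₂ t) t := by
      intro t
      by_cases ht : t ∈ Ioi (0 : ℝ)
      · rw [ha, indicator_of_mem ht, indicator_of_mem ht, mul_sub, ← mul_assoc, ← mul_assoc,
          ← Complex.exp_add]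
        congr 3 <;> ring
      · rw [ha, indicator_of_notMem ht, indicator_of_notMem ht, mul_zero]
    unfold fourierT
    simp_rw [e]
    rw [integral_indicator measurableSet_Ioi, integral_sub (h₁ _ hs) (h₂ _ hs), h _ hs, sub_self]

theorem integral_fourierT_schwartz (ψ : 𝓢(ℝ, ℂ)) :
    ∫ x, fourierT ψ x = 2 * Real.pi * ψ 0 := by
  simp_rw [fourierT_eq_fourier, ← SchwartzMap.fourier_coe]
  rw [Measure.integral_comp_div (fun x => (𝓕 ψ : 𝓢(ℝ, ℂ)) x) (2 * Real.pi),
    abs_of_pos (by positivity), Complex.real_smul]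
  have h1 : (𝓕⁻ (𝓕 ψ : 𝓢(ℝ, ℂ)) : 𝓢(ℝ, ℂ)) 0 = ∫ x, (𝓕 ψ : 𝓢(ℝ, ℂ)) x := by
    rw [SchwartzMap.fourierInv_coe, Real.fourierInv_eq]
    simp
  rw [← h1, FourierTransform.fourierInv_fourier_eq]
  push_cast
  rfl

/-- The transforms of these test functions are `(n+1) ψ̂((n+1)(x-y))`, an approximate identity at
`y` of total mass `2π ψ(0)`. Point values of `h` can thus be read off from pairings. -/
theorem tendsto_fourierPair_dilation (ψ : 𝓢(ℝ, ℂ)) {h : ℝ → ℝ} (hh : Continuous h) {M : ℝ}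
    (hM : ∀ x, |h x| ≤ M) (y : ℝ) :
    Tendsto (fun n : ℕ => fourierPair h fun ξ =>
      Complex.exp (-(Complex.I * ((-y : ℝ) : ℂ) * ξ)) * ψ (ξ / (n + 1))) atTop
      (𝓝 (h y * (2 * Real.pi * ψ 0))) := by
  have e : ∀ n : ℕ, fourierPair h (fun ξ =>
      Complex.exp (-(Complex.I * ((-y : ℝ) : ℂ) * ξ)) * ψ (ξ / (n + 1))) =
      ∫ z, (h (y + z / (n + 1)) : ℂ) * fourierT ψ z := by
    intro n
    have hn : (0 : ℝ) < n + 1 := by positivity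
    unfold fourierPair
    simp_rw [fourierT_exp_mul (fun ξ => ψ (ξ / (n + 1))), fourierT_comp_mul ψ _ _ hn]
    rw [← integral_add_right_eq_self _ y]
    have h2 := Measure.integral_comp_div
      (fun x => (h (y + x) : ℂ) * fourierT ψ (x * (n + 1))) ((n : ℝ) + 1)
    rw [abs_of_pos hn, Complex.real_smul] at h2
    simp only [div_mul_cancel₀ _ hn.ne'] at h2
    rw [h2, ← integral_const_mul]
    refine integral_congr_ae (Eventually.of_forall fun x => ?_)
    simp only
    rw [show -y + (x + y) = x by ring, add_comm x y]
    ring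
  simp_rw [e]
  rw [← integral_fourierT_schwartz, ← integral_const_mul]
  have hψ := continuous_fourierT ψ.integrable
  refine tendsto_integral_of_dominated_convergence (fun z => M * ‖fourierT ψ z‖) ?_
    ((integrable_fourierT_schwartz ψ).norm.const_mul M) ?_ ?_
  · intro n
    exact (by fun_prop : Continuous fun z : ℝ =>
      (h (y + z / (n + 1)) : ℂ) * fourierT ψ z).aestronglyMeasurable
  · refine fun n => Eventually.of_forall fun z => ?_
    rw [norm_mul, Complex.norm_real]
    gcongr
    exact hM _
  · refine Eventually.of_forall fun z => Tendsto.mul_const _ ?_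
    refine (Complex.continuous_ofReal.tendsto _).comp ((hh.tendsto y).comp ?_)
    have : Tendsto (fun n : ℕ => z / ((n : ℝ) + 1)) atTop (𝓝 0) :=
      tendsto_const_nhds.div_atTop (tendsto_natCast_atTop_atTop.atTop_add tendsto_const_nhds)
    simpa using this.const_add y

theorem contDiff_symbolZeta {α : ℝ} (hα : α ≤ 1) (p : ℝ) {s : ℂ} (hs : 0 < s.re) :
    ContDiff ℝ (⊤ : ℕ∞) fun ξ => symbolZeta α p ξ s := by
  have h1 := (hasTemperateGrowth_cpow_affine (c := -Complex.I) hs (by simp) hα).1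
  have h2 := (hasTemperateGrowth_cpow_affine (c := Complex.I) hs (by simp) hα).1
  have h3 : ContDiff ℝ (⊤ : ℕ∞) fun ξ : ℝ => (p : ℂ) * (s + -Complex.I * ξ) ^ (α : ℂ) +
      (1 - p) * (s + Complex.I * ξ) ^ (α : ℂ) :=
    (contDiff_const.mul h1).add (contDiff_const.mul h2)
  convert! h3 using 2 with ξ
  rw [symbolZeta, neg_mul, ← sub_eq_add_neg]

/-- The equation is tested with `ψ` divided by the symbol. The quotient is smooth because the symbol
is smooth without zeros, and compact support of `ψ` makes growth estimates for the reciprocal symbol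
unnecessary. -/
theorem IsMildSolution.exists_fourierLaplacePair_eq {α p : ℝ} (hα : 0 < α) (hα1 : α < 1)
    (hp0 : 0 < p) (hp1 : p < 1) {f u v : ℝ → ℝ → ℝ} {g : ℝ → ℝ} (hu : IsMildSolution α p f g u)
    (hv : IsMildSolution α p f g v) :
    ∃ a : ℝ, 0 ≤ a ∧ ∀ s : ℂ, a < s.re → ∀ ψ : ℝ → ℂ, ContDiff ℝ (⊤ : ℕ∞) ψ →
      HasCompactSupport ψ → fourierLaplacePair u s ψ = fourierLaplacePair v s ψ := by
  obtain ⟨a₁, ha₁, h₁⟩ := hu.equation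
  obtain ⟨a₂, ha₂, h₂⟩ := hv.equation
  obtain ⟨a₃, ha₃, h₃⟩ := hu.expTypeC0.exists_materialDerivPair_eq hα1.le p g
  obtain ⟨a₄, ha₄, h₄⟩ := hv.expTypeC0.exists_materialDerivPair_eq hα1.le p g
  refine ⟨max (max a₁ a₂) (max a₃ a₄), by positivity, fun s hs ψ hψ hψc => ?_⟩
  simp only [max_lt_iff] at hs
  have hs0 : 0 < s.re := ha₁.trans hs.1.1
  have hζ : ∀ ξ, symbolZeta α p ξ s ≠ 0 := fun ξ => symbolZeta_ne_zero hα hα1 hp0 hp1 hs0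
  have hφ : ContDiff ℝ (⊤ : ℕ∞) fun ξ => (symbolZeta α p ξ s)⁻¹ * ψ ξ :=
    ((contDiff_symbolZeta hα1.le p hs0).inv hζ).mul hψ
  have hφc : HasCompactSupport fun ξ => (symbolZeta α p ξ s)⁻¹ * ψ ξ := hψc.mul_left
  have key := ((h₃ s hs.2.1 (hφc.toSchwartzMap hφ)).symm.trans
    ((h₁ s hs.1.1 _).trans (h₂ s hs.1.2 _).symm)).trans (h₄ s hs.2.2 _)
  have e : (fun ξ => symbolZeta α p ξ s * (hφc.toSchwartzMap hφ) ξ) = ψ := by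
    ext ξ
    exact mul_inv_cancel_left₀ (hζ ξ) _
  rw [e] at key
  exact sub_left_inj.1 key

theorem IsMildSolution.ae_eq {α p : ℝ} (hα : 0 < α) (hα1 : α < 1)
    (hp0 : 0 < p) (hp1 : p < 1) {f u v : ℝ → ℝ → ℝ} {g : ℝ → ℝ} (hu : IsMildSolution α p f g u)
    (hv : IsMildSolution α p f g v) :
    ∀ᵐ t ∂(volume.restrict (Ioi (0 : ℝ))), ∀ x, u x t = v x t := by
  obtain ⟨a, ha, huv⟩ := hu.exists_fourierLaplacePair_eq hα hα1 hp0 hp1 hv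
  obtain ⟨a₁, ha₁, h₁⟩ := hu.expTypeC0.exists_integrableOn_fourierPair
  obtain ⟨a₂, ha₂, h₂⟩ := hv.expTypeC0.exists_integrableOn_fourierPair
  set b := max a (max a₁ a₂) + 1 with hb
  have hab : a < b := (le_max_left _ _).trans_lt (lt_add_one _)
  have hab₁ : a₁ < b := ((le_max_left _ _).trans (le_max_right _ _)).trans_lt (lt_add_one _)
  have hab₂ : a₂ < b := ((le_max_right _ _).trans (le_max_right _ _)).trans_lt (lt_add_one _)
  have hψ : ∀ ψ : ℝ → ℂ, ContDiff ℝ (⊤ : ℕ∞) ψ → HasCompactSupport ψ →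
      ∀ᵐ t ∂(volume.restrict (Ioi (0 : ℝ))),
        fourierPair (fun x => u x t) ψ = fourierPair (fun x => v x t) ψ := by
    intro ψ hψ hψc
    have hi : Integrable ψ := hψ.continuous.integrable_of_hasCompactSupport hψc
    have hi' : Integrable (fourierT ψ) := integrable_fourierT_schwartz (hψc.toSchwartzMap hψ)
    exact ae_eq_of_laplace_eq (b := b) (fun s hs => h₁ s (hs ▸ hab₁) ψ hi hi')
      (fun s hs => h₂ s (hs ▸ hab₂) ψ hi hi') fun s hs => huv s (hs ▸ hab) ψ hψ hψc
  set χ : ContDiffBump (0 : ℝ) := ⟨1, 2, one_pos, one_lt_two⟩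
  have hχ : ContDiff ℝ (⊤ : ℕ∞) fun x => ((χ x : ℝ) : ℂ) :=
    Complex.ofRealCLM.contDiff.comp χ.contDiff
  have hχc : HasCompactSupport fun x => ((χ x : ℝ) : ℂ) :=
    χ.hasCompactSupport.comp_left Complex.ofReal_zero
  have hχ0 : (hχc.toSchwartzMap hχ) 0 = 1 := by
    change ((χ 0 : ℝ) : ℂ) = 1
    rw [χ.one_of_mem_closedBall, Complex.ofReal_one]
    exact Metric.mem_closedBall_self (zero_le_one)
  -- The null set of times depends on the test function, so only countably many are used: rational
  -- centres and integer dilations. Continuity in `x` supplies the remaining points.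
  have hall : ∀ᵐ t ∂(volume.restrict (Ioi (0 : ℝ))), ∀ (y : ℚ) (n : ℕ),
      fourierPair (fun x => u x t) (fun ξ : ℝ => Complex.exp (-(Complex.I * ((-y : ℝ) : ℂ) * ξ)) *
        (hχc.toSchwartzMap hχ) (ξ / (n + 1))) =
      fourierPair (fun x => v x t) (fun ξ : ℝ => Complex.exp (-(Complex.I * ((-y : ℝ) : ℂ) * ξ)) *
        (hχc.toSchwartzMap hχ) (ξ / (n + 1))) := by
    rw [ae_all_iff]; intro y
    rw [ae_all_iff]; intro n
    have hn : ((n : ℝ) + 1)⁻¹ ≠ 0 := by positivity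
    refine hψ _ (ContDiff.mul ?_ ?_) (HasCompactSupport.mul_left ?_)
    · have : ContDiff ℝ (⊤ : ℕ∞) fun ξ : ℝ => (ξ : ℂ) := Complex.ofRealCLM.contDiff
      fun_prop
    · exact ((hχc.toSchwartzMap hχ).smooth (⊤ : ℕ∞)).comp (by fun_prop)
    · simp only [div_eq_mul_inv]
      exact hχc.comp_homeomorph (Homeomorph.mulRight₀ _ hn)
  filter_upwards [hall, hu.expTypeC0.zeroAtInfty, hv.expTypeC0.zeroAtInfty] with t ht
    ⟨w₁, hw₁⟩ ⟨w₂, hw₂⟩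
  have e₁ : (fun x => u x t) = w₁ := funext fun x => (hw₁ x).symm
  have e₂ : (fun x => v x t) = w₂ := funext fun x => (hw₂ x).symm
  rw [e₁, e₂] at ht
  have hq : (w₁ : ℝ → ℝ) = w₂ := by
    refine Rat.denseRange_cast.equalizer w₁.continuous w₂.continuous (funext fun y => ?_)
    have l₁ := tendsto_fourierPair_dilation (hχc.toSchwartzMap hχ) w₁.continuous w₁.abs_apply_le y
    have l₂ := tendsto_fourierPair_dilation (hχc.toSchwartzMap hχ) w₂.continuous w₂.abs_apply_le y
    have := tendsto_nhds_unique (l₁.congr fun n => ht y n) l₂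
    rw [hχ0] at this
    have hπ : (2 * (Real.pi : ℂ) * 1) ≠ 0 := by simp [Real.pi_ne_zero]
    exact_mod_cast mul_right_cancel₀ hπ this
  intro x
  rw [← hw₁, ← hw₂, hq]

/-! ### Invariance under null sets of times, and joint continuity -/

section

theorem IsExpTypeC0.congr {u v : ℝ → ℝ → ℝ} (hu : IsExpTypeC0 u)
    (huv : ∀ t, 0 < t → ∀ x, u x t = v x t) : IsExpTypeC0 v where
  measurable := by
    refine hu.measurable.congr ?_
    filter_upwards [ae_restrict_mem (MeasurableSet.univ.prod measurableSet_Ioi)] with z hz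
    exact huv z.2 hz.2 z.1
  zeroAtInfty := by
    filter_upwards [hu.zeroAtInfty, ae_restrict_mem measurableSet_Ioi] with t ⟨h, hh⟩ ht
    exact ⟨h, fun x => (hh x).trans (huv t ht x)⟩
  locallyIntegrable := by
    obtain ⟨ρ, hρ, h⟩ := hu.locallyIntegrable
    refine ⟨ρ, hρ, ?_⟩
    filter_upwards [h, ae_restrict_mem measurableSet_Ioi] with t h ht x
    rw [← huv t ht]
    exact h x
  expType := by
    obtain ⟨M, a, t₀, h⟩ := hu.expType
    refine ⟨M, a, max t₀ 1, fun t ht x => ?_⟩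
    rw [← huv t (one_pos.trans_le ((le_max_right _ _).trans ht))]
    exact h t ((le_max_left _ _).trans ht) x

theorem IsMildSolution.congr {α p : ℝ} {f F u v : ℝ → ℝ → ℝ} {g : ℝ → ℝ}
    (hu : IsMildSolution α p F g u)
    (hfF : ∀ᵐ t ∂(volume.restrict (Ioi (0 : ℝ))), ∀ x, F x t = f x t)
    (huv : ∀ t, 0 < t → ∀ x, u x t = v x t) : IsMildSolution α p f g v where
  expTypeC0 := hu.expTypeC0.congr huv
  equation := by
    have huv' : ∀ᵐ t ∂(volume.restrict (Ioi (0 : ℝ))), ∀ x, u x t = v x t := by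
      filter_upwards [ae_restrict_mem measurableSet_Ioi] with t ht using huv t ht
    obtain ⟨a, ha, h⟩ := hu.equation
    refine ⟨a, ha, fun s hs φ => ?_⟩
    rw [← fourierLaplacePair_congr hfF, ← h s hs φ]
    simp only [materialDerivPair, fourierLaplacePair_congr huv']
  fracIntegrable := by
    intro x
    filter_upwards [hu.fracIntegrable x, self_mem_nhdsWithin] with t ht ht0
    refine ht.congr fun s hs => ?_
    rw [uIoc_of_le (le_of_lt ht0)] at hs
    simp only [huv s hs.1]
  initial := by
    intro x
    refine (hu.initial x).congr' ?_
    filter_upwards [self_mem_nhdsWithin] with t ht0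
    unfold fracIntegral
    congr 1
    refine intervalIntegral.integral_congr_ae (Eventually.of_forall fun s hs => ?_)
    rw [uIoc_of_le (le_of_lt ht0)] at hs
    rw [huv s hs.1]

variable {α : ℝ} {Φ : ℝ → ℝ} {F : ℝ → ℝ → ℝ} {ρ : ℝ → ℝ}

/-- With the cutoff the kernel is at most `ε^(α-1)`, so dominated convergence applies over the fixed
interval `(0,T]`. The moving endpoint sits in an indicator that is locally constant at every `τ`
except `z₀.2 - ε`. -/
theorem continuousAt_setIntegral_truncated (hα1 : α < 1) (hΦm : Measurable Φ) (hΦ : Integrable Φ)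
    (hF : HasMajorant F ρ) {ε : ℝ} (hε : 0 < ε) (T : ℝ) (z₀ : ℝ × ℝ) :
    ContinuousAt (fun z : ℝ × ℝ => ∫ τ in Ioc 0 T, (Iic (z.2 - ε)).indicator (fun τ =>
      (z.2 - τ) ^ (α - 1) * profileAvg Φ (fun y => F y τ) (z.2 - τ) z.1) τ) z₀ := by
  refine continuousAt_of_dominated (bound := fun τ => (∫ η, |Φ η|) * (ε ^ (α - 1) * ρ τ)) ?_ ?_
    (((hF.integrable T).const_mul _).const_mul _) ?_
  · exact Eventually.of_forall fun z =>
      ((measurable_duhamel_integrand hΦm hF z.2 z.1).indicator measurableSet_Iic).aestronglyMeasurable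
  · refine Eventually.of_forall fun z => Eventually.of_forall fun τ => ?_
    have hρ := hF.nonneg τ
    have hC : 0 ≤ ∫ η, |Φ η| := integral_nonneg fun _ => abs_nonneg _
    by_cases h : τ ∈ Iic (z.2 - ε)
    · have h' : ε ≤ z.2 - τ := by linarith [mem_Iic.1 h]
      rw [indicator_of_mem h]
      refine (norm_duhamel_integrand_le hΦ hF (by linarith) z.1).trans ?_
      gcongr ?_ * (?_ * _)
      exact Real.rpow_le_rpow_of_nonpos hε h' (by linarith)
    · rw [indicator_of_notMem h, norm_zero]
      positivity
  · have hne : ∀ᵐ τ ∂(volume.restrict (Ioc 0 T)), τ ≠ z₀.2 - ε :=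
      ae_restrict_of_ae (Measure.ae_ne _ _)
    filter_upwards [hne] with τ hτ
    rcases lt_or_gt_of_ne hτ with h | h
    · have hev : ∀ᶠ z : ℝ × ℝ in 𝓝 z₀, τ < z.2 - ε :=
        (continuous_snd.sub continuous_const).continuousAt.eventually_const_lt h
      have h1 : ContinuousAt (fun z : ℝ × ℝ => (z.2 - τ) ^ (α - 1)) z₀ :=
        (by fun_prop : ContinuousAt (fun z : ℝ × ℝ => z.2 - τ) z₀).rpow_const
          (Or.inl (by linarith))
      have h2 : Continuous fun z : ℝ × ℝ => profileAvg Φ (fun y => F y τ) (z.2 - τ) z.1 :=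
        (continuous_profileAvg hΦ (hF.continuous τ) fun y => hF.bound y τ).comp
          (by fun_prop : Continuous fun z : ℝ × ℝ => (z.2 - τ, z.1))
      refine (h1.mul h2.continuousAt).congr ?_
      filter_upwards [hev] with z hz
      rw [indicator_of_mem (mem_Iic.2 hz.le), Pi.mul_apply]
    · have hev : ∀ᶠ z : ℝ × ℝ in 𝓝 z₀, z.2 - ε < τ :=
        (continuous_snd.sub continuous_const).continuousAt.eventually_lt_const h
      refine (continuousAt_const (y := (0 : ℝ))).congr ?_
      filter_upwards [hev] with z hz
      rw [indicator_of_notMem (fun h => absurd (mem_Iic.1 h) (not_le.2 hz))]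

theorem abs_setIntegral_near_le (hα : 0 < α) (hΦ : Integrable Φ) (hF : HasMajorant F ρ)
    {t ε M : ℝ} (hε : 0 < ε) (hM : ∀ τ ∈ Ioo (t - ε) t, ρ τ ≤ M) (x : ℝ) :
    |∫ τ in Ioo (t - ε) t, (t - τ) ^ (α - 1) * profileAvg Φ (fun y => F y τ) (t - τ) x| ≤
      (∫ η, |Φ η|) * (ε ^ α / α * M) := by
  have hC : 0 ≤ ∫ η, |Φ η| := integral_nonneg fun _ => abs_nonneg _
  have h1 : IntervalIntegrable (fun s : ℝ => s ^ (α - 1)) volume 0 ε :=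
    intervalIntegral.intervalIntegrable_rpow' (by linarith)
  have h2 := (h1.comp_sub_left t).symm
  rw [sub_zero, intervalIntegrable_iff_integrableOn_Ioo_of_le (by linarith)] at h2
  have h3 : ∫ τ in Ioo (t - ε) t, (t - τ) ^ (α - 1) = ε ^ α / α := by
    rw [← integral_Ioc_eq_integral_Ioo, ← intervalIntegral.integral_of_le (by linarith),
      intervalIntegral.integral_comp_sub_left (fun s => s ^ (α - 1)), sub_self, sub_sub_cancel,
      integral_rpow (Or.inl (by linarith)), sub_add_cancel, Real.zero_rpow hα.ne', sub_zero]
  rw [← Real.norm_eq_abs, ← h3, ← integral_mul_const M, ← integral_const_mul]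
  refine norm_integral_le_of_norm_le (g := fun τ => (∫ η, |Φ η|) * ((t - τ) ^ (α - 1) * M))
    (Integrable.const_mul (Integrable.mul_const h2 M) _) ?_
  filter_upwards [ae_restrict_mem measurableSet_Ioo] with τ hτ
  refine (norm_duhamel_integrand_le hΦ hF hτ.2 x).trans ?_
  have : 0 ≤ t - τ := by linarith [hτ.2]
  gcongr
  exact hM τ hτ

theorem integrableOn_sub_rpow_mul_of_locallyBounded (hα : 0 < α) (hα1 : α < 1)
    (hF : HasMajorant F ρ) (hb : ∀ a b : ℝ, 0 < a → ∃ M, ∀ t ∈ Icc a b, ρ t ≤ M) {t : ℝ}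
    (ht : 0 < t) : IntegrableOn (fun τ => (t - τ) ^ (α - 1) * ρ τ) (Ioo 0 t) := by
  obtain ⟨M, hM⟩ := hb (t - t / 2) t (by linarith)
  exact (integrableOn_sub_rpow_mul_of_le hα hα1 hF (half_pos ht)
    fun τ hτ => hM τ (Ioo_subset_Icc_self hτ)).1

/-- Near a given point the Duhamel integral is uniformly approximated by its truncations: the
omitted piece is at most a constant times `ε^α` where the majorant is bounded. -/
theorem continuousOn_duhamelAvg (hα : 0 < α) (hα1 : α < 1) (hΦm : Measurable Φ)
    (hΦ : Integrable Φ) (hF : HasMajorant F ρ)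
    (hb : ∀ a b : ℝ, 0 < a → ∃ M, ∀ t ∈ Icc a b, ρ t ≤ M) (g : C₀(ℝ, ℝ)) :
    ContinuousOn (fun z : ℝ × ℝ => duhamelAvg α Φ F g z.1 z.2) (univ ×ˢ Ioi 0) := by
  intro z₀ hz₀
  have ht₀ : 0 < z₀.2 := hz₀.2
  refine ContinuousAt.continuousWithinAt ?_
  unfold duhamelAvg
  refine ContinuousAt.add ?_ ?_
  · refine ContinuousAt.mul (continuousAt_snd.rpow_const (Or.inl ht₀.ne')) ?_
    exact ((continuous_profileAvg hΦ g.continuous g.abs_apply_le).comp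
      (by fun_prop : Continuous fun z : ℝ × ℝ => (z.2, z.1))).continuousAt
  obtain ⟨M, hM⟩ := hb (z₀.2 / 4) (2 * z₀.2) (by linarith)
  have hM0 : 0 ≤ M := (hF.nonneg _).trans (hM z₀.2 ⟨by linarith, by linarith⟩)
  refine continuousAt_of_locally_uniform_approx_of_continuousAt fun u hu => ?_
  obtain ⟨η, hη, hηu⟩ := Metric.mem_uniformity_dist.1 hu
  have hlim : Tendsto (fun ε : ℝ => (∫ η, |Φ η|) * (ε ^ α / α * M)) (𝓝[>] 0) (𝓝 0) := by
    have h1 : Tendsto (fun ε : ℝ => ε ^ α) (𝓝[>] 0) (𝓝 0) := by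
      have := (Real.continuousAt_rpow_const 0 α (Or.inr hα.le)).tendsto
      rw [Real.zero_rpow hα.ne'] at this
      exact this.mono_left nhdsWithin_le_nhds
    simpa using ((h1.div_const α).mul_const M).const_mul (∫ η, |Φ η|)
  have hsmall : ∀ᶠ ε : ℝ in 𝓝[>] 0, ε < z₀.2 / 4 :=
    (eventually_lt_nhds (by linarith)).filter_mono nhdsWithin_le_nhds
  -- For times in `(t₀/2, 2t₀)` with `t₀ = z₀.2`, the choice `ε < t₀/4` keeps the omitted window
  -- inside `[t₀/4, 2t₀]`, where `M` bounds the majorant.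
  obtain ⟨ε, hεη, hε4, hε⟩ :=
    ((hlim.eventually_lt_const hη).and (hsmall.and self_mem_nhdsWithin)).exists
  have hε0 : 0 < ε := hε
  refine ⟨{z | z.2 ∈ Ioo (z₀.2 / 2) (2 * z₀.2)}, ?_, _,
    continuousAt_setIntegral_truncated hα1 hΦm hΦ hF hε0 (2 * z₀.2) z₀, fun z hz => hηu ?_⟩
  · exact continuousAt_snd.preimage_mem_nhds (Ioo_mem_nhds (by linarith) (by linarith))
  have hz1 : z₀.2 / 2 < z.2 := hz.1
  have hz2 : z.2 < 2 * z₀.2 := hz.2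
  have hint : IntegrableOn (fun τ => (z.2 - τ) ^ (α - 1) *
      profileAvg Φ (fun y => F y τ) (z.2 - τ) z.1) (Ioo 0 z.2) := by
    refine Integrable.mono' ((integrableOn_sub_rpow_mul_of_locallyBounded hα hα1 hF hb
      (by linarith : 0 < z.2)).const_mul (∫ η, |Φ η|))
      (measurable_duhamel_integrand hΦm hF z.2 z.1).aestronglyMeasurable ?_
    filter_upwards [ae_restrict_mem measurableSet_Ioo] with τ hτ
    exact norm_duhamel_integrand_le hΦ hF hτ.2 z.1
  have hset : Ioc 0 (2 * z₀.2) ∩ Iic (z.2 - ε) = Ioc 0 (z.2 - ε) := by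
    rw [Ioc_inter_Iic, min_eq_right (by linarith)]
  have hunion : Ioo 0 z.2 = Ioc 0 (z.2 - ε) ∪ Ioo (z.2 - ε) z.2 :=
    (Ioc_union_Ioo_eq_Ioo (by linarith) (by linarith)).symm
  rw [setIntegral_indicator measurableSet_Iic, hset, hunion, setIntegral_union
    (disjoint_left.2 fun τ h1 h2 => absurd h1.2 (not_le.2 h2.1)) measurableSet_Ioo
    (hint.mono_set (hunion ▸ subset_union_left)) (hint.mono_set (hunion ▸ subset_union_right)),
    Real.dist_eq, add_sub_cancel_left]
  exact (abs_setIntegral_near_le hα hΦ hF hε0 (fun τ hτ => hM τ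
    ⟨by linarith [hτ.1], by linarith [hτ.2]⟩) z.1).trans_lt hεη

/-- The transform identity at `ξ = 0`, `s = 1`: the symbol is `p + (1-p) = 1`, the Fourier factor is
the mass of `Φ`, and the Laplace integral is `Γ(α)`. -/
theorem Gamma_mul_integral_eq_one_of_laplace {p : ℝ}
    (hL : ∀ (ξ : ℝ) (s : ℂ), 0 < s.re → ∫ t in Ioi (0 : ℝ), Complex.exp (-(s * t)) *
      (((t ^ (α - 1) : ℝ) : ℂ) * fourierT (fun y => (Φ y : ℂ)) (ξ * t)) = 1 / symbolZeta α p ξ s)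
    (hα : 0 < α) : Real.Gamma α * ∫ η, Φ η = 1 := by
  have h := hL 0 1 (by simp)
  have e : ∀ t : ℝ, Complex.exp (-(1 * t)) * (((t ^ (α - 1) : ℝ) : ℂ) *
      fourierT (fun y => (Φ y : ℂ)) ((0 : ℝ) * t)) =
      ((Real.exp (-t) * t ^ (α - 1) * ∫ η, Φ η : ℝ) : ℂ) := by
    intro t
    have : fourierT (fun y => (Φ y : ℂ)) ((0 : ℝ) * t) = ((∫ η, Φ η : ℝ) : ℂ) := by
      simp [fourierT, integral_complex_ofReal]
    rw [this]
    push_cast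
    rw [one_mul, mul_assoc]
  simp_rw [e] at h
  rw [integral_complex_ofReal, integral_mul_const, ← Real.Gamma_eq_integral hα] at h
  simpa [symbolZeta, ← Complex.ofReal_mul, -Complex.ofReal_mul] using h

end

/-! ### The main theorem -/

theorem mainTheorem1 (α p : ℝ) (hα₀ : 0 < α) (hα₁ : α < 1) (hp₀ : 0 < p) (hp₁ : p < 1) :
    ∃ G : ℝ → ℝ → ℝ,
      IsInverseFourierLaplace (fun ξ s => 1 / symbolZeta α p ξ s) G ∧
      (∀ t, 0 < t → ∀ x, G t x = t ^ (α - 2) * G 1 (x / t)) ∧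
      MemLp (G 1) 1 volume ∧
      ∀ f : ℝ → ℝ → ℝ, IsExpTypeC0 f → ∀ g : C₀(ℝ, ℝ),
        -- Duhamel's formula converges and gives a mild solution
        (∀ᵐ t ∂(volume.restrict (Ioi (0 : ℝ))), ∀ x, DuhamelConverges G f x t) ∧
        IsMildSolution α p f g (duhamel G f g) ∧
        -- there is no other mild solution
        (∀ v : ℝ → ℝ → ℝ, IsMildSolution α p f g v →
          ∀ᵐ t ∂(volume.restrict (Ioi (0 : ℝ))), ∀ x, v x t = duhamel G f g x t) ∧
        -- no exceptional times if `f` is bounded on compact time intervals in `(0,∞)`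
        ((∀ a b : ℝ, 0 < a → ∃ M : ℝ, ∀ t ∈ Icc a b, ∀ x, |f x t| ≤ M) →
          (∀ t, 0 < t → (∀ x, DuhamelConverges G f x t) ∧
            ∃ h : C₀(ℝ, ℝ), ∀ x, h x = duhamel G f g x t) ∧
          ContinuousOn (fun z : ℝ × ℝ => duhamel G f g z.1 z.2) (univ ×ˢ Ioi 0)) := by
  have hΦm := measurable_profile hα₀ hα₁ p
  have hΦ := integrable_profile hα₀ hα₁ p
  have hL : ∀ (ξ : ℝ) (s : ℂ), 0 < s.re → ∫ t in Ioi (0 : ℝ), Complex.exp (-(s * t)) *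
      (((t ^ (α - 1) : ℝ) : ℂ) * fourierT (fun y => (profile α p y : ℂ)) (ξ * t)) =
        1 / symbolZeta α p ξ s := fun ξ _ hs => laplace_fourierT_profile hα₀ hα₁ hp₀ hp₁ ξ hs
  have hone : ∀ x, selfSimilar α (profile α p) 1 x = profile α p x := fun x => by
    rw [selfSimilar, Real.one_rpow, one_mul, div_one]
  refine ⟨selfSimilar α (profile α p), isInverseFourierLaplace_selfSimilar hα₀ hΦ hL,
    fun t _ x => ?_, ?_, fun f hf g => ?_⟩
  · rw [hone, selfSimilar]
  · rw [funext hone]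
    exact memLp_one_iff_integrable.2 hΦ
  obtain ⟨F, ρ, hF, hFf, hρ⟩ := hf.exists_hasMajorant
  have huv : ∀ t, 0 < t → ∀ x, duhamelAvg α (profile α p) F g x t =
      duhamel (selfSimilar α (profile α p)) f g x t := fun t ht x =>
    (duhamel_selfSimilar_eq α _ g hFf ht x).symm
  have hu : IsMildSolution α p f g (duhamel (selfSimilar α (profile α p)) f g) :=
    (isMildSolution_duhamelAvg hα₀ hα₁ hp₀ hp₁ hΦm hΦ hL
      (Gamma_mul_integral_eq_one_of_laplace hL hα₀) hF g).congr hFf huv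
  refine ⟨?_, hu, fun v hv => hv.ae_eq hα₀ hα₁ hp₀ hp₁ hu, fun hb => ?_⟩
  · filter_upwards [ae_restrict_of_ae (hF.ae_integrableOn_sub_rpow_mul hα₀)] with t ht x
    exact (duhamelConverges_of_integrableOn hΦm hΦ hF ht x).congr hFf
  have hb' : ∀ a b : ℝ, 0 < a → ∃ M, ∀ t ∈ Icc a b, ρ t ≤ M := fun a b ha => by
    obtain ⟨M, hM⟩ := hb a b ha
    -- The given bound may be negative when the time interval is empty, while the comparison with
    -- `ρ` asks for a nonnegative one.
    exact ⟨max M 0, fun t ht => hρ t _ (le_max_right _ _) fun x =>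
      (hM t ht x).trans (le_max_left _ _)⟩
  refine ⟨fun t ht => ?_, ?_⟩
  · have hi := integrableOn_sub_rpow_mul_of_locallyBounded hα₀ hα₁ hF hb' ht
    obtain ⟨h, hh⟩ := exists_zeroAtInfty_duhamelAvg hΦm hΦ hF g hi
    exact ⟨fun x => (duhamelConverges_of_integrableOn hΦm hΦ hF hi x).congr hFf, h,
      fun x => (hh x).trans (huv t ht x)⟩
  · exact (continuousOn_duhamelAvg hα₀ hα₁ hΦm hΦ hF hb' g).congr fun z hz =>
      (huv z.2 hz.2 z.1).symm
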